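/- Let $N\ge 2$, $p\ge 2$, $s_1\in(0,1)$ and $s_p\in\left(0,\frac{p-1}{p}\right]$, and let $\Omega\subset\mathbb{R}^N$ be a bounded domain. For $s\in(0,1)$, $q\ge1$ and open $A\subset\mathbb{R}^N$ put $$[w]_{W^{s,q}(A)}:=\left(\int_A\int_A\frac{|w(x)-w(y)|^q}{|x-y|^{N+sq}}\,dx\,dy\right)^{1/q},$$ and let $W^{s,q}(A)$ be the space of all $w\in L^q(A)$ with $[w]_{W^{s,q}(A)}<\infty$. Let $u$ be a locally bounded (that is, $u\in L^\infty_{\mathrm{loc}}(\Omega)$) weak solution of $$(-\Delta_1)^{s_1}u+(-\Delta_p)^{s_p}u=0\quad\text{in }\Omega,$$ which means that $u:\mathbb{R}^N\to\mathbb{R}$ is measurable, $u\in W^{s_1,1}_{\mathrm{loc}}(\Omega)\cap W^{s_p,p}_{\mathrm{loc}}(\Omega)$, $\int_{\mathbb{R}^N}\frac{|u(x)|^{p-1}}{(1+|x|)^{N+s_pp}}\,dx<\infty$, and there is $Z\in L^\infty(\mathbb{R}^N\times\mathbb{R}^N)$ with $Z(x,y)\in\mathrm{sgn}(u(x)-u(y))$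 for a.e. $(x,y)$, where $\mathrm{sgn}(t)=\{t/|t|\}$ for $t\ne0$ and $\mathrm{sgn}(0)=[-1,1]$, such that $$0=\int_{\mathbb{R}^N}\int_{\mathbb{R}^N}Z(x,y)\frac{\varphi(x)-\varphi(y)}{|x-y|^{N+s_1}}\,dx\,dy+\int_{\mathbb{R}^N}\int_{\mathbb{R}^N}\frac{|u(x)-u(y)|^{p-2}(u(x)-u(y))(\varphi(x)-\varphi(y))}{|x-y|^{N+s_pp}}\,dx\,dy$$ for every $\varphi\in W^{s_1,1}(\mathbb{R}^N)\cap W^{s_p,p}(\mathbb{R}^N)$ with compact support in $\Omega$. Then (after modification on a null set) $u\in C^{0,\gamma}_{\mathrm{loc}}(\Omega)$ for every $\gamma\in\left(0,\frac{s_pp}{p-1}\right)$, that is, for every ball $B$ with $\overline{B}\subset\Omega$, $$[u]_{C^{0,\gamma}(B)}:=\sup_{x,y\in B,\,x\ne y}\frac{|u(x)-u(y)|}{|x-y|^\gamma}<\infty.$$ Moreover, for every such $\gamma$ there are constants $C$ and $\kappa$, depending only on $N,p,s_1,s_p,\gamma$, such that for every ball $B_R=B_R(x_0)$ with $\overline{B_R}\subset\Omega$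 and $R\in(0,1)$, and every $r\in(0,R)$, with $B_r=B_r(x_0)$, $$[u]_{C^{0,\gamma}(B_r)}\le\frac{C\left(\mathcal{T}+[u]_{W^{s_p,p}(B_R)}+1\right)}{(R-r)^\kappa},$$ where $$\mathcal{T}:=\|u\|_{L^\infty(B_R(x_0))}+\left(R^{s_pp}\int_{\mathbb{R}^N\setminus B_R(x_0)}\frac{|u(x)|^{p-1}}{|x-x_0|^{N+s_pp}}\,dx\right)^{\frac1{p-1}}.$$ -/

import Mathlib

open MeasureTheory
open scoped ENNReal

noncomputable section

/-- The Euclidean space `ℝ^N`. -/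
abbrev RN (N : ℕ) : Type := EuclideanSpace ℝ (Fin N)

/-- `A ⊂⊂ Ω`: the closure of `A` is a compact subset of `Ω`. -/
def CompactlyIn {N : ℕ} (A Ω : Set (RN N)) : Prop :=
  IsCompact (closure A) ∧ closure A ⊆ Ω

/-- The Gagliardo seminorm `[w]_{W^{s,q}(A)}`, with values in `[0,∞]`. -/
def gagliardo {N : ℕ} (s q : ℝ) (A : Set (RN N)) (w : RN N → ℝ) : ℝ≥0∞ :=
  (∫⁻ z in A ×ˢ A,
    ENNReal.ofReal (|w z.1 - w z.2| ^ q / ‖z.1 - z.2‖ ^ ((N : ℝ) + s * q))) ^ (1 / q)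

/-- `w ∈ W^{s,q}(A)`. -/
def MemSobolev {N : ℕ} (s q : ℝ) (A : Set (RN N)) (w : RN N → ℝ) : Prop :=
  MemLp w (ENNReal.ofReal q) (volume.restrict A) ∧ gagliardo s q A w < ∞

/-- `w ∈ W^{s,q}_loc(Ω)`. -/
def MemSobolevLoc {N : ℕ} (s q : ℝ) (Ω : Set (RN N)) (w : RN N → ℝ) : Prop :=
  ∀ U : Set (RN N), IsOpen U → CompactlyIn U Ω → MemSobolev s q U w

/-- `w ∈ L^∞_loc(Ω)`. -/
def LocallyBoundedOn {N : ℕ} (Ω : Set (RN N)) (w : RN N → ℝ) : Prop :=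
  ∀ U : Set (RN N), IsOpen U → CompactlyIn U Ω → MemLp w ∞ (volume.restrict U)

/-- The tail space `L^q_a(ℝ^N)`. Membership in `L^q_loc(ℝ^N)` is contained in the finiteness of the
integral, because the weight is bounded below on bounded sets. -/
def MemTailSpace {N : ℕ} (q a : ℝ) (w : RN N → ℝ) : Prop :=
  AEStronglyMeasurable w volume ∧
    ∫⁻ x, ENNReal.ofReal (|w x| ^ q / (1 + ‖x‖) ^ ((N : ℝ) + a)) < ∞

/-- `Tail(w; x₀, R)`, with values in `[0,∞]`. -/
def tail {N : ℕ} (s p : ℝ) (w : RN N → ℝ) (x₀ : RN N) (R : ℝ) : ℝ≥0∞ :=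
  (ENNReal.ofReal (R ^ (s * p)) *
    ∫⁻ x in (Metric.ball x₀ R)ᶜ,
      ENNReal.ofReal (|w x| ^ (p - 1) / ‖x - x₀‖ ^ ((N : ℝ) + s * p))) ^ (1 / (p - 1))

/-- The quantity `𝒯 = ‖w‖_{L^∞(B_R(x₀))} + Tail(w; x₀, R)`. -/
def supTail {N : ℕ} (s p : ℝ) (w : RN N → ℝ) (x₀ : RN N) (R : ℝ) : ℝ≥0∞ :=
  eLpNorm w ∞ (volume.restrict (Metric.ball x₀ R)) + tail s p w x₀ R

/-- The Hölder seminorm `[w]_{C^{0,γ}(A)}`, with values in `[0,∞]`. -/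
def holderSeminorm {N : ℕ} (γ : ℝ) (A : Set (RN N)) (w : RN N → ℝ) : ℝ≥0∞ :=
  ⨆ (x ∈ A) (y ∈ A) (_ : x ≠ y), ENNReal.ofReal (|w x - w y| / ‖x - y‖ ^ γ)

/-- `w ∈ C^{0,γ}_loc(Ω)`: on every ball compactly contained in `Ω` the Hölder seminorm is finite. -/
def MemHolderLoc {N : ℕ} (γ : ℝ) (Ω : Set (RN N)) (w : RN N → ℝ) : Prop :=
  ∀ (x₀ : RN N) (R : ℝ), 0 < R → CompactlyIn (Metric.ball x₀ R) Ω →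
    holderSeminorm γ (Metric.ball x₀ R) w < ∞

/-- The set-valued sign function: `sgn 0 = [-1,1]`. -/
def sgnSet (t : ℝ) : Set ℝ :=
  if t = 0 then Set.Icc (-1) 1 else {t / |t|}

/-- Test functions: elements of `W^{s₁,1} ∩ W^{s_p,p}` with compact support in `Ω`, extended by zero
to the whole space. For these both integrals in the weak formulation converge absolutely when `u` is
only locally of class `W^{s_p,p}` in `Ω`. -/
def IsTestFunction {N : ℕ} (p s₁ sp : ℝ) (Ω : Set (RN N)) (φ : RN N → ℝ) : Prop :=
  MemSobolev s₁ 1 Set.univ φ ∧ MemSobolev sp p Set.univ φ ∧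
    HasCompactSupport φ ∧ tsupport φ ⊆ Ω

/-- `u` is a weak solution of `(-Δ₁)^{s₁} u + (-Δ_p)^{s_p} u = 0` in `Ω`. -/
def IsWeakSolution {N : ℕ} (p s₁ sp : ℝ) (Ω : Set (RN N)) (u : RN N → ℝ) : Prop :=
  MemSobolevLoc s₁ 1 Ω u ∧ MemSobolevLoc sp p Ω u ∧ MemTailSpace (p - 1) (sp * p) u ∧
    ∃ Z : RN N × RN N → ℝ,
      MemLp Z ∞ volume ∧
      (∀ᵐ z : RN N × RN N, Z z ∈ sgnSet (u z.1 - u z.2)) ∧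
      ∀ φ : RN N → ℝ, IsTestFunction p s₁ sp Ω φ →
        0 = (∫ z : RN N × RN N, Z z * (φ z.1 - φ z.2) / ‖z.1 - z.2‖ ^ ((N : ℝ) + s₁)) +
          ∫ z : RN N × RN N,
            |u z.1 - u z.2| ^ (p - 2) * (u z.1 - u z.2) * (φ z.1 - φ z.2) /
              ‖z.1 - z.2‖ ^ ((N : ℝ) + sp * p)

end

/-! The regularity comes from differentiating the equation discretely. Translation, dilation and
division by a constant turn `u` near an interior point into a solution on the ball of radius 2 whose
supremum there, tail and `p`-energy are at most one. Its sign term carries a factor `ε ∈ [0,1]`,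
because the two operators scale differently (`NormalizedSolution`). All estimates for such functions
are uniform in `u`.

Write `δ` for the difference `u(· + h) - u`. Subtract the equation for `u` from its translate by `h`
and test with `|δ|^k δ ζ²`, `ζ` a cutoff. The sign term yields no regularity but does no harm: the
sign graph is monotone, so its main part has the good sign, and only a commutator with `ζ` remains,
integrable near the diagonal because `s₁ < 1`. The `p`-term is coercive. Hence, if the differences
of `u` have size `‖h‖^α` in `L^q` with `q = p + k`, the near-diagonal energy of `δ` with exponent
`q` and kernel `‖x - y‖^{-N - sp p}` is at most a multiple of `‖h‖^{α(k+1)}`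
(`exists_energy_estimate`). Differencing once more gives second differences of order `α'`, where `α'
q = α(k+1) + sp p`, and below order one second differences control first ones
(`NikolskiiBound.improve`).

The affine map `α ↦ α'` has fixed point `σ = sp p/(p-1)` and contraction factor `(k+1)/q < 1`. The
assumption `sp ≤ (p-1)/p` says exactly `σ ≤ 1`, so the iterates stay below one and converge to `σ`
(`exists_nikolskiiBound`). The iteration starts from order `sp` in a large `L^q`: the energy gives
it in `L^p`, and boundedness of `u` trades each gain of order for a larger exponent
(`nikolskiiBound_sobolev`). Once `α - N/q > γ`, a Morrey argument on ball averages (`exists_morrey`)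
gives the Hölder bound at Lebesgue points. Scaling back yields the power of `R - r`, and density of
the Lebesgue points gives a continuous representative that does not depend on `γ`. -/

/-! ### Pointwise inequalities for odd powers and the sign graph. -/

/-- The odd power `|t|^b t`. -/
noncomputable def oddPow (b t : ℝ) : ℝ := |t| ^ b * t

lemma measurable_oddPow (b : ℝ) : Measurable (oddPow b) := by
  unfold oddPow; fun_prop

lemma abs_oddPow {b : ℝ} (hb : 0 ≤ b) (t : ℝ) : |oddPow b t| = |t| ^ (b + 1) := by
  rw [oddPow, abs_mul, abs_of_nonneg (Real.rpow_nonneg (abs_nonneg t) b)]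
  rw [Real.rpow_add_one' (abs_nonneg t) (by positivity)]

lemma oddPow_neg (b t : ℝ) : oddPow b (-t) = -oddPow b t := by
  simp [oddPow]

/-- The two sides differ by half of `(|s|^b - |t|^b)(s² - t²)`, whose factors have the same sign. -/
lemma oddPow_sub_mul_sub_ge {b : ℝ} (hb : 0 ≤ b) (s t : ℝ) :
    (|s| ^ b + |t| ^ b) * (s - t) ^ 2 / 2 ≤ (oddPow b s - oddPow b t) * (s - t) := by
  have key : 0 ≤ (|s| ^ b - |t| ^ b) * (s ^ 2 - t ^ 2) := by
    rcases le_total |s| |t| with h | h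
    · have h1 := Real.rpow_le_rpow (abs_nonneg s) h hb
      have h2 : s ^ 2 ≤ t ^ 2 := sq_le_sq.mpr h
      nlinarith
    · have h1 := Real.rpow_le_rpow (abs_nonneg t) h hb
      have h2 : t ^ 2 ≤ s ^ 2 := sq_le_sq.mpr h
      nlinarith
  unfold oddPow
  nlinarith

lemma oddPow_sub_mul_sub_nonneg {b : ℝ} (hb : 0 ≤ b) (s t : ℝ) :
    0 ≤ (oddPow b s - oddPow b t) * (s - t) :=
  le_trans (by positivity) (oddPow_sub_mul_sub_ge hb s t)

lemma abs_oddPow_sub_ge' {b : ℝ} (hb : 0 ≤ b) (s t : ℝ) :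
    (|s| ^ b + |t| ^ b) * |s - t| / 2 ≤ |oddPow b s - oddPow b t| := by
  rcases eq_or_ne s t with rfl | hne
  · simp
  have hpos : 0 < |s - t| := abs_pos.mpr (sub_ne_zero.mpr hne)
  have h := oddPow_sub_mul_sub_ge hb s t
  have h2 := le_abs_self ((oddPow b s - oddPow b t) * (s - t))
  rw [abs_mul] at h2
  have h3 : (s - t) ^ 2 = |s - t| * |s - t| := by rw [← sq, sq_abs]
  rw [h3] at h
  refine le_of_mul_le_mul_right ?_ hpos
  nlinarith

lemma abs_sub_rpow_le {b : ℝ} (hb : 0 ≤ b) (s t : ℝ) :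
    |s - t| ^ b ≤ 2 ^ b * (|s| ^ b + |t| ^ b) := by
  have h0 : |s - t| ≤ 2 * max |s| |t| := by
    have := abs_sub s t
    have h1 := le_max_left |s| |t|
    have h2 := le_max_right |s| |t|
    linarith
  have hm : 0 ≤ max |s| |t| := le_trans (abs_nonneg s) (le_max_left _ _)
  calc |s - t| ^ b ≤ (2 * max |s| |t|) ^ b := Real.rpow_le_rpow (abs_nonneg _) h0 hb
    _ = 2 ^ b * (max |s| |t|) ^ b := Real.mul_rpow (by norm_num) hm
    _ ≤ _ := by
      gcongr
      have e1 := Real.rpow_nonneg (abs_nonneg s) b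
      have e2 := Real.rpow_nonneg (abs_nonneg t) b
      rcases max_choice |s| |t| with h | h <;> rw [h] <;> linarith

lemma abs_oddPow_sub_ge {b : ℝ} (hb : 0 ≤ b) (s t : ℝ) :
    |s - t| ^ (b + 1) / (2 * 2 ^ b) ≤ |oddPow b s - oddPow b t| := by
  refine le_trans ?_ (abs_oddPow_sub_ge' hb s t)
  have h2 : (0 : ℝ) < 2 ^ b := by positivity
  rw [Real.rpow_add_one' (abs_nonneg _) (by positivity), div_le_div_iff₀ (by positivity) (by norm_num)]
  have := mul_le_mul_of_nonneg_right (abs_sub_rpow_le hb s t) (abs_nonneg (s - t))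
  nlinarith

/-- Bernoulli's inequality for the exponent `b + 1` at `t / s - 1`. -/
lemma rpow_sub_rpow_le {b s t : ℝ} (hb : 0 ≤ b) (ht : 0 ≤ t) (hts : t ≤ s) :
    s ^ b * s - t ^ b * t ≤ (b + 1) * s ^ b * (s - t) := by
  rcases eq_or_lt_of_le (ht.trans hts) with h0 | h0
  · have : t = 0 := by linarith
    simp [this, ← h0]
  have hx := one_add_mul_self_le_rpow_one_add (s := t / s - 1) (by
    have : 0 ≤ t / s := by positivity
    linarith) (p := b + 1) (by linarith)
  rw [add_sub_cancel, Real.div_rpow ht h0.le, Real.rpow_add_one' ht (by positivity),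
    Real.rpow_add_one' h0.le (by positivity)] at hx
  have hs : 0 < s ^ b * s := by positivity
  rw [le_div_iff₀ hs] at hx
  have : (1 + (b + 1) * (t / s - 1)) * (s ^ b * s) = s ^ b * s + (b + 1) * s ^ b * (t - s) := by
    field_simp
  nlinarith

/-- For equal signs this is `rpow_sub_rpow_le`; for opposite signs the bound already holds with
factor one; oddness reduces the remaining cases to these. -/
lemma abs_oddPow_sub_le {b : ℝ} (hb : 0 ≤ b) (s t : ℝ) :
    |oddPow b s - oddPow b t| ≤ (b + 1) * (|s| ^ b + |t| ^ b) * |s - t| := by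
  have main : ∀ s t : ℝ, t ≤ s → 0 ≤ s →
      oddPow b s - oddPow b t ≤ (b + 1) * (|s| ^ b + |t| ^ b) * (s - t) := by
    intro s t hts hs
    have e1 := Real.rpow_nonneg (abs_nonneg s) b
    have e2 := Real.rpow_nonneg (abs_nonneg t) b
    rcases le_total 0 t with ht | ht
    · have := rpow_sub_rpow_le hb ht hts
      unfold oddPow
      have h3 : 0 ≤ |t| ^ b * (s - t) := mul_nonneg e2 (by linarith)
      rw [abs_of_nonneg hs, abs_of_nonneg ht] at *
      nlinarith
    · unfold oddPow
      have h1 : 0 ≤ |s| ^ b * (-t) := mul_nonneg e1 (by linarith)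
      have h2 : 0 ≤ |t| ^ b * s := mul_nonneg e2 hs
      have h3 : 0 ≤ b * ((|s| ^ b + |t| ^ b) * (s - t)) :=
        mul_nonneg hb (mul_nonneg (by linarith) (by linarith))
      nlinarith
  have main2 : ∀ s t : ℝ, t ≤ s →
      oddPow b s - oddPow b t ≤ (b + 1) * (|s| ^ b + |t| ^ b) * (s - t) := by
    intro s t hts
    rcases le_total 0 s with hs | hs
    · exact main s t hts hs
    · have := main (-t) (-s) (by linarith) (by linarith)
      rw [oddPow_neg, oddPow_neg, abs_neg, abs_neg] at this
      linarith
  have hmono : ∀ s t : ℝ, t ≤ s → 0 ≤ oddPow b s - oddPow b t := by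
    intro s t hts
    rcases eq_or_lt_of_le hts with rfl | hlt
    · simp
    · exact nonneg_of_mul_nonneg_left (oddPow_sub_mul_sub_nonneg hb s t) (by linarith)
  rcases le_total t s with h | h
  · rw [abs_of_nonneg (hmono s t h), abs_of_nonneg (sub_nonneg.mpr h)]
    exact main2 s t h
  · rw [abs_sub_comm, abs_sub_comm s, abs_of_nonneg (hmono t s h), abs_of_nonneg (sub_nonneg.mpr h),
      add_comm (|s| ^ b)]
    exact main2 t s h

lemma abs_le_one_of_mem_sgnSet {z t : ℝ} (h : z ∈ sgnSet t) : |z| ≤ 1 := by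
  unfold sgnSet at h
  split_ifs at h with h0
  · exact abs_le.mpr h
  · rw [Set.mem_singleton_iff] at h
    rw [h, abs_div, abs_abs, div_self (abs_ne_zero.mpr h0)]

lemma mul_eq_abs_of_mem_sgnSet {z t : ℝ} (h : z ∈ sgnSet t) : z * t = |t| := by
  unfold sgnSet at h
  split_ifs at h with h0
  · simp [h0]
  · rw [Set.mem_singleton_iff] at h
    rw [h]
    have : |t| ≠ 0 := abs_ne_zero.mpr h0
    field_simp
    rw [sq_abs]

/-- `sgnSet` is the subdifferential of the absolute value: `z₁ a = |a|` while `z₁ b ≤ |b|`, and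
symmetrically. This is the only structure of the sign term beyond boundedness that the estimates
use. -/
lemma sgnSet_monotone {z₁ z₂ a b : ℝ} (h₁ : z₁ ∈ sgnSet a) (h₂ : z₂ ∈ sgnSet b) :
    0 ≤ (z₁ - z₂) * (a - b) := by
  have e1 := mul_eq_abs_of_mem_sgnSet h₁
  have e2 := mul_eq_abs_of_mem_sgnSet h₂
  have e3 : z₂ * a ≤ |a| := by
    have := le_abs_self (z₂ * a)
    rw [abs_mul] at this
    nlinarith [abs_le_one_of_mem_sgnSet h₂, abs_nonneg a]
  have e4 : z₁ * b ≤ |b| := by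
    have := le_abs_self (z₁ * b)
    rw [abs_mul] at this
    nlinarith [abs_le_one_of_mem_sgnSet h₁, abs_nonneg b]
  nlinarith

/-- Two numbers having the same sign as a common third one multiply nonnegatively. -/
lemma mul_nonneg_of_mul_sub_nonneg {D t : ℝ} {b X Y : ℝ} (hb : 0 ≤ b) (ht : t = X - Y)
    (hD : 0 ≤ D * t) : 0 ≤ D * (oddPow b X - oddPow b Y) := by
  rcases eq_or_ne t 0 with h0 | h0
  · have : X = Y := by linarith
    simp [this]
  · have h1 := oddPow_sub_mul_sub_nonneg hb X Y
    rw [← ht] at h1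
    have h2 : 0 < t ^ 2 := by positivity
    refine nonneg_of_mul_nonneg_left (b := t ^ 2) ?_ h2
    have := mul_nonneg hD h1
    nlinarith

/-- A crude Young inequality: replace the smaller base by the larger one. -/
lemma rpow_mul_rpow_le_add {a b q θ : ℝ} (ha : 0 ≤ a) (hb : 0 ≤ b) (h0 : 0 ≤ θ) (h1 : θ ≤ q) :
    a ^ θ * b ^ (q - θ) ≤ a ^ q + b ^ q := by
  have hq : 0 ≤ q := h0.trans h1
  have key : ∀ m : ℝ, 0 ≤ m → m ^ θ * m ^ (q - θ) ≤ m ^ q := by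
    intro m hm
    rcases eq_or_lt_of_le h0 with h | h
    · simp [← h]
    · rw [← Real.rpow_add' hm (by linarith)]; simp
  have e1 := Real.rpow_nonneg ha q
  have e2 := Real.rpow_nonneg hb q
  rcases le_total a b with h | h
  · have : a ^ θ * b ^ (q - θ) ≤ b ^ θ * b ^ (q - θ) := by
      gcongr
    linarith [key b hb]
  · have : a ^ θ * b ^ (q - θ) ≤ a ^ θ * a ^ (q - θ) := by
      gcongr
    linarith [key a ha]

/-- Symmetrization: the first summand is the monotone main part with the cutoff as a weight, the
second is the commutator with the cutoff. -/
lemma oddPow_mul_sub_decomp (D Jx Jy zx zy : ℝ) :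
    D * (Jx * zx ^ 2 - Jy * zy ^ 2) =
      D * (Jx - Jy) * (zx ^ 2 + zy ^ 2) / 2 + D * (Jx + Jy) * (zx ^ 2 - zy ^ 2) / 2 := by
  ring

/-- The main part is nonnegative by monotonicity and is discarded; the commutator is bounded through
`|z₁ - z₂| ≤ 2`. In the application `a`, `b` are increments of the translated and the original
function between two points, and `X`, `Y` are the `h`-differences at these points, so that `a - b =
X - Y`. -/
lemma sgn_part_ge {z₁ z₂ a b X Y zx zy k : ℝ} (hk : 0 ≤ k) (h₁ : z₁ ∈ sgnSet a) (h₂ : z₂ ∈ sgnSet b)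
    (ht : a - b = X - Y) (hzx : zx ∈ Set.Icc (0 : ℝ) 1) (hzy : zy ∈ Set.Icc (0 : ℝ) 1) :
    -(2 * (|X| ^ (k + 1) + |Y| ^ (k + 1)) * |zx - zy|) ≤
      (z₁ - z₂) * (oddPow k X * zx ^ 2 - oddPow k Y * zy ^ 2) := by
  rw [oddPow_mul_sub_decomp]
  have h1 : 0 ≤ (z₁ - z₂) * (oddPow k X - oddPow k Y) :=
    mul_nonneg_of_mul_sub_nonneg hk ht (sgnSet_monotone h₁ h₂)
  have h1' := mul_nonneg h1 (by positivity : 0 ≤ zx ^ 2 + zy ^ 2)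
  have h2 : |z₁ - z₂| ≤ 2 := by
    have := abs_sub z₁ z₂
    linarith [abs_le_one_of_mem_sgnSet h₁, abs_le_one_of_mem_sgnSet h₂]
  have h3 : |oddPow k X + oddPow k Y| ≤ |X| ^ (k + 1) + |Y| ^ (k + 1) := by
    have := abs_add_le (oddPow k X) (oddPow k Y)
    rwa [abs_oddPow hk, abs_oddPow hk] at this
  have h4 : |zx ^ 2 - zy ^ 2| ≤ 2 * |zx - zy| := by
    have : zx ^ 2 - zy ^ 2 = (zx + zy) * (zx - zy) := by ring
    rw [this, abs_mul]
    gcongr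
    rw [abs_of_nonneg (by linarith [hzx.1, hzy.1])]
    linarith [hzx.2, hzy.2]
  have h5 : |(z₁ - z₂) * (oddPow k X + oddPow k Y) * (zx ^ 2 - zy ^ 2)| ≤
      2 * (|X| ^ (k + 1) + |Y| ^ (k + 1)) * (2 * |zx - zy|) := by
    rw [abs_mul, abs_mul]
    gcongr
  have := neg_abs_le ((z₁ - z₂) * (oddPow k X + oddPow k Y) * (zx ^ 2 - zy ^ 2))
  linarith

/-- Completing the square with weight `t`: the first term can be absorbed by coercivity, and the
factor `1 / t` in the second is later compensated by `|D| ≲ t`. -/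
lemma young_cutoff {t σ S : ℝ} (ht : 0 < t) (hσ : σ ^ 2 ≤ 2 * S) (M d : ℝ) :
    M * (σ * d) / 2 ≤ t * S / 8 + 2 * (M ^ 2 * d ^ 2) / t := by
  have h1 : t * S / 8 + 2 * (M ^ 2 * d ^ 2) / t - M * (σ * d) / 2 =
      (t * (2 * S - σ ^ 2) / 16) + ((t * σ / 4 - M * d) ^ 2 + (M * d) ^ 2) / t := by
    field_simp
    ring
  have h2 : 0 ≤ (t * (2 * S - σ ^ 2) / 16) + ((t * σ / 4 - M * d) ^ 2 + (M * d) ^ 2) / t := by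
    have : 0 ≤ 2 * S - σ ^ 2 := by linarith
    positivity
  linarith

/-- The main part is the product of `|D|` and the difference of the `k`-powers. Half of it stays on
the left, where the two lower bounds for odd powers give the power `m + k + 2` of `|X - Y|`; the
other half absorbs the commutator by `young_cutoff`. The error keeps `(zx - zy)^2`, quadratic in the
cutoff. -/
lemma p_part_ge {m a b X Y zx zy k : ℝ} (hm : 0 ≤ m) (hk : 0 ≤ k) (ht : a - b = X - Y)
    (hzx : 0 ≤ zx) (hzy : 0 ≤ zy) :
    |X - Y| ^ (m + k + 2) * (zx ^ 2 + zy ^ 2) / (16 * 2 ^ m * 2 ^ k) -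
      4 * (m + 1) * (|a| ^ m + |b| ^ m) * (|X| ^ (k + 2) + |Y| ^ (k + 2)) * (zx - zy) ^ 2 ≤
      (oddPow m a - oddPow m b) * (oddPow k X * zx ^ 2 - oddPow k Y * zy ^ 2) := by
  rw [oddPow_mul_sub_decomp]
  set D := oddPow m a - oddPow m b with hD
  set A := |a| ^ m + |b| ^ m with hA
  set t := X - Y with htd
  have hA0 : 0 ≤ A := by positivity
  have hDt : 0 ≤ D * t := by rw [← ht]; exact oddPow_sub_mul_sub_nonneg hm a b
  have hDJ : 0 ≤ D * (oddPow k X - oddPow k Y) := mul_nonneg_of_mul_sub_nonneg hk htd hDt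
  have hDJ' : D * (oddPow k X - oddPow k Y) = |D| * |oddPow k X - oddPow k Y| := by
    rw [← abs_mul, abs_of_nonneg hDJ]
  have hDle : |D| ≤ (m + 1) * A * |t| := by rw [← ht]; exact abs_oddPow_sub_le hm a b
  have hDge : |t| ^ (m + 1) / (2 * 2 ^ m) ≤ |D| := by rw [← ht]; exact abs_oddPow_sub_ge hm a b
  have hJge : |t| ^ (k + 1) / (2 * 2 ^ k) ≤ |oddPow k X - oddPow k Y| := abs_oddPow_sub_ge hk X Y
  set B := |X| ^ k + |Y| ^ k with hB
  have hB0 : 0 ≤ B := by positivity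
  have hJge' : B * |t| / 2 ≤ |oddPow k X - oddPow k Y| := abs_oddPow_sub_ge' hk X Y
  set M := max |X| |Y| with hM
  have hM0 : 0 ≤ M := le_trans (abs_nonneg X) (le_max_left _ _)
  have hXM : |X| ≤ M := le_max_left _ _
  have hYM : |Y| ≤ M := le_max_right _ _
  have hJsum : |oddPow k X + oddPow k Y| ≤ B * M := by
    have := abs_add_le (oddPow k X) (oddPow k Y)
    rw [abs_oddPow hk, abs_oddPow hk, Real.rpow_add_one' (abs_nonneg X) (by positivity),
      Real.rpow_add_one' (abs_nonneg Y) (by positivity)] at this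
    have e1 := mul_le_mul_of_nonneg_left hXM (Real.rpow_nonneg (abs_nonneg X) k)
    have e2 := mul_le_mul_of_nonneg_left hYM (Real.rpow_nonneg (abs_nonneg Y) k)
    rw [hB]; linarith
  have hBM : B * M ^ 2 ≤ 2 * (|X| ^ (k + 2) + |Y| ^ (k + 2)) := by
    have hBle : B ≤ 2 * M ^ k := by
      have e1 := Real.rpow_le_rpow (abs_nonneg X) hXM hk
      have e2 := Real.rpow_le_rpow (abs_nonneg Y) hYM hk
      rw [hB]; linarith
    have hMk : M ^ k * M ^ 2 = M ^ (k + 2) := by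
      rw [← Real.rpow_natCast M 2, ← Real.rpow_add' hM0 (by positivity)]; norm_num
    have hMle : M ^ (k + 2) ≤ |X| ^ (k + 2) + |Y| ^ (k + 2) := by
      have e1 := Real.rpow_nonneg (abs_nonneg X) (k + 2)
      have e2 := Real.rpow_nonneg (abs_nonneg Y) (k + 2)
      rcases max_choice |X| |Y| with h | h <;> rw [hM, h] <;> linarith
    calc B * M ^ 2 ≤ 2 * M ^ k * M ^ 2 := by gcongr
      _ = 2 * M ^ (k + 2) := by rw [mul_assoc, hMk]
      _ ≤ _ := by linarith
  have hmain : |t| ^ (m + k + 2) / (4 * 2 ^ m * 2 ^ k) ≤ |D| * |oddPow k X - oddPow k Y| := by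
    have : |t| ^ (m + k + 2) = |t| ^ (m + 1) * |t| ^ (k + 1) := by
      rw [← Real.rpow_add' (abs_nonneg t) (by positivity)]; ring_nf
    rw [this]
    calc |t| ^ (m + 1) * |t| ^ (k + 1) / (4 * 2 ^ m * 2 ^ k)
        = |t| ^ (m + 1) / (2 * 2 ^ m) * (|t| ^ (k + 1) / (2 * 2 ^ k)) := by
          field_simp; norm_num
      _ ≤ _ := by gcongr
  set S := zx ^ 2 + zy ^ 2 with hS
  have hS0 : 0 ≤ S := by positivity
  have hcross : -(|D| * (B * M) * ((zx + zy) * |zx - zy|)) ≤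
      D * (oddPow k X + oddPow k Y) * (zx ^ 2 - zy ^ 2) := by
    have h1 : |zx ^ 2 - zy ^ 2| = (zx + zy) * |zx - zy| := by
      have : zx ^ 2 - zy ^ 2 = (zx + zy) * (zx - zy) := by ring
      rw [this, abs_mul, abs_of_nonneg (by linarith : 0 ≤ zx + zy)]
    have := neg_abs_le (D * (oddPow k X + oddPow k Y) * (zx ^ 2 - zy ^ 2))
    rw [abs_mul, abs_mul, h1] at this
    refine le_trans (neg_le_neg ?_) this
    gcongr
  have hyoung : |D| * (B * M) * ((zx + zy) * |zx - zy|) / 2 ≤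
      |D| * (B * |t|) * S / 8 + 2 * (m + 1) * A * (B * M ^ 2) * (zx - zy) ^ 2 := by
    -- Dividing by `|t|` is impossible at zero, but there `D` vanishes as well.
    rcases eq_or_lt_of_le (abs_nonneg t) with h0 | h0
    · have : |D| = 0 := le_antisymm (by rw [← h0] at hDle; simpa using hDle) (abs_nonneg D)
      rw [this]
      have : 0 ≤ 2 * (m + 1) * A * (B * M ^ 2) * (zx - zy) ^ 2 := by positivity
      simpa using this
    · have hσ : (zx + zy) ^ 2 ≤ 2 * S := by rw [hS]; nlinarith [sq_nonneg (zx - zy)]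
      have h1 := young_cutoff h0 hσ M |zx - zy|
      rw [sq_abs] at h1
      have h2 : |D| / |t| ≤ (m + 1) * A := by rwa [div_le_iff₀ h0]
      calc |D| * (B * M) * ((zx + zy) * |zx - zy|) / 2
          = |D| * B * (M * ((zx + zy) * |zx - zy|) / 2) := by ring
        _ ≤ |D| * B * (|t| * S / 8 + 2 * (M ^ 2 * (zx - zy) ^ 2) / |t|) := by gcongr
        _ = |D| * (B * |t|) * S / 8 + |D| / |t| * (2 * (B * M ^ 2) * (zx - zy) ^ 2) := by
          field_simp
        _ ≤ |D| * (B * |t|) * S / 8 + (m + 1) * A * (2 * (B * M ^ 2) * (zx - zy) ^ 2) := by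
          gcongr
        _ = _ := by ring
  have hhalf : |D| * (B * |t|) * S / 8 ≤ |D| * |oddPow k X - oddPow k Y| * S / 4 := by
    have : |D| * (B * |t| / 2) * S ≤ |D| * |oddPow k X - oddPow k Y| * S := by gcongr
    linarith
  have herr : 2 * (m + 1) * A * (B * M ^ 2) * (zx - zy) ^ 2 ≤
      4 * (m + 1) * A * (|X| ^ (k + 2) + |Y| ^ (k + 2)) * (zx - zy) ^ 2 := by
    have : 2 * (m + 1) * A * (B * M ^ 2) * (zx - zy) ^ 2 ≤
      2 * (m + 1) * A * (2 * (|X| ^ (k + 2) + |Y| ^ (k + 2))) * (zx - zy) ^ 2 := by gcongr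
    linarith
  have hfin : |t| ^ (m + k + 2) * S / (16 * 2 ^ m * 2 ^ k) ≤
      |D| * |oddPow k X - oddPow k Y| * S / 4 := by
    have := mul_le_mul_of_nonneg_right hmain (by positivity : 0 ≤ S / 4)
    calc _ = |t| ^ (m + k + 2) / (4 * 2 ^ m * 2 ^ k) * (S / 4) := by field_simp; norm_num
      _ ≤ _ := this
      _ = _ := by ring
  rw [hDJ']
  linarith

/-! ### Power kernels, and differences against energies. -/

lemma lintegral_near_lt_top {N : ℕ} (hN : 1 ≤ N) {a : ℝ} (ha : 0 < a) (d : ℝ) :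
    ∫⁻ k : RN N in Metric.ball 0 d, ENNReal.ofReal (‖k‖ ^ (a - N)) < ∞ := by
  have hfr : Module.finrank ℝ (RN N) = N := by simp
  have h := integrableOn_ball_of_norm_le_rpow (μ := (volume : Measure (RN N)))
    (f := fun k : RN N => ‖k‖ ^ (a - N)) (C := 1) (α := N - a) (r := d) (by rw [hfr]; exact hN)
    (by rw [hfr]; linarith) (Filter.Eventually.of_forall fun x => by
      rw [Real.norm_of_nonneg (by positivity), neg_sub, one_mul])
    (Measurable.aestronglyMeasurable (by fun_prop))
  have h2 := h.2
  rw [hasFiniteIntegral_iff_ofReal (Filter.Eventually.of_forall fun x => by positivity)] at h2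
  exact h2

lemma lintegral_far_lt_top {N : ℕ} {a : ℝ} (ha : 0 < a) {d : ℝ} (hd : 0 < d) :
    ∫⁻ k : RN N in (Metric.ball 0 d)ᶜ, ENNReal.ofReal (1 / ‖k‖ ^ (N + a)) < ∞ := by
  have hfr : Module.finrank ℝ (RN N) = N := by simp
  have h := integrable_one_add_norm (E := RN N) (μ := volume) (r := N + a) (by rw [hfr]; linarith)
  -- Outside the ball of radius `d` one has `1 + ‖x‖ ≤ ((1 + d) / d) ‖x‖`.
  set c : ℝ := ((1 + d) / d) ^ (N + a) with hc
  have h2 := (h.const_mul c).2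
  rw [hasFiniteIntegral_iff_ofReal (Filter.Eventually.of_forall fun x => by positivity)] at h2
  refine lt_of_le_of_lt ?_ h2
  refine le_trans (setLIntegral_mono' (g := fun x => ENNReal.ofReal (c * (1 + ‖x‖) ^ (-(N + a : ℝ))))
    measurableSet_ball.compl ?_) (setLIntegral_le_lintegral _ _)
  intro x hx
  have hx' : d ≤ ‖x‖ := by simpa using hx
  have hx0 : 0 < ‖x‖ := lt_of_lt_of_le hd hx'
  refine ENNReal.ofReal_le_ofReal ?_
  rw [Real.rpow_neg (by positivity), hc, ← div_eq_mul_inv, ← Real.div_rpow (by positivity) (by positivity),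
    one_div, ← Real.inv_rpow hx0.le]
  refine Real.rpow_le_rpow (by positivity) ?_ (by positivity)
  rw [inv_eq_one_div, div_div, div_le_div_iff₀ hx0 (by positivity)]
  nlinarith

lemma setLIntegral_ball_comp_add_le {N : ℕ} (F : RN N → ℝ≥0∞) {r ρ : ℝ} {h : RN N}
    (hr : r + ‖h‖ ≤ ρ) :
    ∫⁻ x in Metric.ball 0 r, F (x + h) ≤ ∫⁻ x in Metric.ball 0 ρ, F x := by
  rw [← lintegral_indicator measurableSet_ball, ← lintegral_indicator measurableSet_ball,
    ← lintegral_add_right_eq_self (Set.indicator (Metric.ball 0 ρ) F) h]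
  refine lintegral_mono fun x => ?_
  by_cases hx : x ∈ Metric.ball (0 : RN N) r
  · have : x + h ∈ Metric.ball (0 : RN N) ρ := by
      rw [mem_ball_zero_iff] at *
      linarith [norm_add_le x h]
    rw [Set.indicator_of_mem hx, Set.indicator_of_mem this]
  · rw [Set.indicator_of_notMem hx]; exact zero_le

lemma abs_sub_rpow_le_kernel {N : ℕ} {f : RN N → ℝ} {q τ ℓ : ℝ} (hq : 0 < q) (hτ : 0 ≤ τ)
    {x y : RN N} (hxy : ‖x - y‖ ≤ ℓ) :
    |f x - f y| ^ q ≤ ℓ ^ τ * (|f x - f y| ^ q / ‖x - y‖ ^ τ) := by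
  rcases eq_or_ne x y with rfl | hne
  · simp [Real.zero_rpow hq.ne']
  · have h0 : 0 < ‖x - y‖ := norm_pos_iff.mpr (sub_ne_zero.mpr hne)
    have h1 : ‖x - y‖ ^ τ ≤ ℓ ^ τ := Real.rpow_le_rpow h0.le hxy hτ
    have h2 : 0 < ‖x - y‖ ^ τ := by positivity
    rw [← mul_div_assoc, le_div_iff₀ h2, mul_comm]
    gcongr

/-- The pairs of points whose first entry lies in a ball and whose distance is less than `d`. -/
def nearPairs (N : ℕ) (ρ d : ℝ) : Set (RN N × RN N) :=
  {z | z.1 ∈ Metric.ball (0 : RN N) ρ ∧ ‖z.1 - z.2‖ < d}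

lemma measurableSet_nearPairs (N : ℕ) (ρ d : ℝ) : MeasurableSet (nearPairs N ρ d) :=
  (measurable_fst measurableSet_ball).inter
    (measurableSet_lt (by fun_prop : Measurable fun z : RN N × RN N => ‖z.1 - z.2‖)
      measurable_const)

/-- Bounded Gagliardo energy controls first differences. -/
lemma lintegral_diff_le_gagliardo {N : ℕ} (q σ : ℝ) (hq : 0 < q) (hσ : 0 ≤ σ) :
    ∃ C : ℝ, 0 ≤ C ∧ ∀ f : RN N → ℝ, Measurable f → ∀ (r ρ d : ℝ) (h : RN N), r + ‖h‖ ≤ ρ →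
      2 * ‖h‖ < d → h ≠ 0 →
      ∫⁻ x in Metric.ball 0 r, ENNReal.ofReal (|f (x + h) - f x| ^ q) ≤
        ENNReal.ofReal (C * ‖h‖ ^ σ) * ∫⁻ z in nearPairs N ρ d,
          ENNReal.ofReal (|f z.1 - f z.2| ^ q / ‖z.1 - z.2‖ ^ ((N : ℝ) + σ)) := by
  set V := volume (Metric.ball (0 : RN N) 1) with hV
  have hV0 : V ≠ 0 := (Metric.measure_ball_pos _ _ one_pos).ne'
  have hVt : V ≠ ∞ := measure_ball_lt_top.ne
  have hVr : 0 < V.toReal := ENNReal.toReal_pos hV0 hVt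
  refine ⟨2 * 2 ^ q * 2 ^ (N + σ) / V.toReal, by positivity, ?_⟩
  intro f hf r ρ d h hρ hd hne
  have hh : 0 < ‖h‖ := norm_pos_iff.mpr hne
  set S : Set (RN N × RN N) := {z | ‖z.1 - z.2‖ < d} with hS
  have hSm : MeasurableSet S := measurableSet_lt (by fun_prop) measurable_const
  set g : RN N → RN N → ℝ≥0∞ := fun x y => S.indicator (fun z =>
    ENNReal.ofReal (|f z.1 - f z.2| ^ q / ‖z.1 - z.2‖ ^ ((N : ℝ) + σ))) (x, y) with hg
  have hgm : Measurable (Function.uncurry g) :=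
    Measurable.indicator (by fun_prop) hSm
  have hgS : ∀ x y, ‖x - y‖ < d →
      g x y = ENNReal.ofReal (|f x - f y| ^ q / ‖x - y‖ ^ ((N : ℝ) + σ)) := by
    intro x y hxy
    simp only [hg]
    rw [Set.indicator_of_mem (show (x, y) ∈ S from hxy)]
  set H : RN N → ℝ≥0∞ := fun x => ∫⁻ y, g x y with hH
  have hHm : Measurable H := hgm.lintegral_prod_right'
  have hG : ∫⁻ z in nearPairs N ρ d,
          ENNReal.ofReal (|f z.1 - f z.2| ^ q / ‖z.1 - z.2‖ ^ ((N : ℝ) + σ)) =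
      ∫⁻ x in Metric.ball 0 ρ, H x := by
    have h1 : nearPairs N ρ d = S ∩ (Metric.ball 0 ρ ×ˢ Set.univ) := by
      ext z; simp [nearPairs, hS, and_comm]
    rw [h1, ← setLIntegral_indicator hSm, Measure.volume_eq_prod, ← Measure.prod_restrict,
      Measure.restrict_univ]
    exact lintegral_prod _ hgm.aemeasurable
  rw [hG]
  set c : ℝ := 2 ^ q * (2 * ‖h‖) ^ ((N : ℝ) + σ) with hc
  have hc0 : 0 ≤ c := by positivity
  -- Pass from `x` to `x + h` through an intermediate `z`, within `2 ‖h‖ < d` of both, and average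
  -- over `z`. The kernel costs `‖h‖ ^ (N + σ)`, and dividing by the volume of the ball of radius
  -- `‖h‖` leaves `‖h‖ ^ σ`.
  have hpt : ∀ x z : RN N, z ∈ Metric.ball x ‖h‖ →
      ENNReal.ofReal (|f (x + h) - f x| ^ q) ≤ ENNReal.ofReal c * (g (x + h) z + g x z) := by
    intro x z hz
    have hz' : ‖x - z‖ < ‖h‖ := by rwa [mem_ball_iff_norm'] at hz
    have h1 : ‖x - z‖ ≤ 2 * ‖h‖ := by linarith
    have h2 : ‖x + h - z‖ ≤ 2 * ‖h‖ := by
      have : x + h - z = (x - z) + h := by abel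
      rw [this]; linarith [norm_add_le (x - z) h]
    rw [hgS _ _ (by linarith), hgS _ _ (by linarith)]
    rw [← ENNReal.ofReal_add (by positivity) (by positivity), ← ENNReal.ofReal_mul hc0]
    refine ENNReal.ofReal_le_ofReal ?_
    have e := abs_sub_rpow_le hq.le (f (x + h) - f z) (f x - f z)
    rw [sub_sub_sub_cancel_right] at e
    have e1 := abs_sub_rpow_le_kernel (f := f) hq (by positivity : 0 ≤ (N : ℝ) + σ) h2
    have e2 := abs_sub_rpow_le_kernel (f := f) hq (by positivity : 0 ≤ (N : ℝ) + σ) h1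
    have e3 : (0:ℝ) ≤ 2 ^ q := by positivity
    calc _ ≤ _ := e
      _ ≤ _ := mul_le_mul_of_nonneg_left (add_le_add e1 e2) e3
      _ = _ := by rw [hc]; ring
  have hvol : ∀ x : RN N, volume (Metric.ball x ‖h‖) = ENNReal.ofReal (‖h‖ ^ N) * V := by
    intro x
    rw [Measure.addHaar_ball_of_pos volume x hh]; simp [hV]
  have hfint : ∀ x ∈ Metric.ball (0 : RN N) r,
      ENNReal.ofReal (‖h‖ ^ N) * V * ENNReal.ofReal (|f (x + h) - f x| ^ q) ≤
        ENNReal.ofReal c * (H (x + h) + H x) := by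
    intro x hx
    calc _ = ∫⁻ z in Metric.ball x ‖h‖, ENNReal.ofReal (|f (x + h) - f x| ^ q) := by
          rw [setLIntegral_const, hvol, mul_comm]
      _ ≤ ∫⁻ z in Metric.ball x ‖h‖, ENNReal.ofReal c * (g (x + h) z + g x z) :=
          setLIntegral_mono' measurableSet_ball (hpt x)
      _ ≤ ∫⁻ z, ENNReal.ofReal c * (g (x + h) z + g x z) :=
          setLIntegral_le_lintegral _ _
      _ = _ := by
          have m1 : Measurable (g (x + h)) := hgm.of_uncurry_left
          have m2 : Measurable (g x) := hgm.of_uncurry_left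
          rw [lintegral_const_mul _ (by fun_prop), lintegral_add_left m1]
  have htot : ENNReal.ofReal (‖h‖ ^ N) * V *
      ∫⁻ x in Metric.ball 0 r, ENNReal.ofReal (|f (x + h) - f x| ^ q) ≤
        ENNReal.ofReal c * (2 * ∫⁻ x in Metric.ball 0 ρ, H x) := by
    rw [← lintegral_const_mul _ (by fun_prop)]
    calc _ ≤ ∫⁻ x in Metric.ball 0 r, ENNReal.ofReal c * (H (x + h) + H x) :=
          setLIntegral_mono' measurableSet_ball hfint
      _ = ENNReal.ofReal c * ((∫⁻ x in Metric.ball 0 r, H (x + h)) + ∫⁻ x in Metric.ball 0 r, H x) := by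
          rw [lintegral_const_mul _ (by fun_prop), lintegral_add_left (by fun_prop)]
      _ ≤ _ := by
          rw [two_mul]
          refine mul_le_mul_right (add_le_add ?_ ?_) _
          · exact setLIntegral_ball_comp_add_le H (by linarith)
          · exact lintegral_mono_set (Metric.ball_subset_ball (by linarith))
  have hW0 : ENNReal.ofReal (‖h‖ ^ N) * V ≠ 0 :=
    mul_ne_zero (ENNReal.ofReal_pos.mpr (pow_pos hh N)).ne' hV0
  have hWt : ENNReal.ofReal (‖h‖ ^ N) * V ≠ ∞ := ENNReal.mul_ne_top ENNReal.ofReal_ne_top hVt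
  rw [← ENNReal.mul_le_mul_iff_right hW0 hWt]
  refine htot.trans (le_of_eq ?_)
  rw [← mul_assoc, ← mul_assoc]
  congr 1
  obtain ⟨v, hv, hVe⟩ : ∃ v : ℝ, 0 < v ∧ V = ENNReal.ofReal v :=
    ⟨V.toReal, hVr, (ENNReal.ofReal_toReal hVt).symm⟩
  have h2e : ENNReal.ofReal c * 2 = ENNReal.ofReal (c * 2) := by
    rw [ENNReal.ofReal_mul hc0]; simp
  rw [hVe, ENNReal.toReal_ofReal hv.le, ← ENNReal.ofReal_mul (by positivity),
    ← ENNReal.ofReal_mul (by positivity), h2e]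
  congr 1
  rw [hc, Real.mul_rpow (by norm_num) hh.le, Real.rpow_add hh, Real.rpow_natCast]
  field_simp

/-- The `L^q` size of second differences controls that of first differences at orders below one. -/
lemma lintegral_diff_le_of_second_diff {N : ℕ} {q α r h₀ K : ℝ} (hq : 1 ≤ q) (hα0 : 0 < α)
    (hα : α < 1) (hh₀ : 0 < h₀) (hK : 0 ≤ K) (hr : r + 2 * h₀ ≤ 2) :
    ∃ K' : ℝ, 0 ≤ K' ∧ ∀ f : RN N → ℝ, Measurable f → (∀ x ∈ Metric.ball (0 : RN N) 2, |f x| ≤ 1) →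
      (∀ h : RN N, ‖h‖ < h₀ → ∫⁻ x in Metric.ball 0 r,
        ENNReal.ofReal (|f (x + h + h) - f (x + h) - (f (x + h) - f x)| ^ q) ≤
          ENNReal.ofReal (K * ‖h‖ ^ (α * q))) →
      ∀ h : RN N, ‖h‖ < h₀ → ∫⁻ x in Metric.ball 0 r, ENNReal.ofReal (|f (x + h) - f x| ^ q) ≤
          ENNReal.ofReal (K' * ‖h‖ ^ (α * q)) := by
  have hq0 : 0 < q := by linarith
  set V := (volume (Metric.ball (0 : RN N) r)).toReal with hV
  have hV0 : 0 ≤ V := ENNReal.toReal_nonneg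
  set B : ℝ := (V * 2 ^ q) ^ (1 / q) with hB
  -- With `n h` the `L^q` norm of the first difference, twice the first difference is the difference
  -- of step `2h` minus the second difference, so `n h ≤ n (2h) / 2 + b ‖h‖^α / 2`. A bound `L
  -- ‖h‖^α` passes from `2h` to `h` when `θ L + b ≤ L`; this needs `θ < 1`, that is `α < 1`. The
  -- summand of `L` with `B` handles steps of length at least `h₀`.
  set θ : ℝ := 2 ^ (α - 1) with hθ
  have hθ1 : θ < 1 := Real.rpow_lt_one_of_one_lt_of_neg (by norm_num) (by linarith)
  set b : ℝ := K ^ (1 / q) with hb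
  have hb0 : 0 ≤ b := by positivity
  set L : ℝ := B / h₀ ^ α + b / (1 - θ) with hL
  have h1θ : 0 < 1 - θ := by linarith
  have hB0 : 0 ≤ B := by positivity
  have hL0 : 0 ≤ L := by positivity
  have hLB : B ≤ L * h₀ ^ α := by
    have : 0 < h₀ ^ α := by positivity
    rw [hL, add_mul, div_mul_cancel₀ _ this.ne']
    have : 0 ≤ b / (1 - θ) * h₀ ^ α := by positivity
    linarith
  have hLθ : θ * L + b ≤ L := by
    have h1 : b / (1 - θ) ≤ L := by
      rw [hL]; have : 0 ≤ B / h₀ ^ α := by positivity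
      linarith
    rw [div_le_iff₀ h1θ] at h1
    linarith
  refine ⟨L ^ q, by positivity, ?_⟩
  intro f hf hbd hS
  set n : RN N → ℝ≥0∞ := fun h =>
    (∫⁻ x in Metric.ball 0 r, (ENNReal.ofReal |f (x + h) - f x|) ^ q) ^ (1 / q) with hn
  have hpow : ∀ t : ℝ, ENNReal.ofReal (|t| ^ q) = (ENNReal.ofReal |t|) ^ q := fun t =>
    (ENNReal.ofReal_rpow_of_nonneg (abs_nonneg t) hq0.le).symm
  have hbig : ∀ h : RN N, ‖h‖ ≤ 2 * h₀ → h₀ ≤ ‖h‖ → n h ≤ ENNReal.ofReal (L * ‖h‖ ^ α) := by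
    intro h hh hh'
    have h1 : ∫⁻ x in Metric.ball 0 r, (ENNReal.ofReal |f (x + h) - f x|) ^ q ≤
        ENNReal.ofReal (V * 2 ^ q) := by
      calc _ ≤ ∫⁻ x in Metric.ball (0 : RN N) r, ENNReal.ofReal (2 ^ q) := by
            refine setLIntegral_mono' measurableSet_ball fun x hx => ?_
            rw [← hpow]
            refine ENNReal.ofReal_le_ofReal (Real.rpow_le_rpow (abs_nonneg _) ?_ hq0.le)
            have hx' : ‖x‖ < r := by simpa using hx
            have e1 := hbd x (by simpa using (by linarith : ‖x‖ < 2))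
            have e2 := hbd (x + h) (by
              rw [mem_ball_zero_iff]; linarith [norm_add_le x h])
            have := abs_sub (f (x + h)) (f x)
            linarith
        _ = _ := by
            rw [setLIntegral_const, mul_comm, ENNReal.ofReal_mul hV0, hV,
              ENNReal.ofReal_toReal measure_ball_lt_top.ne]
    calc n h ≤ (ENNReal.ofReal (V * 2 ^ q)) ^ (1 / q) := ENNReal.rpow_le_rpow h1 (by positivity)
      _ = ENNReal.ofReal B := by rw [ENNReal.ofReal_rpow_of_nonneg (by positivity) (by positivity)]
      _ ≤ _ := ENNReal.ofReal_le_ofReal (hLB.trans (by gcongr))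
  have hstep : ∀ h : RN N, ‖h‖ < h₀ → n (h + h) ≤ ENNReal.ofReal (L * ‖h + h‖ ^ α) →
      n h ≤ ENNReal.ofReal (L * ‖h‖ ^ α) := by
    intro h hh hrec
    have h2h : ‖h + h‖ = 2 * ‖h‖ := by
      rw [← two_smul ℝ h, norm_smul]; simp
    have h1 : n h ≤ (∫⁻ x in Metric.ball 0 r, ((fun x => ENNReal.ofReal (|f (x + (h + h)) - f x| / 2)) +
        fun x => ENNReal.ofReal (|f (x + h + h) - f (x + h) - (f (x + h) - f x)| / 2)) x ^ q)
          ^ (1 / q) := by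
      refine ENNReal.rpow_le_rpow (lintegral_mono fun x => ?_) (by positivity)
      refine ENNReal.rpow_le_rpow ?_ hq0.le
      rw [Pi.add_apply, ← ENNReal.ofReal_add (by positivity) (by positivity)]
      refine ENNReal.ofReal_le_ofReal ?_
      have e := abs_sub (f (x + (h + h)) - f x) (f (x + h + h) - f (x + h) - (f (x + h) - f x))
      have e2 : f (x + (h + h)) - f x - (f (x + h + h) - f (x + h) - (f (x + h) - f x)) =
          2 * (f (x + h) - f x) := by rw [add_assoc]; ring
      rw [e2, abs_mul, abs_two] at e
      linarith
    have h2 := ENNReal.lintegral_Lp_add_le (μ := volume.restrict (Metric.ball (0 : RN N) r))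
      (f := fun x => ENNReal.ofReal (|f (x + (h + h)) - f x| / 2))
      (g := fun x => ENNReal.ofReal (|f (x + h + h) - f (x + h) - (f (x + h) - f x)| / 2))
      (by fun_prop) (by fun_prop) hq
    have hhalf : ∀ F : RN N → ℝ, Measurable F →
        (∫⁻ x in Metric.ball (0 : RN N) r, ENNReal.ofReal (|F x| / 2) ^ q) ^ (1 / q) =
        ENNReal.ofReal (1 / 2) * (∫⁻ x in Metric.ball (0 : RN N) r, ENNReal.ofReal (|F x|) ^ q) ^ (1 / q) := by
      intro F hF
      have : ∀ x, ENNReal.ofReal (|F x| / 2) ^ q = ENNReal.ofReal (1 / 2) ^ q * ENNReal.ofReal |F x| ^ q := by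
        intro x
        rw [← ENNReal.mul_rpow_of_nonneg _ _ hq0.le, ← ENNReal.ofReal_mul (by norm_num)]
        congr 2; ring
      simp_rw [this]
      rw [lintegral_const_mul _ (by fun_prop), ENNReal.mul_rpow_of_nonneg _ _ (by positivity),
        ← ENNReal.rpow_mul, mul_one_div_cancel hq0.ne', ENNReal.rpow_one]
    rw [hhalf (fun x => f (x + (h + h)) - f x) (by fun_prop),
      hhalf (fun x => f (x + h + h) - f (x + h) - (f (x + h) - f x)) (by fun_prop)] at h2
    have h3 : (∫⁻ x in Metric.ball 0 r,
        ENNReal.ofReal |f (x + h + h) - f (x + h) - (f (x + h) - f x)| ^ q) ^ (1 / q) ≤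
        ENNReal.ofReal (b * ‖h‖ ^ α) := by
      have := hS h hh
      simp_rw [hpow] at this
      refine (ENNReal.rpow_le_rpow this (by positivity : 0 ≤ 1 / q)).trans (le_of_eq ?_)
      rw [ENNReal.ofReal_rpow_of_nonneg (by positivity) (by positivity),
        Real.mul_rpow hK (by positivity), ← Real.rpow_mul (norm_nonneg h), mul_assoc,
        mul_one_div_cancel hq0.ne', mul_one]
    refine h1.trans (h2.trans ?_)
    refine (add_le_add (mul_le_mul_right hrec _) (mul_le_mul_right h3 _)).trans ?_
    rw [← ENNReal.ofReal_mul (by norm_num), ← ENNReal.ofReal_mul (by norm_num),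
      ← ENNReal.ofReal_add (by positivity) (by positivity)]
    refine ENNReal.ofReal_le_ofReal ?_
    rw [h2h, Real.mul_rpow (by norm_num) (norm_nonneg h)]
    have h2α : (2 : ℝ) ^ α = 2 * θ := by
      rw [hθ, Real.rpow_sub_one (by norm_num)]; ring
    rw [h2α]
    have : 0 ≤ ‖h‖ ^ α := by positivity
    nlinarith
  -- Induction on the number of doublings that reach length `h₀`. Only steps shorter than `h₀` are
  -- doubled, so all steps stay within `2 * h₀` and `x + h` stays where `|f| ≤ 1`.
  have hind : ∀ m : ℕ, ∀ h : RN N, ‖h‖ ≤ 2 * h₀ → h₀ ≤ 2 ^ m * ‖h‖ →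
      n h ≤ ENNReal.ofReal (L * ‖h‖ ^ α) := by
    intro m
    induction m with
    | zero => intro h h1 h2; exact hbig h h1 (by simpa using h2)
    | succ m ih =>
      intro h h1 h2
      rcases le_or_gt h₀ ‖h‖ with h3 | h3
      · exact hbig h h1 h3
      · have h2h : ‖h + h‖ = 2 * ‖h‖ := by
          rw [← two_smul ℝ h, norm_smul]; simp
        refine hstep h h3 (ih _ (by linarith) ?_)
        rw [h2h, ← mul_assoc, ← pow_succ]; exact h2
  intro h hh
  rcases eq_or_ne h 0 with rfl | hne
  · simp [Real.zero_rpow hq0.ne']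
  · have hpos : 0 < ‖h‖ := norm_pos_iff.mpr hne
    obtain ⟨m, hm⟩ := pow_unbounded_of_one_lt (h₀ / ‖h‖) (by norm_num : (1 : ℝ) < 2)
    rw [div_lt_iff₀ hpos] at hm
    have := ENNReal.rpow_le_rpow (hind m h (by linarith) hm.le) hq0.le
    rw [hn, ← ENNReal.rpow_mul, one_div_mul_cancel hq0.ne', ENNReal.rpow_one,
      ENNReal.ofReal_rpow_of_nonneg (by positivity) hq0.le, Real.mul_rpow hL0 (by positivity),
      ← Real.rpow_mul (norm_nonneg h)] at this
    simp_rw [hpow]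
    exact this

/-! ### Integrals over pairs against truncated kernels. -/

lemma volume_prod_lintegral {N : ℕ} {F : RN N × RN N → ℝ≥0∞} (hF : Measurable F) :
    ∫⁻ z, F z = ∫⁻ x, ∫⁻ y, F (x, y) := by
  rw [Measure.volume_eq_prod, lintegral_prod _ hF.aemeasurable]

lemma lintegral_comp_swap {N : ℕ} {F : RN N × RN N → ℝ≥0∞} (hF : Measurable F) :
    ∫⁻ z : RN N × RN N, F z.swap = ∫⁻ z, F z := by
  rw [Measure.volume_eq_prod]
  exact (Measure.measurePreserving_swap (μ := (volume : Measure (RN N)))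
    (ν := (volume : Measure (RN N)))).lintegral_comp hF

lemma lintegral_mul_sub_kernel {N : ℕ} {F k : RN N → ℝ≥0∞} (hF : Measurable F)
    (hk : Measurable k) :
    ∫⁻ z : RN N × RN N, F z.1 * k (z.1 - z.2) = (∫⁻ x, F x) * ∫⁻ x, k x := by
  rw [volume_prod_lintegral (by fun_prop)]
  have : ∀ x, ∫⁻ y, F x * k (x - y) = F x * ∫⁻ y, k y := by
    intro x
    rw [lintegral_const_mul _ (by fun_prop), lintegral_sub_left_eq_self]
  simp_rw [this]
  rw [lintegral_mul_const _ hF]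

/-- The weight `‖k‖^{-N-a}` cut off near the origin. -/
noncomputable def farKernel (N : ℕ) (a d : ℝ) (k : RN N) : ℝ≥0∞ :=
  (Metric.ball 0 d)ᶜ.indicator (fun k => ENNReal.ofReal (1 / ‖k‖ ^ (N + a))) k

/-- The weight `‖k‖^{a-N}` cut off away from the origin. -/
noncomputable def nearKernel (N : ℕ) (a d : ℝ) (k : RN N) : ℝ≥0∞ :=
  (Metric.ball 0 d).indicator (fun k => ENNReal.ofReal (‖k‖ ^ (a - N))) k

lemma measurable_farKernel (N : ℕ) (a d : ℝ) : Measurable (farKernel N a d) :=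
  Measurable.indicator (by fun_prop) measurableSet_ball.compl

lemma measurable_nearKernel (N : ℕ) (a d : ℝ) : Measurable (nearKernel N a d) :=
  Measurable.indicator (by fun_prop) measurableSet_ball

lemma lintegral_farKernel_lt_top {N : ℕ} {a : ℝ} (ha : 0 < a) {d : ℝ} (hd : 0 < d) :
    ∫⁻ k, farKernel N a d k < ∞ := by
  unfold farKernel
  rw [lintegral_indicator measurableSet_ball.compl]
  exact lintegral_far_lt_top ha hd

lemma lintegral_nearKernel_lt_top {N : ℕ} (hN : 1 ≤ N) {a : ℝ} (ha : 0 < a) (d : ℝ) :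
    ∫⁻ k, nearKernel N a d k < ∞ := by
  unfold nearKernel
  rw [lintegral_indicator measurableSet_ball]
  exact lintegral_near_lt_top hN ha d

lemma farKernel_neg {N : ℕ} (a d : ℝ) (k : RN N) : farKernel N a d (-k) = farKernel N a d k := by
  unfold farKernel
  by_cases h : k ∈ (Metric.ball (0 : RN N) d)ᶜ
  · rw [Set.indicator_of_mem h, Set.indicator_of_mem (by simpa using h), norm_neg]
  · rw [Set.indicator_of_notMem h, Set.indicator_of_notMem (by simpa using h)]

lemma farKernel_eq {N : ℕ} (a : ℝ) {d : ℝ} {k : RN N} (h : d ≤ ‖k‖) :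
    farKernel N a d k = ENNReal.ofReal (1 / ‖k‖ ^ (N + a)) := by
  unfold farKernel
  rw [Set.indicator_of_mem (by simpa using h)]

lemma nearKernel_eq {N : ℕ} (a : ℝ) {d : ℝ} {k : RN N} (h : ‖k‖ < d) :
    nearKernel N a d k = ENNReal.ofReal (‖k‖ ^ (a - N)) := by
  unfold nearKernel
  rw [Set.indicator_of_mem (by simpa using h)]

lemma nearKernel_neg {N : ℕ} (a d : ℝ) (k : RN N) : nearKernel N a d (-k) = nearKernel N a d k := by
  unfold nearKernel
  by_cases h : k ∈ (Metric.ball (0 : RN N) d)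
  · rw [Set.indicator_of_mem h, Set.indicator_of_mem (by simpa using h), norm_neg]
  · rw [Set.indicator_of_notMem h, Set.indicator_of_notMem (by simpa using h)]

lemma lintegral_mul_sub_kernel' {N : ℕ} {F k : RN N → ℝ≥0∞} (hF : Measurable F)
    (hk : Measurable k) (hk' : ∀ x, k (-x) = k x) :
    ∫⁻ z : RN N × RN N, F z.2 * k (z.1 - z.2) = (∫⁻ x, F x) * ∫⁻ x, k x := by
  rw [← lintegral_mul_sub_kernel hF hk, ← lintegral_comp_swap (by fun_prop)]
  refine lintegral_congr fun z => ?_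
  rw [← hk' (z.1 - z.2), neg_sub]
  rfl

/-! ### Normalized solutions and their interaction at positive distance. -/

/-- Normalized solutions in the ball of radius two. -/
structure NormalizedSolution {N : ℕ} (p s₁ sp : ℝ) (u : RN N → ℝ) : Prop where
  measurable : Measurable u
  abs_le_one : ∀ x ∈ Metric.ball (0 : RN N) 2, |u x| ≤ 1
  tail_le : ∫⁻ x in (Metric.ball (0 : RN N) 2)ᶜ,
    ENNReal.ofReal (|u x| ^ (p - 1) / ‖x‖ ^ ((N : ℝ) + sp * p)) ≤ 1
  energy_le : ∫⁻ z in Metric.ball (0 : RN N) 2 ×ˢ Metric.ball (0 : RN N) 2,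
    ENNReal.ofReal (|u z.1 - u z.2| ^ p / ‖z.1 - z.2‖ ^ ((N : ℝ) + sp * p)) ≤ 1
  energy_one_lt_top : ∫⁻ z in Metric.ball (0 : RN N) 2 ×ˢ Metric.ball (0 : RN N) 2,
    ENNReal.ofReal (|u z.1 - u z.2| ^ (1 : ℝ) / ‖z.1 - z.2‖ ^ ((N : ℝ) + s₁ * 1)) < ∞
  equation : ∃ ε ∈ Set.Icc (0 : ℝ) 1, ∃ Z : RN N × RN N → ℝ, AEStronglyMeasurable Z volume ∧
    (∀ᵐ z : RN N × RN N, Z z ∈ sgnSet (u z.1 - u z.2)) ∧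
    ∀ φ : RN N → ℝ, IsTestFunction p s₁ sp (Metric.ball 0 2) φ →
      0 = ε * (∫ z : RN N × RN N, Z z * (φ z.1 - φ z.2) / ‖z.1 - z.2‖ ^ ((N : ℝ) + s₁)) +
        ∫ z : RN N × RN N, |u z.1 - u z.2| ^ (p - 2) * (u z.1 - u z.2) * (φ z.1 - φ z.2) /
          ‖z.1 - z.2‖ ^ ((N : ℝ) + sp * p)

/-- The nonlocal part of the `p`-energy density, cut off near the diagonal. -/
noncomputable def farDensity {N : ℕ} (p sp d : ℝ) (u : RN N → ℝ) (z : RN N × RN N) : ℝ≥0∞ :=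
  ENNReal.ofReal (|u z.1 - u z.2| ^ (p - 1)) * farKernel N (sp * p) d (z.1 - z.2)

lemma measurable_farDensity {N : ℕ} (p sp d : ℝ) {u : RN N → ℝ} (hu : Measurable u) :
    Measurable (farDensity p sp d u) := by
  have := measurable_farKernel N (sp * p) d
  unfold farDensity; fun_prop

lemma farDensity_swap {N : ℕ} (p sp d : ℝ) (u : RN N → ℝ) (z : RN N × RN N) :
    farDensity p sp d u z.swap = farDensity p sp d u z := by
  unfold farDensity
  rw [Prod.fst_swap, Prod.snd_swap, abs_sub_comm, ← farKernel_neg, neg_sub]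

/-- For `y` inside the ball of radius 2 both values are bounded by one and the far kernel is
integrable; for `y` outside, the normalized tail takes over. The bound depends on `u` only through
the normalization. -/
lemma exists_lintegral_farDensity_le {N : ℕ} {p s₁ sp d : ℝ} (hp : 2 ≤ p) (hsp : 0 < sp)
    (hd : 0 < d) (hd1 : d ≤ 1) :
    ∃ C : ℝ≥0∞, C ≠ ∞ ∧ ∀ u : RN N → ℝ, NormalizedSolution p s₁ sp u →
      ∀ x ∈ Metric.ball (0 : RN N) (2 - d), ∫⁻ y, farDensity p sp d u (x, y) ≤ C := by
  have hspp : 0 < sp * p := by positivity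
  set τ : ℝ := N + sp * p with hτ
  have hτ0 : 0 < τ := by positivity
  refine ⟨ENNReal.ofReal (2 * 2 ^ (p - 1)) * (∫⁻ k, farKernel N (sp * p) d k) +
    ENNReal.ofReal (2 ^ (p - 1) * (2 / d) ^ τ) * 1, ?_, ?_⟩
  · refine ENNReal.add_ne_top.mpr ⟨ENNReal.mul_ne_top ENNReal.ofReal_ne_top
      (lintegral_farKernel_lt_top hspp hd).ne, by simp⟩
  intro u hu x hx
  have hum := hu.measurable
  have hxn : ‖x‖ < 2 - d := by simpa using hx
  have hx2 : |u x| ≤ 1 := hu.abs_le_one x (by simpa using (by linarith : ‖x‖ < 2))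
  have mk := measurable_farKernel N (sp * p) d
  set T : RN N → ℝ≥0∞ := (Metric.ball (0 : RN N) 2)ᶜ.indicator
    (fun y => ENNReal.ofReal (|u y| ^ (p - 1) / ‖y‖ ^ τ)) with hT
  have hTm : Measurable T := Measurable.indicator (by fun_prop) measurableSet_ball.compl
  have hTi : ∫⁻ y, T y ≤ 1 := by
    rw [hT, lintegral_indicator measurableSet_ball.compl]; exact hu.tail_le
  have hpt : ∀ y, farDensity p sp d u (x, y) ≤
      ENNReal.ofReal (2 * 2 ^ (p - 1)) * farKernel N (sp * p) d (x - y) +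
        ENNReal.ofReal (2 ^ (p - 1) * (2 / d) ^ τ) * T y := by
    intro y
    rcases lt_or_ge ‖x - y‖ d with h | h
    · have : farDensity p sp d u (x, y) = 0 := by
        unfold farDensity farKernel
        rw [Set.indicator_of_notMem (by simpa using h), mul_zero]
      rw [this]; exact zero_le
    · unfold farDensity
      simp only
      rw [farKernel_eq _ h]
      have e := abs_sub_rpow_le (by linarith : 0 ≤ p - 1) (u x) (u y)
      have hux : |u x| ^ (p - 1) ≤ 1 := Real.rpow_le_one (abs_nonneg _) hx2 (by linarith)
      have h2 : (0 : ℝ) < 2 ^ (p - 1) := by positivity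
      have hxy : 0 < ‖x - y‖ := lt_of_lt_of_le hd h
      by_cases hy : y ∈ Metric.ball (0 : RN N) 2
      · have huy : |u y| ^ (p - 1) ≤ 1 :=
          Real.rpow_le_one (abs_nonneg _) (hu.abs_le_one y hy) (by linarith)
        refine le_trans ?_ le_self_add
        gcongr
        nlinarith
      · have hTy : T y = ENNReal.ofReal (|u y| ^ (p - 1) / ‖y‖ ^ τ) :=
          Set.indicator_of_mem hy _
        have hyn : 2 ≤ ‖y‖ := by simpa using hy
        rw [hTy, ← ENNReal.ofReal_mul (by positivity), ← ENNReal.ofReal_mul (by positivity),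
          ← ENNReal.ofReal_mul (by positivity), ← ENNReal.ofReal_add (by positivity) (by positivity)]
        refine ENNReal.ofReal_le_ofReal ?_
        -- Since `‖x‖ < 2 - d` and `‖y‖ ≥ 2`, the distance `‖x - y‖` is at least `(d / 2) ‖y‖`.
        have hk : 1 / ‖x - y‖ ^ τ ≤ (2 / d) ^ τ * (1 / ‖y‖ ^ τ) := by
          rw [mul_one_div, ← Real.div_rpow (by positivity) (by positivity), one_div,
            ← Real.inv_rpow (by positivity)]
          refine Real.rpow_le_rpow (by positivity) ?_ hτ0.le
          rw [inv_eq_one_div, div_div, div_le_div_iff₀ hxy (by positivity)]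
          have : ‖y‖ - ‖x‖ ≤ ‖x - y‖ := by
            rw [norm_sub_rev]; exact norm_sub_norm_le y x
          nlinarith
        have hk0 : 0 ≤ 1 / ‖x - y‖ ^ τ := by positivity
        have huy0 : 0 ≤ |u y| ^ (p - 1) := by positivity
        calc |u x - u y| ^ (p - 1) * (1 / ‖x - y‖ ^ τ)
            ≤ (2 ^ (p - 1) * (1 + |u y| ^ (p - 1))) * (1 / ‖x - y‖ ^ τ) := by
              refine mul_le_mul_of_nonneg_right ?_ hk0
              nlinarith
          _ = 2 ^ (p - 1) * (1 / ‖x - y‖ ^ τ) +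
              2 ^ (p - 1) * |u y| ^ (p - 1) * (1 / ‖x - y‖ ^ τ) := by ring
          _ ≤ 2 * 2 ^ (p - 1) * (1 / ‖x - y‖ ^ τ) +
              2 ^ (p - 1) * |u y| ^ (p - 1) * ((2 / d) ^ τ * (1 / ‖y‖ ^ τ)) := by
              gcongr
              linarith
          _ = _ := by rw [hτ]; ring
  calc _ ≤ ∫⁻ y, (ENNReal.ofReal (2 * 2 ^ (p - 1)) * farKernel N (sp * p) d (x - y) +
        ENNReal.ofReal (2 ^ (p - 1) * (2 / d) ^ τ) * T y) := lintegral_mono hpt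
    _ = ENNReal.ofReal (2 * 2 ^ (p - 1)) * (∫⁻ k, farKernel N (sp * p) d k) +
        ENNReal.ofReal (2 ^ (p - 1) * (2 / d) ^ τ) * ∫⁻ y, T y := by
      rw [lintegral_add_left (by fun_prop), lintegral_const_mul _ (by fun_prop),
        lintegral_const_mul _ (by fun_prop),
        lintegral_sub_left_eq_self (fun k => farKernel N (sp * p) d k)]
    _ ≤ _ := by gcongr

/-- Freeze the first point and integrate out the second. The shift `h` covers the translated
equation, and `h = 0` the original one. -/
lemma lintegral_mul_farDensity_le {N : ℕ} {p sp d : ℝ} {u : RN N → ℝ} (hu : Measurable u)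
    {C : ℝ≥0∞} (hC : ∀ x ∈ Metric.ball (0 : RN N) (2 - d), ∫⁻ y, farDensity p sp d u (x, y) ≤ C)
    {G : RN N → ℝ≥0∞} (hG : Measurable G) {h : RN N}
    (hG0 : ∀ x, x + h ∉ Metric.ball (0 : RN N) (2 - d) → G x = 0) :
    ∫⁻ z : RN N × RN N, G z.1 * farDensity p sp d u (z.1 + h, z.2 + h) ≤ (∫⁻ x, G x) * C := by
  have hm := measurable_farDensity p sp d hu
  rw [volume_prod_lintegral (by fun_prop), ← lintegral_mul_const _ hG]
  refine lintegral_mono fun x => ?_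
  simp only
  rw [lintegral_const_mul _ (by fun_prop),
    lintegral_add_right_eq_self (fun y => farDensity p sp d u (x + h, y)) h]
  by_cases hx : x + h ∈ Metric.ball (0 : RN N) (2 - d)
  · gcongr
    exact hC _ hx
  · simp [hG0 x hx]

lemma lintegral_mul_farDensity_le' {N : ℕ} {p sp d : ℝ} {u : RN N → ℝ} (hu : Measurable u)
    {C : ℝ≥0∞} (hC : ∀ x ∈ Metric.ball (0 : RN N) (2 - d), ∫⁻ y, farDensity p sp d u (x, y) ≤ C)
    {G : RN N → ℝ≥0∞} (hG : Measurable G) {h : RN N}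
    (hG0 : ∀ x, x + h ∉ Metric.ball (0 : RN N) (2 - d) → G x = 0) :
    ∫⁻ z : RN N × RN N, G z.2 * farDensity p sp d u (z.1 + h, z.2 + h) ≤ (∫⁻ x, G x) * C := by
  have hm := measurable_farDensity p sp d hu
  refine le_trans (le_of_eq ?_) (lintegral_mul_farDensity_le hu hC hG hG0)
  rw [← lintegral_comp_swap (by fun_prop)]
  refine lintegral_congr fun z => ?_
  rw [← farDensity_swap]
  rfl

instance instIsAddRightInvariantVolumeProd (N : ℕ) :
    (volume : Measure (RN N × RN N)).IsAddRightInvariant := by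
  rw [Measure.volume_eq_prod]; infer_instance

lemma setLIntegral_prod_comp_add_le {N : ℕ} (F : RN N × RN N → ℝ≥0∞) {S S' : Set (RN N × RN N)}
    (hS : MeasurableSet S) (hS' : MeasurableSet S') (h : RN N)
    (hSS : ∀ z ∈ S, z + (h, h) ∈ S') :
    ∫⁻ z in S, F (z + (h, h)) ≤ ∫⁻ z in S', F z := by
  rw [← lintegral_indicator hS, ← lintegral_indicator hS',
    ← lintegral_add_right_eq_self (S'.indicator F) (h, h)]
  refine lintegral_mono fun z => ?_
  by_cases hz : z ∈ S
  · rw [Set.indicator_of_mem hz, Set.indicator_of_mem (hSS z hz)]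
  · rw [Set.indicator_of_notMem hz]; exact zero_le

/-! ### Admissibility of test functions. -/

/-- The Gagliardo energy density of order `a` and exponent `q`. -/
noncomputable def energyDensity {N : ℕ} (q a : ℝ) (f : RN N → ℝ) (z : RN N × RN N) : ℝ≥0∞ :=
  ENNReal.ofReal (|f z.1 - f z.2| ^ q / ‖z.1 - z.2‖ ^ ((N : ℝ) + a))

lemma measurable_energyDensity {N : ℕ} (q a : ℝ) {f : RN N → ℝ} (hf : Measurable f) :
    Measurable (energyDensity q a f) := by
  unfold energyDensity; fun_prop

/-- For a bounded function with bounded support, pairs at distance at least `d` cost at most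
`(2M)^q` times an integrable kernel, so only near-diagonal energy has to be known. -/
lemma lintegral_energyDensity_lt_top {N : ℕ} {q a ρ d M : ℝ} {φ : RN N → ℝ} (hq : 0 < q)
    (ha : 0 < a) (hd : 0 < d) (hφ : Measurable φ) (hM : ∀ x, |φ x| ≤ M)
    (h0 : ∀ x, x ∉ Metric.ball (0 : RN N) ρ → φ x = 0)
    (hnear : ∫⁻ z in nearPairs N (ρ + d) d, energyDensity q a φ z < ∞) :
    ∫⁻ z, energyDensity q a φ z < ∞ := by
  have mk := measurable_farKernel N a d
  have mE := measurable_energyDensity q a hφ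
  set G : RN N → ℝ≥0∞ := (Metric.ball (0 : RN N) ρ).indicator
    (fun _ => ENNReal.ofReal ((2 * M) ^ q)) with hG
  have hGm : Measurable G := measurable_const.indicator measurableSet_ball
  have hGi : ∫⁻ x, G x < ∞ := by
    rw [hG, lintegral_indicator measurableSet_ball, setLIntegral_const]
    exact ENNReal.mul_lt_top ENNReal.ofReal_lt_top measure_ball_lt_top
  have hM0 : 0 ≤ M := (abs_nonneg _).trans (hM 0)
  have hpt : ∀ z : RN N × RN N, energyDensity q a φ z ≤
      (nearPairs N (ρ + d) d).indicator (energyDensity q a φ) z +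
        (G z.1 * farKernel N a d (z.1 - z.2) + G z.2 * farKernel N a d (z.1 - z.2)) := by
    intro z
    by_cases h1 : z.1 ∉ Metric.ball (0 : RN N) ρ ∧ z.2 ∉ Metric.ball (0 : RN N) ρ
    · have : energyDensity q a φ z = 0 := by
        unfold energyDensity
        rw [h0 _ h1.1, h0 _ h1.2]
        simp [Real.zero_rpow hq.ne']
      rw [this]; exact zero_le
    · rcases lt_or_ge ‖z.1 - z.2‖ d with h | h
      · have hz : z ∈ nearPairs N (ρ + d) d := by
          refine ⟨?_, h⟩
          rw [mem_ball_zero_iff]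
          by_cases h2 : z.1 ∈ Metric.ball (0 : RN N) ρ
          · rw [mem_ball_zero_iff] at h2; linarith
          · have h3 : z.2 ∈ Metric.ball (0 : RN N) ρ := by
              by_contra h3; exact h1 ⟨h2, h3⟩
            rw [mem_ball_zero_iff] at h3
            linarith [norm_sub_norm_le z.1 z.2]
        rw [Set.indicator_of_mem hz]
        exact le_self_add
      · refine le_trans ?_ le_add_self
        have hval : energyDensity q a φ z ≤
            ENNReal.ofReal ((2 * M) ^ q) * farKernel N a d (z.1 - z.2) := by
          rw [farKernel_eq _ h, ← ENNReal.ofReal_mul (by positivity)]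
          refine ENNReal.ofReal_le_ofReal ?_
          rw [mul_one_div]
          gcongr
          have := abs_sub (φ z.1) (φ z.2)
          linarith [hM z.1, hM z.2]
        by_cases h2 : z.1 ∈ Metric.ball (0 : RN N) ρ
        · refine le_trans ?_ le_self_add
          rw [hG, Set.indicator_of_mem h2]; exact hval
        · have h3 : z.2 ∈ Metric.ball (0 : RN N) ρ := by
            by_contra h3; exact h1 ⟨h2, h3⟩
          refine le_trans ?_ le_add_self
          rw [hG, Set.indicator_of_mem h3]; exact hval
  refine lt_of_le_of_lt (lintegral_mono hpt) ?_
  rw [lintegral_add_left (mE.indicator (measurableSet_nearPairs N _ _)),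
    lintegral_add_left (by fun_prop), lintegral_mul_sub_kernel hGm mk,
    lintegral_mul_sub_kernel' hGm mk (farKernel_neg a d),
    lintegral_indicator (measurableSet_nearPairs N _ _)]
  have := ENNReal.mul_lt_top hGi (lintegral_farKernel_lt_top (N := N) ha hd)
  exact ENNReal.add_lt_top.mpr ⟨hnear, ENNReal.add_lt_top.mpr ⟨this, this⟩⟩

lemma isTestFunction_of {N : ℕ} {p s₁ sp ρ M : ℝ} {Ω : Set (RN N)} {φ : RN N → ℝ} (hp : 0 < p)
    (hφ : Measurable φ) (hM : ∀ x, |φ x| ≤ M) (hΩ : Metric.closedBall (0 : RN N) ρ ⊆ Ω)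
    (h0 : ∀ x, x ∉ Metric.ball (0 : RN N) ρ → φ x = 0)
    (h1 : ∫⁻ z, energyDensity 1 (s₁ * 1) φ z < ∞) (h2 : ∫⁻ z, energyDensity p (sp * p) φ z < ∞) :
    IsTestFunction p s₁ sp Ω φ := by
  have hsup : tsupport φ ⊆ Metric.closedBall (0 : RN N) ρ := by
    refine closure_minimal ?_ Metric.isClosed_closedBall
    intro x hx
    by_contra hx'
    exact hx (h0 x fun h => hx' (Metric.ball_subset_closedBall h))
  have hcs : HasCompactSupport φ :=
    HasCompactSupport.of_support_subset_isCompact (isCompact_closedBall (0 : RN N) ρ)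
      ((subset_tsupport φ).trans hsup)
  have hmem : ∀ q : ℝ≥0∞, MemLp φ q (volume.restrict Set.univ) := by
    intro q
    rw [Measure.restrict_univ]
    exact hcs.memLp_of_bound hφ.aestronglyMeasurable M (Filter.Eventually.of_forall hM)
  refine ⟨⟨hmem _, ?_⟩, ⟨hmem _, ?_⟩, hcs, hsup.trans hΩ⟩
  · unfold gagliardo
    rw [Set.univ_prod_univ, Measure.restrict_univ]
    exact ENNReal.rpow_lt_top_of_nonneg (by norm_num) h1.ne
  · unfold gagliardo
    rw [Set.univ_prod_univ, Measure.restrict_univ]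
    exact ENNReal.rpow_lt_top_of_nonneg (by positivity) h2.ne

lemma add_add_rpow_le {q a b c : ℝ} (hq : 0 ≤ q) (ha : 0 ≤ a) (hb : 0 ≤ b) (hc : 0 ≤ c) :
    (a + b + c) ^ q ≤ 3 ^ q * (a ^ q + b ^ q + c ^ q) := by
  have hm : ∃ m, 0 ≤ m ∧ a ≤ m ∧ b ≤ m ∧ c ≤ m ∧ m ^ q ≤ a ^ q + b ^ q + c ^ q := by
    have e1 := Real.rpow_nonneg ha q
    have e2 := Real.rpow_nonneg hb q
    have e3 := Real.rpow_nonneg hc q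
    rcases le_total a b with h1 | h1 <;> rcases le_total b c with h2 | h2 <;>
      rcases le_total a c with h3 | h3
    · exact ⟨c, hc, by linarith, by linarith, by linarith, by linarith⟩
    · exact ⟨c, hc, by linarith, by linarith, by linarith, by linarith⟩
    · exact ⟨b, hb, by linarith, by linarith, by linarith, by linarith⟩
    · exact ⟨b, hb, by linarith, by linarith, by linarith, by linarith⟩
    · exact ⟨c, hc, by linarith, by linarith, by linarith, by linarith⟩
    · exact ⟨a, ha, by linarith, by linarith, by linarith, by linarith⟩
    · exact ⟨a, ha, by linarith, by linarith, by linarith, by linarith⟩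
    · exact ⟨a, ha, by linarith, by linarith, by linarith, by linarith⟩
  obtain ⟨m, hm0, h1, h2, h3, h4⟩ := hm
  calc (a + b + c) ^ q ≤ (3 * m) ^ q := Real.rpow_le_rpow (by positivity) (by linarith) hq
    _ = 3 ^ q * m ^ q := Real.mul_rpow (by norm_num) hm0
    _ ≤ _ := by gcongr

/-! ### Powers of differences as test functions. -/

/-- The test function: an odd power of the first difference of `u`, times a squared cutoff. -/
noncomputable def diffTest {N : ℕ} (k : ℝ) (u ζ : RN N → ℝ) (h x : RN N) : ℝ :=
  oddPow k (u (x + h) - u x) * ζ x ^ 2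

/-- Lipschitz cutoffs supported in the ball of radius `ρ`. -/
structure IsCutoff {N : ℕ} (ρ Λ : ℝ) (ζ : RN N → ℝ) : Prop where
  measurable : Measurable ζ
  mem_Icc : ∀ x, ζ x ∈ Set.Icc (0 : ℝ) 1
  eq_zero : ∀ x, x ∉ Metric.ball (0 : RN N) ρ → ζ x = 0
  lipschitz : ∀ x y, |ζ x - ζ y| ≤ Λ * ‖x - y‖

section diffTest

variable {N : ℕ} {k ρ d Λ : ℝ} {u ζ : RN N → ℝ} {h : RN N}

lemma measurable_diffTest (hu : Measurable u) (hζ : IsCutoff ρ Λ ζ) :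
    Measurable (diffTest k u ζ h) := by
  have := hζ.measurable
  have := measurable_oddPow k
  unfold diffTest; fun_prop

lemma diffTest_eq_zero (hζ : IsCutoff ρ Λ ζ) {x : RN N}
    (hx : x ∉ Metric.ball (0 : RN N) ρ) : diffTest k u ζ h x = 0 := by
  simp [diffTest, hζ.eq_zero x hx]

lemma abs_diff_le_two (hu : ∀ x ∈ Metric.ball (0 : RN N) 2, |u x| ≤ 1) {r : ℝ} (hr : r + ‖h‖ ≤ 2)
    {x : RN N} (hx : x ∈ Metric.ball (0 : RN N) r) : |u (x + h) - u x| ≤ 2 := by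
  rw [mem_ball_zero_iff] at hx
  have e1 := hu x (by rw [mem_ball_zero_iff]; linarith [norm_nonneg h])
  have e2 := hu (x + h) (by rw [mem_ball_zero_iff]; linarith [norm_add_le x h])
  linarith [abs_sub (u (x + h)) (u x)]

lemma abs_diffTest_le (hk : 0 ≤ k) (hζ : IsCutoff ρ Λ ζ) (x : RN N) :
    |diffTest k u ζ h x| ≤
      (Metric.ball (0 : RN N) ρ).indicator (fun x => |u (x + h) - u x| ^ (k + 1)) x := by
  by_cases hx : x ∈ Metric.ball (0 : RN N) ρ
  · rw [Set.indicator_of_mem hx, diffTest, abs_mul, abs_oddPow hk]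
    have h1 := (hζ.mem_Icc x).1
    have h2 := (hζ.mem_Icc x).2
    have : |ζ x ^ 2| ≤ 1 := by
      rw [abs_of_nonneg (by positivity)]; nlinarith
    exact mul_le_of_le_one_right (by positivity) this
  · rw [Set.indicator_of_notMem hx, diffTest_eq_zero hζ hx]; simp

lemma abs_diffTest_le_const (hk : 0 ≤ k) (hζ : IsCutoff ρ Λ ζ)
    (hu : ∀ x ∈ Metric.ball (0 : RN N) 2, |u x| ≤ 1) (hr : ρ + ‖h‖ ≤ 2) (x : RN N) :
    |diffTest k u ζ h x| ≤ 2 ^ (k + 1) := by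
  refine (abs_diffTest_le hk hζ x).trans ?_
  by_cases hx : x ∈ Metric.ball (0 : RN N) ρ
  · rw [Set.indicator_of_mem hx]
    exact Real.rpow_le_rpow (abs_nonneg _) (abs_diff_le_two hu hr hx) (by linarith)
  · rw [Set.indicator_of_notMem hx]; positivity

/-- Odd powers are Lipschitz on `[-2, 2]`, where the differences of `u` take their values, and the
squared cutoff is Lipschitz. Thus the test function inherits finite energy from `u` and its
translate. -/
lemma abs_diffTest_sub_le (hk : 0 ≤ k) (hΛ : 0 ≤ Λ) (hζ : IsCutoff ρ Λ ζ)
    (hu : ∀ x ∈ Metric.ball (0 : RN N) 2, |u x| ≤ 1) {r : ℝ} (hr : r + ‖h‖ ≤ 2) {x y : RN N}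
    (hx : x ∈ Metric.ball (0 : RN N) r) (hy : y ∈ Metric.ball (0 : RN N) r) :
    |diffTest k u ζ h x - diffTest k u ζ h y| ≤
      ((k + 1) * (2 * 2 ^ k) + 2 ^ (k + 1) * (2 * Λ)) *
        (|u (x + h) - u (y + h)| + |u x - u y| + ‖x - y‖) := by
  set X := u (x + h) - u x with hX
  set Y := u (y + h) - u y with hY
  have hX2 : |X| ≤ 2 := abs_diff_le_two hu hr hx
  have hY2 : |Y| ≤ 2 := abs_diff_le_two hu hr hy
  have e1 : |oddPow k X - oddPow k Y| ≤ (k + 1) * (2 * 2 ^ k) *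
      (|u (x + h) - u (y + h)| + |u x - u y|) := by
    refine (abs_oddPow_sub_le hk X Y).trans ?_
    have h1 := Real.rpow_le_rpow (abs_nonneg X) hX2 hk
    have h2 := Real.rpow_le_rpow (abs_nonneg Y) hY2 hk
    have h3 : |X - Y| ≤ |u (x + h) - u (y + h)| + |u x - u y| := by
      have : X - Y = (u (x + h) - u (y + h)) - (u x - u y) := by rw [hX, hY]; ring
      rw [this]; exact abs_sub _ _
    gcongr
    linarith
  have e2 : |oddPow k Y| ≤ 2 ^ (k + 1) := by
    rw [abs_oddPow hk]; exact Real.rpow_le_rpow (abs_nonneg _) hY2 (by linarith)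
  have e3 : |ζ x ^ 2 - ζ y ^ 2| ≤ 2 * Λ * ‖x - y‖ := by
    have : ζ x ^ 2 - ζ y ^ 2 = (ζ x + ζ y) * (ζ x - ζ y) := by ring
    rw [this, abs_mul, mul_assoc]
    refine mul_le_mul ?_ (hζ.lipschitz x y) (abs_nonneg _) (by norm_num)
    rw [abs_of_nonneg (by linarith [(hζ.mem_Icc x).1, (hζ.mem_Icc y).1])]
    linarith [(hζ.mem_Icc x).2, (hζ.mem_Icc y).2]
  have e4 : |ζ x ^ 2| ≤ 1 := by
    rw [abs_of_nonneg (by positivity)]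
    nlinarith [(hζ.mem_Icc x).1, (hζ.mem_Icc x).2]
  have e5 : diffTest k u ζ h x - diffTest k u ζ h y =
      (oddPow k X - oddPow k Y) * ζ x ^ 2 + oddPow k Y * (ζ x ^ 2 - ζ y ^ 2) := by
    simp only [diffTest, ← hX, ← hY]; ring
  rw [e5]
  set a := |u (x + h) - u (y + h)| + |u x - u y| with ha
  have ha0 : 0 ≤ a := by positivity
  calc _ ≤ |(oddPow k X - oddPow k Y) * ζ x ^ 2| + |oddPow k Y * (ζ x ^ 2 - ζ y ^ 2)| :=
        abs_add_le _ _
    _ ≤ (k + 1) * (2 * 2 ^ k) * a * 1 + 2 ^ (k + 1) * (2 * Λ * ‖x - y‖) := by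
        rw [abs_mul, abs_mul]; gcongr
    _ ≤ _ := by
        have h1 : 0 ≤ (k + 1) * (2 * 2 ^ k) * ‖x - y‖ := by positivity
        have h2 : 0 ≤ 2 ^ (k + 1) * (2 * Λ) * a := by positivity
        linarith

/-- The condition `a < q` gives Lipschitz functions finite energy near the diagonal. The lemma is
applied with `q = 1`, `a = s₁ * 1` and with `q = p`, `a = sp * p`, where it reads `s₁ < 1` and `sp <
1`. -/
lemma lintegral_energyDensity_diffTest_lt_top (hN : 1 ≤ N) {q a : ℝ} (hq : 0 < q) (ha : 0 < a)
    (haq : a < q) (hd : 0 < d) (hk : 0 ≤ k) (hΛ : 0 ≤ Λ) (hum : Measurable u)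
    (hu : ∀ x ∈ Metric.ball (0 : RN N) 2, |u x| ≤ 1) (hζ : IsCutoff ρ Λ ζ)
    (hr : ρ + 2 * d + ‖h‖ ≤ 2)
    (hE : ∫⁻ z in Metric.ball (0 : RN N) 2 ×ˢ Metric.ball (0 : RN N) 2, energyDensity q a u z < ∞) :
    ∫⁻ z, energyDensity q a (diffTest k u ζ h) z < ∞ := by
  have mE := measurable_energyDensity q a hum
  have mk := measurable_nearKernel N (q - a) d
  refine lintegral_energyDensity_lt_top hq ha hd (measurable_diffTest hum hζ)
    (abs_diffTest_le_const hk hζ hu (by linarith)) (fun x hx => diffTest_eq_zero hζ hx) ?_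
  set L := (k + 1) * (2 * 2 ^ k) + 2 ^ (k + 1) * (2 * Λ) with hL
  have hL0 : 0 ≤ L := by positivity
  set G : RN N → ℝ≥0∞ := (Metric.ball (0 : RN N) (ρ + d)).indicator (fun _ => 1) with hG
  have hGm : Measurable G := measurable_const.indicator measurableSet_ball
  have hGi : ∫⁻ x, G x < ∞ := by
    rw [hG, lintegral_indicator measurableSet_ball, setLIntegral_const]
    exact ENNReal.mul_lt_top (by simp) measure_ball_lt_top
  have hball : ∀ z ∈ nearPairs N (ρ + d) d, ‖z.1‖ < ρ + 2 * d ∧ ‖z.2‖ < ρ + 2 * d := by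
    rintro z ⟨h1, h2⟩
    rw [mem_ball_zero_iff] at h1
    rw [norm_sub_rev] at h2
    exact ⟨by linarith, by linarith [norm_sub_norm_le z.2 z.1]⟩
  have hpt : ∀ z ∈ nearPairs N (ρ + d) d, energyDensity q a (diffTest k u ζ h) z ≤
      ENNReal.ofReal (L ^ q * 3 ^ q) * (energyDensity q a u (z + (h, h)) + energyDensity q a u z +
        G z.1 * nearKernel N (q - a) d (z.1 - z.2)) := by
    intro z hz
    obtain ⟨b1, b2⟩ := hball z hz
    have hGz : G z.1 = 1 := Set.indicator_of_mem hz.1 _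
    rw [hGz, one_mul, nearKernel_eq _ hz.2]
    have e := abs_diffTest_sub_le (k := k) hk hΛ hζ hu (r := ρ + 2 * d) hr
      (mem_ball_zero_iff.mpr b1) (mem_ball_zero_iff.mpr b2)
    unfold energyDensity
    have hsub : (z + (h, h)).1 - (z + (h, h)).2 = z.1 - z.2 := by simp
    rw [hsub, Prod.fst_add, Prod.snd_add]
    rw [← ENNReal.ofReal_add (by positivity) (by positivity),
      ← ENNReal.ofReal_add (by positivity) (by positivity), ← ENNReal.ofReal_mul (by positivity)]
    refine ENNReal.ofReal_le_ofReal ?_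
    have hn : ‖z.1 - z.2‖ ^ q / ‖z.1 - z.2‖ ^ ((N : ℝ) + a) ≤ ‖z.1 - z.2‖ ^ (q - a - N) := by
      rcases eq_or_lt_of_le (norm_nonneg (z.1 - z.2)) with h0 | h0
      · rw [← h0, Real.zero_rpow hq.ne', zero_div]; positivity
      · rw [← Real.rpow_sub h0]; apply le_of_eq; congr 1; ring
    set A := |u (z.1 + h) - u (z.2 + h)|
    set B := |u z.1 - u z.2|
    set n := ‖z.1 - z.2‖
    have hA0 : 0 ≤ A := abs_nonneg _
    have hB0 : 0 ≤ B := abs_nonneg _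
    have hn0 : 0 ≤ n := norm_nonneg _
    have hnt : 0 ≤ n ^ ((N : ℝ) + a) := by positivity
    calc _ ≤ (L * (A + B + n)) ^ q / n ^ ((N : ℝ) + a) := by gcongr
      _ = L ^ q * (A + B + n) ^ q / n ^ ((N : ℝ) + a) := by
          rw [Real.mul_rpow hL0 (by positivity)]
      _ ≤ L ^ q * (3 ^ q * (A ^ q + B ^ q + n ^ q)) / n ^ ((N : ℝ) + a) := by
          gcongr
          exact add_add_rpow_le hq.le hA0 hB0 hn0
      _ = L ^ q * 3 ^ q * (A ^ q / n ^ ((N : ℝ) + a) + B ^ q / n ^ ((N : ℝ) + a) +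
          n ^ q / n ^ ((N : ℝ) + a)) := by ring
      _ ≤ _ := by gcongr
  refine lt_of_le_of_lt (setLIntegral_mono' (measurableSet_nearPairs N _ _) hpt) ?_
  rw [lintegral_const_mul _ (by fun_prop), lintegral_add_left (by fun_prop),
    lintegral_add_left (by fun_prop)]
  refine ENNReal.mul_lt_top ENNReal.ofReal_lt_top (ENNReal.add_lt_top.mpr
    ⟨ENNReal.add_lt_top.mpr ⟨?_, ?_⟩, ?_⟩)
  · refine lt_of_le_of_lt (setLIntegral_prod_comp_add_le _ (measurableSet_nearPairs N _ _)
      (measurableSet_ball.prod measurableSet_ball) h ?_) hE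
    intro z hz
    obtain ⟨b1, b2⟩ := hball z hz
    refine ⟨?_, ?_⟩
    · rw [mem_ball_zero_iff, Prod.fst_add]; linarith [norm_add_le z.1 h]
    · rw [mem_ball_zero_iff, Prod.snd_add]; linarith [norm_add_le z.2 h]
  · refine lt_of_le_of_lt (lintegral_mono_set ?_) hE
    intro z hz
    obtain ⟨b1, b2⟩ := hball z hz
    have := norm_nonneg h
    exact ⟨by rw [mem_ball_zero_iff]; linarith, by rw [mem_ball_zero_iff]; linarith⟩
  · refine lt_of_le_of_lt (setLIntegral_le_lintegral _ _) ?_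
    rw [lintegral_mul_sub_kernel hGm mk]
    exact ENNReal.mul_lt_top hGi (lintegral_nearKernel_lt_top hN (by linarith) d)

end diffTest

/-! ### The differentiated equation. -/

/-- Near the diagonal the integrand is dominated by the energies of `u` and `φ`, with exponents `p -
1` and `1`; away from it, `φ` is bounded with bounded support and `farDensity` is integrable in the
other variable. -/
lemma integrable_p_part {N : ℕ} {p s₁ sp ρ d M : ℝ} {u φ : RN N → ℝ} (hp : 2 ≤ p) (hsp : 0 < sp)
    (hd : 0 < d) (hd1 : d ≤ 1) (hu : NormalizedSolution p s₁ sp u) (hφ : Measurable φ)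
    (hM : ∀ x, |φ x| ≤ M) (h0 : ∀ x, x ∉ Metric.ball (0 : RN N) ρ → φ x = 0) (hρ : ρ + d ≤ 2)
    (hE : ∫⁻ z, energyDensity p (sp * p) φ z < ∞) :
    Integrable (fun z : RN N × RN N => oddPow (p - 2) (u z.1 - u z.2) * (φ z.1 - φ z.2) /
      ‖z.1 - z.2‖ ^ ((N : ℝ) + sp * p)) := by
  obtain ⟨C, hCt, hC⟩ := exists_lintegral_farDensity_le (N := N) (s₁ := s₁) hp hsp hd hd1
  have hum := hu.measurable
  have mo := measurable_oddPow (p - 2)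
  have mE := measurable_energyDensity p (sp * p) hum
  have mF := measurable_energyDensity p (sp * p) hφ
  have mD := measurable_farDensity p sp d hum
  have hM0 : 0 ≤ M := (abs_nonneg _).trans (hM 0)
  set G : RN N → ℝ≥0∞ := (Metric.ball (0 : RN N) ρ).indicator (fun _ => ENNReal.ofReal M) with hG
  have hGm : Measurable G := measurable_const.indicator measurableSet_ball
  have hGi : ∫⁻ x, G x < ∞ := by
    rw [hG, lintegral_indicator measurableSet_ball, setLIntegral_const]
    exact ENNReal.mul_lt_top ENNReal.ofReal_lt_top measure_ball_lt_top
  have hφG : ∀ x, ENNReal.ofReal |φ x| ≤ G x := by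
    intro x
    by_cases hx : x ∈ Metric.ball (0 : RN N) ρ
    · rw [hG, Set.indicator_of_mem hx]; exact ENNReal.ofReal_le_ofReal (hM x)
    · simp [h0 x hx]
  set B := Metric.ball (0 : RN N) 2 ×ˢ Metric.ball (0 : RN N) 2 with hB
  have hBm : MeasurableSet B := measurableSet_ball.prod measurableSet_ball
  refine ⟨Measurable.aestronglyMeasurable (by fun_prop), ?_⟩
  rw [hasFiniteIntegral_iff_norm]
  have hpt : ∀ z : RN N × RN N, ENNReal.ofReal ‖oddPow (p - 2) (u z.1 - u z.2) * (φ z.1 - φ z.2) /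
      ‖z.1 - z.2‖ ^ ((N : ℝ) + sp * p)‖ ≤ B.indicator (energyDensity p (sp * p) u) z +
        (energyDensity p (sp * p) φ z + (G z.1 * farDensity p sp d u (z.1 + 0, z.2 + 0) +
          G z.2 * farDensity p sp d u (z.1 + 0, z.2 + 0))) := by
    intro z
    rw [add_zero, add_zero, Prod.mk.eta]
    have hnorm : ‖oddPow (p - 2) (u z.1 - u z.2) * (φ z.1 - φ z.2) /
        ‖z.1 - z.2‖ ^ ((N : ℝ) + sp * p)‖ = |u z.1 - u z.2| ^ (p - 1) * |φ z.1 - φ z.2| /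
        ‖z.1 - z.2‖ ^ ((N : ℝ) + sp * p) := by
      rw [Real.norm_eq_abs, abs_div, abs_mul, abs_oddPow (by linarith),
        abs_of_nonneg (by positivity : 0 ≤ ‖z.1 - z.2‖ ^ ((N : ℝ) + sp * p))]
      congr 3; ring
    rw [hnorm]
    by_cases h1 : z.1 ∉ Metric.ball (0 : RN N) ρ ∧ z.2 ∉ Metric.ball (0 : RN N) ρ
    · rw [h0 _ h1.1, h0 _ h1.2]; simp
    · rcases lt_or_ge ‖z.1 - z.2‖ d with h | h
      · have hz : z ∈ B := by
          have hs := norm_sub_norm_le z.1 z.2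
          have hs' := norm_sub_norm_le z.2 z.1
          rw [norm_sub_rev] at hs'
          by_cases h2 : z.1 ∈ Metric.ball (0 : RN N) ρ
          · rw [mem_ball_zero_iff] at h2
            exact ⟨mem_ball_zero_iff.mpr (by linarith), mem_ball_zero_iff.mpr (by linarith)⟩
          · have h3 : z.2 ∈ Metric.ball (0 : RN N) ρ := by
              by_contra h3; exact h1 ⟨h2, h3⟩
            rw [mem_ball_zero_iff] at h3
            exact ⟨mem_ball_zero_iff.mpr (by linarith), mem_ball_zero_iff.mpr (by linarith)⟩
        rw [Set.indicator_of_mem hz, ← add_assoc]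
        refine le_trans ?_ le_self_add
        unfold energyDensity
        rw [← ENNReal.ofReal_add (by positivity) (by positivity), ← add_div]
        refine ENNReal.ofReal_le_ofReal ?_
        have := rpow_mul_rpow_le_add (abs_nonneg (u z.1 - u z.2)) (abs_nonneg (φ z.1 - φ z.2))
          (by linarith : 0 ≤ p - 1) (by linarith : p - 1 ≤ p)
        rw [sub_sub_cancel, Real.rpow_one] at this
        gcongr
      · refine le_trans ?_ le_add_self
        refine le_trans ?_ le_add_self
        rw [← add_mul]
        unfold farDensity
        rw [farKernel_eq _ h, ← ENNReal.ofReal_mul (by positivity), mul_one_div, mul_comm (_ ^ _),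
          mul_div_assoc, ENNReal.ofReal_mul (by positivity)]
        refine mul_le_mul_left ?_ _
        refine le_trans ?_ (add_le_add (hφG z.1) (hφG z.2))
        rw [← ENNReal.ofReal_add (by positivity) (by positivity)]
        exact ENNReal.ofReal_le_ofReal (abs_sub _ _)
  refine lt_of_le_of_lt (lintegral_mono hpt) ?_
  rw [lintegral_add_left (mE.indicator hBm), lintegral_add_left mF, lintegral_add_left (by fun_prop),
    lintegral_indicator hBm]
  have hG0 : ∀ x, x + 0 ∉ Metric.ball (0 : RN N) (2 - d) → G x = 0 := by
    intro x hx
    refine Set.indicator_of_notMem ?_ _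
    rw [add_zero] at hx
    exact fun h => hx (Metric.ball_subset_ball (by linarith) h)
  have hfin := ENNReal.mul_lt_top hGi hCt.lt_top
  refine ENNReal.add_lt_top.mpr ⟨lt_of_le_of_lt hu.energy_le (by simp), ENNReal.add_lt_top.mpr
    ⟨hE, ENNReal.add_lt_top.mpr ⟨?_, ?_⟩⟩⟩
  · exact lt_of_le_of_lt (lintegral_mul_farDensity_le hum (hC u hu) hGm hG0) hfin
  · exact lt_of_le_of_lt (lintegral_mul_farDensity_le' hum (hC u hu) hGm hG0) hfin

lemma integrable_one_part {N : ℕ} {s₁ : ℝ} {φ : RN N → ℝ} {Z : RN N × RN N → ℝ}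
    (hZ : AEStronglyMeasurable Z volume) (hZ1 : ∀ᵐ z, |Z z| ≤ 1) (hφ : Measurable φ)
    (hE : ∫⁻ z, energyDensity 1 (s₁ * 1) φ z < ∞) :
    Integrable (fun z : RN N × RN N => Z z * (φ z.1 - φ z.2) / ‖z.1 - z.2‖ ^ ((N : ℝ) + s₁)) := by
  have hI : Integrable (fun z : RN N × RN N => (φ z.1 - φ z.2) / ‖z.1 - z.2‖ ^ ((N : ℝ) + s₁)) := by
    refine ⟨Measurable.aestronglyMeasurable (by fun_prop), ?_⟩
    rw [hasFiniteIntegral_iff_norm]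
    convert hE using 3 with z
    unfold energyDensity
    rw [norm_div, Real.norm_eq_abs, Real.rpow_one, mul_one,
      Real.norm_of_nonneg (by positivity : 0 ≤ ‖z.1 - z.2‖ ^ ((N : ℝ) + s₁))]
  simp_rw [mul_div_assoc]
  exact hI.bdd_mul hZ hZ1

lemma lintegral_energyDensity_shift {N : ℕ} (q a : ℝ) (φ : RN N → ℝ) (h : RN N) :
    ∫⁻ z, energyDensity q a (fun x => φ (x - h)) z = ∫⁻ z, energyDensity q a φ z := by
  rw [← lintegral_add_right_eq_self _ ((h, h) : RN N × RN N)]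
  refine lintegral_congr fun z => ?_
  simp [energyDensity]

/-- Test with `φ` and with `φ(· - h)`, move the shift onto the coefficients by translating both
variables by `h`, which fixes the kernels, and subtract. `Z'` is the translate of `Z`, a sign
selection for the translated function. Integrability of each piece allows the four integrals to be
merged into one. -/
lemma exists_differentiated_equation {N : ℕ} {p s₁ sp ρ d M : ℝ} {u φ : RN N → ℝ} {h : RN N}
    (hp : 2 ≤ p) (hsp : 0 < sp) (hd : 0 < d) (hd1 : d ≤ 1) (hu : NormalizedSolution p s₁ sp u)
    (hφ : Measurable φ) (hM : ∀ x, |φ x| ≤ M)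
    (h0 : ∀ x, x ∉ Metric.ball (0 : RN N) ρ → φ x = 0) (hρ : ρ + ‖h‖ + d ≤ 2)
    (hE1 : ∫⁻ z, energyDensity 1 (s₁ * 1) φ z < ∞)
    (hE : ∫⁻ z, energyDensity p (sp * p) φ z < ∞) :
    ∃ ε ∈ Set.Icc (0 : ℝ) 1, ∃ Z Z' : RN N × RN N → ℝ,
      (∀ᵐ z : RN N × RN N, Z' z ∈ sgnSet (u (z.1 + h) - u (z.2 + h))) ∧
      (∀ᵐ z : RN N × RN N, Z z ∈ sgnSet (u z.1 - u z.2)) ∧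
      Integrable (fun z : RN N × RN N =>
        ε * ((Z' z - Z z) * (φ z.1 - φ z.2) / ‖z.1 - z.2‖ ^ ((N : ℝ) + s₁)) +
          (oddPow (p - 2) (u (z.1 + h) - u (z.2 + h)) - oddPow (p - 2) (u z.1 - u z.2)) *
            (φ z.1 - φ z.2) / ‖z.1 - z.2‖ ^ ((N : ℝ) + sp * p)) ∧
      ∫ z : RN N × RN N,
        (ε * ((Z' z - Z z) * (φ z.1 - φ z.2) / ‖z.1 - z.2‖ ^ ((N : ℝ) + s₁)) +
          (oddPow (p - 2) (u (z.1 + h) - u (z.2 + h)) - oddPow (p - 2) (u z.1 - u z.2)) *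
            (φ z.1 - φ z.2) / ‖z.1 - z.2‖ ^ ((N : ℝ) + sp * p)) = 0 := by
  obtain ⟨ε, hε, Z, hZm, hZs, hZeq⟩ := hu.equation
  have hp0 : 0 < p := by linarith
  have hhn := norm_nonneg h
  set ψ : RN N → ℝ := fun x => φ (x - h) with hψ
  have hψm : Measurable ψ := by fun_prop
  have hψM : ∀ x, |ψ x| ≤ M := fun x => hM _
  have hψ0 : ∀ x, x ∉ Metric.ball (0 : RN N) (ρ + ‖h‖) → ψ x = 0 := by
    intro x hx
    refine h0 _ fun hx' => hx ?_
    rw [mem_ball_zero_iff] at *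
    linarith [norm_sub_norm_le x h]
  have hψE1 : ∫⁻ z, energyDensity 1 (s₁ * 1) ψ z < ∞ := by
    rw [lintegral_energyDensity_shift]; exact hE1
  have hψE : ∫⁻ z, energyDensity p (sp * p) ψ z < ∞ := by
    rw [lintegral_energyDensity_shift]; exact hE
  have hZ1 : ∀ᵐ z, |Z z| ≤ 1 := hZs.mono fun z hz => abs_le_one_of_mem_sgnSet hz
  have eqφ := hZeq φ (isTestFunction_of hp0 hφ hM (Metric.closedBall_subset_ball (by linarith))
    h0 hE1 hE)
  have eqψ := hZeq ψ (isTestFunction_of hp0 hψm hψM (Metric.closedBall_subset_ball (by linarith))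
    hψ0 hψE1 hψE)
  have i1 := integrable_one_part hZm hZ1 hφ hE1
  have i1' := integrable_one_part hZm hZ1 hψm hψE1
  have i2 := integrable_p_part hp hsp hd hd1 hu hφ hM h0 (by linarith) hE
  have i2' := integrable_p_part hp hsp hd hd1 hu hψm hψM hψ0 (by linarith) hψE
  have j1' := i1'.comp_add_right ((h, h) : RN N × RN N)
  have j2' := i2'.comp_add_right ((h, h) : RN N × RN N)
  rw [← integral_add_right_eq_self _ ((h, h) : RN N × RN N),
    ← integral_add_right_eq_self (fun z : RN N × RN N => |u z.1 - u z.2| ^ (p - 2) *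
      (u z.1 - u z.2) * (ψ z.1 - ψ z.2) / ‖z.1 - z.2‖ ^ ((N : ℝ) + sp * p))
      ((h, h) : RN N × RN N)] at eqψ
  simp only [hψ, Prod.fst_add, Prod.snd_add, add_sub_cancel_right, add_sub_add_right_eq_sub]
    at eqψ j1' j2'
  have htot := ((j1'.sub i1).const_mul ε).add (j2'.sub i2)
  have hform : (fun z : RN N × RN N =>
        ε * ((Z (z + (h, h)) - Z z) * (φ z.1 - φ z.2) / ‖z.1 - z.2‖ ^ ((N : ℝ) + s₁)) +
          (oddPow (p - 2) (u (z.1 + h) - u (z.2 + h)) - oddPow (p - 2) (u z.1 - u z.2)) *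
            (φ z.1 - φ z.2) / ‖z.1 - z.2‖ ^ ((N : ℝ) + sp * p)) =
      fun z => ε * (Z (z + (h, h)) * (φ z.1 - φ z.2) / ‖z.1 - z.2‖ ^ ((N : ℝ) + s₁) -
          Z z * (φ z.1 - φ z.2) / ‖z.1 - z.2‖ ^ ((N : ℝ) + s₁)) +
        (oddPow (p - 2) (u (z.1 + h) - u (z.2 + h)) * (φ z.1 - φ z.2) /
            ‖z.1 - z.2‖ ^ ((N : ℝ) + sp * p) -
          oddPow (p - 2) (u z.1 - u z.2) * (φ z.1 - φ z.2) / ‖z.1 - z.2‖ ^ ((N : ℝ) + sp * p)) := by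
    funext z; ring
  refine ⟨ε, hε, Z, fun z => Z (z + (h, h)), ?_, hZs, ?_, ?_⟩
  · exact (measurePreserving_add_right volume ((h, h) : RN N × RN N)).quasiMeasurePreserving.ae hZs
  · rw [hform]; exact htot
  · rw [hform]
    have e1 := integral_add ((j1'.sub i1).const_mul ε) (j2'.sub i2)
    simp only [Pi.sub_apply] at e1
    rw [e1, integral_const_mul, integral_sub j1' i1, integral_sub j2' i2]
    unfold oddPow
    linarith

/-! ### The energy estimate for differences. -/

/-- The positive and negative parts of `T` have equal finite integrals and cancel. Thus `P ≤ T + E`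
can be integrated without knowing beforehand that `P` or `E` has finite integral. -/
lemma lintegral_le_of_integral_eq_zero {α : Type*} [MeasurableSpace α] {μ : Measure α}
    {T : α → ℝ} {P E : α → ℝ≥0∞} (hT : Integrable T μ) (hT0 : ∫ z, T z ∂μ = 0) (hP : Measurable P)
    (h : ∀ᵐ z ∂μ, P z + ENNReal.ofReal (-T z) ≤ ENNReal.ofReal (T z) + E z) :
    ∫⁻ z, P z ∂μ ≤ ∫⁻ z, E z ∂μ := by
  have hm : AEMeasurable (fun z => ENNReal.ofReal (T z)) μ := hT.1.aemeasurable.ennreal_ofReal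
  have h1 := lintegral_mono_ae h
  rw [lintegral_add_left hP, lintegral_add_left' hm] at h1
  have hf1 : ∫⁻ z, ENNReal.ofReal (T z) ∂μ ≠ ∞ := hT.lintegral_lt_top.ne
  have hf2 : ∫⁻ z, ENNReal.ofReal (-T z) ∂μ ≠ ∞ := hT.neg.lintegral_lt_top.ne
  have h2 : ∫⁻ z, ENNReal.ofReal (T z) ∂μ = ∫⁻ z, ENNReal.ofReal (-T z) ∂μ := by
    rw [integral_eq_lintegral_pos_part_sub_lintegral_neg_part hT, sub_eq_zero,
      ENNReal.toReal_eq_toReal_iff' hf1 hf2] at hT0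
    exact hT0
  rw [h2, add_comm] at h1
  exact (ENNReal.add_le_add_iff_left hf2).mp h1

/-- A substitute for Hölder's inequality, with a factor 2: apply `rpow_mul_rpow_le_add` to `|f| / a`
and `|g| / b`, which normalizes both functions to the same size. -/
lemma lintegral_rpow_mul_rpow_le {α : Type*} [MeasurableSpace α] {μ : Measure α} {f g : α → ℝ}
    (hf : Measurable f) (hg : Measurable g) {q θ a b K : ℝ} (h0 : 0 ≤ θ) (h1 : θ ≤ q) (ha : 0 < a)
    (hb : 0 < b) (hK : 0 ≤ K) (hfi : ∫⁻ x, ENNReal.ofReal (|f x| ^ q) ∂μ ≤ ENNReal.ofReal (K * a ^ q))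
    (hgi : ∫⁻ x, ENNReal.ofReal (|g x| ^ q) ∂μ ≤ ENNReal.ofReal (K * b ^ q)) :
    ∫⁻ x, ENNReal.ofReal (|f x| ^ θ * |g x| ^ (q - θ)) ∂μ ≤
      ENNReal.ofReal (2 * K * (a ^ θ * b ^ (q - θ))) := by
  have hc : 0 ≤ a ^ θ * b ^ (q - θ) := by positivity
  have hpt : ∀ x, ENNReal.ofReal (|f x| ^ θ * |g x| ^ (q - θ)) ≤
      ENNReal.ofReal (a ^ θ * b ^ (q - θ) / a ^ q) * ENNReal.ofReal (|f x| ^ q) +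
        ENNReal.ofReal (a ^ θ * b ^ (q - θ) / b ^ q) * ENNReal.ofReal (|g x| ^ q) := by
    intro x
    rw [← ENNReal.ofReal_mul (by positivity), ← ENNReal.ofReal_mul (by positivity),
      ← ENNReal.ofReal_add (by positivity) (by positivity)]
    refine ENNReal.ofReal_le_ofReal ?_
    have h := rpow_mul_rpow_le_add (a := |f x| / a) (b := |g x| / b) (by positivity) (by positivity)
      h0 h1
    rw [Real.div_rpow (by positivity) ha.le, Real.div_rpow (by positivity) hb.le,
      Real.div_rpow (by positivity) ha.le, Real.div_rpow (by positivity) hb.le] at h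
    have h2 := mul_le_mul_of_nonneg_left h hc
    have e1 : a ^ θ ≠ 0 := by positivity
    have e2 : b ^ (q - θ) ≠ 0 := by positivity
    calc _ = a ^ θ * b ^ (q - θ) * (|f x| ^ θ / a ^ θ * (|g x| ^ (q - θ) / b ^ (q - θ))) := by
          field_simp
      _ ≤ _ := h2
      _ = _ := by ring
  refine (lintegral_mono hpt).trans ?_
  rw [lintegral_add_left (by fun_prop), lintegral_const_mul _ (by fun_prop),
    lintegral_const_mul _ (by fun_prop)]
  refine (add_le_add (mul_le_mul_right hfi _) (mul_le_mul_right hgi _)).trans ?_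
  rw [← ENNReal.ofReal_mul (by positivity), ← ENNReal.ofReal_mul (by positivity),
      ← ENNReal.ofReal_add (by positivity) (by positivity)]
  refine ENNReal.ofReal_le_ofReal (le_of_eq ?_)
  have e1 : a ^ q ≠ 0 := by positivity
  have e2 : b ^ q ≠ 0 := by positivity
  field_simp
  ring

/-- First differences of `u` of step less than `h₀` are of size `‖h‖^α` in `L^q(B_r)`. -/
def DiffBound {N : ℕ} (α q r h₀ K : ℝ) (u : RN N → ℝ) : Prop :=
  ∀ h : RN N, ‖h‖ < h₀ → ∫⁻ x in Metric.ball 0 r, ENNReal.ofReal (|u (x + h) - u x| ^ q) ≤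
    ENNReal.ofReal (K * ‖h‖ ^ (α * q))

lemma DiffBound.shift {N : ℕ} {α q r h₀ K : ℝ} {u : RN N → ℝ} (H : DiffBound α q r h₀ K u)
    {h c : RN N} (hh : ‖h‖ < h₀) {R : ℝ} (hR : R + ‖c‖ ≤ r) :
    ∫⁻ x in Metric.ball 0 R, ENNReal.ofReal (|u (x + c + h) - u (x + c)| ^ q) ≤
      ENNReal.ofReal (K * (‖h‖ ^ α) ^ q) := by
  rw [← Real.rpow_mul (norm_nonneg h)]
  exact (setLIntegral_ball_comp_add_le (fun x => ENNReal.ofReal (|u (x + h) - u x| ^ q)) hR).trans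
    (H h hh)

/-- Lowering the exponent on a ball: the product estimate against the constant function one. -/
lemma DiffBound.lintegral_rpow_le {N : ℕ} {α q r h₀ K θ : ℝ} {u : RN N → ℝ}
    (H : DiffBound α q r h₀ K u) (hum : Measurable u) (hK : 0 ≤ K) (hθ : 0 ≤ θ) (hθq : θ ≤ q)
    {h : RN N} (hne : h ≠ 0) (hh : ‖h‖ < h₀) {R : ℝ} (hR : R ≤ r) :
    ∫⁻ x in Metric.ball 0 R, ENNReal.ofReal (|u (x + h) - u x| ^ θ) ≤
      ENNReal.ofReal (2 * (K + (volume (Metric.ball (0 : RN N) R)).toReal) * ‖h‖ ^ (α * θ)) := by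
  have hpos : 0 < ‖h‖ := norm_pos_iff.mpr hne
  set V := (volume (Metric.ball (0 : RN N) R)).toReal with hV
  have hV0 : 0 ≤ V := ENNReal.toReal_nonneg
  have h1 := H.shift (c := 0) hh (R := R) (by simpa using hR)
  simp only [add_zero] at h1
  have h2 := lintegral_rpow_mul_rpow_le (μ := volume.restrict (Metric.ball (0 : RN N) R))
    (f := fun x => u (x + h) - u x) (g := fun _ => 1) (by fun_prop) (by fun_prop) hθ hθq
    (a := ‖h‖ ^ α) (b := 1) (K := K + V) (by positivity) one_pos (by positivity)
    (h1.trans (ENNReal.ofReal_le_ofReal (by gcongr; linarith))) (by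
      simp only [abs_one, Real.one_rpow, ENNReal.ofReal_one, mul_one]
      rw [lintegral_const, one_mul, Measure.restrict_apply_univ,
        ← ENNReal.ofReal_toReal (measure_ball_lt_top (x := (0 : RN N)) (r := R)).ne]
      exact ENNReal.ofReal_le_ofReal (by linarith))
  simp only [abs_one, Real.one_rpow, mul_one] at h2
  rwa [← Real.rpow_mul hpos.le] at h2

/-- For a fixed increment `y` between the two points, the integrand is a sum of four products of a
difference of step `y` to the power `m` and one of step `h` to the power `k + 2`. The hypothesis on
differences serves both: it gives the factor in `h`, and the gain `‖y‖^(α m)` helps make the weight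
integrable even when `σ` exceeds 2. -/
lemma lintegral_near_error_le {N : ℕ} (hN : 1 ≤ N) {α m k r h₀ K R d σ : ℝ} {u : RN N → ℝ}
    (hm : 0 ≤ m) (hk : 0 ≤ k) (hum : Measurable u) (hK : 0 ≤ K)
    (H : DiffBound α (m + k + 2) r h₀ K u) {h : RN N} (hne : h ≠ 0) (hh : ‖h‖ < h₀) (hd : d ≤ h₀)
    (hR : R + d + ‖h‖ ≤ r) :
    ∫⁻ z in nearPairs N R d,
      ENNReal.ofReal ((|u (z.1 + h) - u (z.2 + h)| ^ m + |u z.1 - u z.2| ^ m) *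
        (|u (z.1 + h) - u z.1| ^ (k + 2) + |u (z.2 + h) - u z.2| ^ (k + 2)) *
          ‖z.1 - z.2‖ ^ (2 - N - σ)) ≤
      ENNReal.ofReal (8 * K * ‖h‖ ^ (α * (k + 2))) * ∫⁻ x, nearKernel N (2 - σ + α * m) d x := by
  have hpos : 0 < ‖h‖ := norm_pos_iff.mpr hne
  have : Nonempty (Fin N) := ⟨⟨0, hN⟩⟩
  set F : RN N × RN N → ℝ≥0∞ := fun z =>
    ENNReal.ofReal ((|u (z.1 + h) - u (z.2 + h)| ^ m + |u z.1 - u z.2| ^ m) *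
        (|u (z.1 + h) - u z.1| ^ (k + 2) + |u (z.2 + h) - u z.2| ^ (k + 2)) *
          ‖z.1 - z.2‖ ^ (2 - N - σ)) with hF
  have hFm : Measurable F := by simp only [hF]; fun_prop
  have hSm := measurableSet_nearPairs N R d
  have hIm : Measurable ((nearPairs N R d).indicator F) := hFm.indicator hSm
  change ∫⁻ z in nearPairs N R d, F z ≤ _
  rw [← lintegral_indicator hSm, volume_prod_lintegral hIm]
  have hsub : ∀ x, ∫⁻ y, (nearPairs N R d).indicator F (x, y) =
      ∫⁻ y, (nearPairs N R d).indicator F (x, x + y) := fun x =>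
    (lintegral_add_left_eq_self (fun y => (nearPairs N R d).indicator F (x, y)) x).symm
  simp_rw [hsub]
  have hcm : Measurable (Function.uncurry fun x y => (nearPairs N R d).indicator F (x, x + y)) :=
    hIm.comp (by fun_prop : Measurable fun z : RN N × RN N => (z.1, z.1 + z.2))
  rw [lintegral_lintegral_swap hcm.aemeasurable,
    ← lintegral_const_mul _ (measurable_nearKernel _ _ _)]
  refine lintegral_mono_ae ?_
  -- The powers of `‖y‖` may be negative; the origin is a null set.
  have hae : ∀ᵐ y : RN N, y ≠ 0 := by
    rw [ae_iff]; simp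
  filter_upwards [hae] with y hy
  have hy0 : 0 < ‖y‖ := norm_pos_iff.mpr hy
  rcases le_or_gt d ‖y‖ with hyd | hyd
  · have : ∀ x, (nearPairs N R d).indicator F (x, x + y) = 0 := by
      intro x
      refine Set.indicator_of_notMem ?_ _
      rintro ⟨-, h2⟩
      simp at h2
      linarith
    simp [this]
  have hxeq : ∀ x, (nearPairs N R d).indicator F (x, x + y) =
      (Metric.ball (0 : RN N) R).indicator (fun x => F (x, x + y)) x := by
    intro x
    by_cases hx : x ∈ Metric.ball (0 : RN N) R
    · rw [Set.indicator_of_mem hx, Set.indicator_of_mem (show (x, x + y) ∈ nearPairs N R d from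
        ⟨hx, by simpa using hyd⟩)]
    · rw [Set.indicator_of_notMem hx, Set.indicator_of_notMem (fun h => hx h.1)]
  simp_rw [hxeq]
  rw [lintegral_indicator measurableSet_ball, nearKernel_eq _ hyd]
  set B : ℝ := ‖y‖ ^ (2 - N - σ) with hB
  have hB0 : 0 ≤ B := by positivity
  set f₁ : RN N → ℝ := fun x => u (x + h + y) - u (x + h) with hf₁
  set f₂ : RN N → ℝ := fun x => u (x + y) - u x with hf₂
  set g₁ : RN N → ℝ := fun x => u (x + h) - u x with hg₁
  set g₂ : RN N → ℝ := fun x => u (x + y + h) - u (x + y) with hg₂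
  have mf₁ : Measurable f₁ := by fun_prop
  have mf₂ : Measurable f₂ := by fun_prop
  have mg₁ : Measurable g₁ := by fun_prop
  have mg₂ : Measurable g₂ := by fun_prop
  have if₁ : ∫⁻ x in Metric.ball 0 R, ENNReal.ofReal (|f₁ x| ^ (m + k + 2)) ≤
      ENNReal.ofReal (K * (‖y‖ ^ α) ^ (m + k + 2)) := H.shift (by linarith) (by linarith)
  have if₂ : ∫⁻ x in Metric.ball 0 R, ENNReal.ofReal (|f₂ x| ^ (m + k + 2)) ≤
      ENNReal.ofReal (K * (‖y‖ ^ α) ^ (m + k + 2)) := by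
    have := H.shift (h := y) (c := 0) (by linarith) (R := R) (by simp; linarith)
    simpa only [add_zero] using this
  have ig₁ : ∫⁻ x in Metric.ball 0 R, ENNReal.ofReal (|g₁ x| ^ (m + k + 2)) ≤
      ENNReal.ofReal (K * (‖h‖ ^ α) ^ (m + k + 2)) := by
    have := H.shift (h := h) (c := 0) (by linarith) (R := R) (by simp; linarith)
    simpa only [add_zero] using this
  have ig₂ : ∫⁻ x in Metric.ball 0 R, ENNReal.ofReal (|g₂ x| ^ (m + k + 2)) ≤
      ENNReal.ofReal (K * (‖h‖ ^ α) ^ (m + k + 2)) := H.shift (by linarith) (by linarith)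
  have hmq : m ≤ m + k + 2 := by linarith
  have hya : 0 < ‖y‖ ^ α := by positivity
  have hha : 0 < ‖h‖ ^ α := by positivity
  have hqm : m + k + 2 - m = k + 2 := by ring
  have b11 := lintegral_rpow_mul_rpow_le mf₁ mg₁ hm hmq hya hha hK if₁ ig₁
  have b12 := lintegral_rpow_mul_rpow_le mf₁ mg₂ hm hmq hya hha hK if₁ ig₂
  have b21 := lintegral_rpow_mul_rpow_le mf₂ mg₁ hm hmq hya hha hK if₂ ig₁
  have b22 := lintegral_rpow_mul_rpow_le mf₂ mg₂ hm hmq hya hha hK if₂ ig₂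
  rw [hqm] at b11 b12 b21 b22
  have hexp : ∀ x, F (x, x + y) = ENNReal.ofReal B *
      (ENNReal.ofReal (|f₁ x| ^ m * |g₁ x| ^ (k + 2)) + (ENNReal.ofReal (|f₁ x| ^ m * |g₂ x| ^ (k + 2))
      + (ENNReal.ofReal (|f₂ x| ^ m * |g₁ x| ^ (k + 2)) +
        ENNReal.ofReal (|f₂ x| ^ m * |g₂ x| ^ (k + 2))))) := by
    intro x
    rw [← ENNReal.ofReal_add (by positivity) (by positivity),
      ← ENNReal.ofReal_add (by positivity) (by positivity),
      ← ENNReal.ofReal_add (by positivity) (by positivity), ← ENNReal.ofReal_mul hB0]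
    have hn : ‖x - (x + y)‖ = ‖y‖ := by simp
    have e1 : |u (x + h) - u (x + y + h)| = |f₁ x| := by
      rw [abs_sub_comm]; simp only [hf₁]; rw [add_right_comm]
    have e2 : |u x - u (x + y)| = |f₂ x| := abs_sub_comm _ _
    simp only [hF]
    rw [hn, e1, e2]
    congr 1
    simp only [hg₁, hg₂, hB]
    ring
  simp_rw [hexp]
  rw [lintegral_const_mul _ (by fun_prop), lintegral_add_left (by fun_prop),
    lintegral_add_left (by fun_prop), lintegral_add_left (by fun_prop)]
  refine (mul_le_mul_right (add_le_add b11 (add_le_add b12 (add_le_add b21 b22))) _).trans ?_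
  rw [← ENNReal.ofReal_add (by positivity) (by positivity),
      ← ENNReal.ofReal_add (by positivity) (by positivity),
      ← ENNReal.ofReal_add (by positivity) (by positivity), ← ENNReal.ofReal_mul hB0,
      ← ENNReal.ofReal_mul (by positivity)]
  refine ENNReal.ofReal_le_ofReal (le_of_eq ?_)
  have e3 : ‖y‖ ^ (2 - σ + α * m - N) = B * (‖y‖ ^ α) ^ m := by
    rw [hB, ← Real.rpow_mul hy0.le, ← Real.rpow_add hy0]; congr 1; ring
  rw [e3, Real.rpow_mul hpos.le]
  ring

lemma exists_isCutoff (N : ℕ) {r d : ℝ} (hd : 0 < d) :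
    ∃ ζ : RN N → ℝ, IsCutoff (r + d) (1 / d) ζ ∧ ∀ x ∈ Metric.ball (0 : RN N) r, ζ x = 1 := by
  refine ⟨fun x => max 0 (min 1 ((r + d - ‖x‖) / d)), ⟨by fun_prop, ?_, ?_, ?_⟩, ?_⟩
  · intro x
    exact ⟨le_max_left _ _, max_le zero_le_one (min_le_left _ _)⟩
  · intro x hx
    have hx' : r + d ≤ ‖x‖ := by simpa using hx
    have : (r + d - ‖x‖) / d ≤ 0 := div_nonpos_of_nonpos_of_nonneg (by linarith) hd.le
    exact max_eq_left ((min_le_right _ _).trans this)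
  · intro x y
    refine (abs_max_sub_max_le_max _ _ _ _).trans ?_
    refine max_le (by simp; positivity) ?_
    refine (abs_min_sub_min_le_max _ _ _ _).trans ?_
    refine max_le (by simp; positivity) ?_
    rw [← sub_div, abs_div, abs_of_pos hd, div_eq_inv_mul, one_div]
    gcongr
    have : r + d - ‖x‖ - (r + d - ‖y‖) = ‖y‖ - ‖x‖ := by ring
    rw [this, norm_sub_rev]
    exact abs_norm_sub_norm_le y x
  · intro x hx
    have hx' : ‖x‖ < r := by simpa using hx
    have : 1 ≤ (r + d - ‖x‖) / d := by rw [le_div_iff₀ hd]; linarith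
    simp [min_eq_left this]

/-- Rewrites a real inequality without subtraction, in the form required by
`lintegral_le_of_integral_eq_zero`. -/
lemma ofReal_add_ofReal_neg_le {P T e : ℝ} (hP : 0 ≤ P) (h : P ≤ T + e) (he : 0 ≤ e) {E : ℝ≥0∞}
    (hE : ENNReal.ofReal e ≤ E) :
    ENNReal.ofReal P + ENNReal.ofReal (-T) ≤ ENNReal.ofReal T + E := by
  rcases le_total 0 T with hT | hT
  · rw [ENNReal.ofReal_of_nonpos (by linarith : -T ≤ 0), add_zero]
    refine (ENNReal.ofReal_le_ofReal h).trans ?_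
    rw [ENNReal.ofReal_add hT he]
    gcongr
  · rw [ENNReal.ofReal_of_nonpos hT, zero_add]
    refine le_trans ?_ hE
    rw [← ENNReal.ofReal_add hP (by linarith)]
    exact ENNReal.ofReal_le_ofReal (by linarith)

/-- Adds `p_part_ge` and `sgn_part_ge`. The Lipschitz cutoff supplies `n ^ 2` against the `p`-kernel
and `n` against the sign kernel, and `ε ≤ 1` removes `ε` from the error. -/
lemma near_pointwise {m k ε z₁ z₂ a b X Y zx zy Λ n τ τ₁ : ℝ} (hm : 0 ≤ m) (hk : 0 ≤ k)
    (hε : ε ∈ Set.Icc (0 : ℝ) 1) (h₁ : z₁ ∈ sgnSet a) (h₂ : z₂ ∈ sgnSet b) (ht : a - b = X - Y)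
    (hzx : zx ∈ Set.Icc (0 : ℝ) 1) (hzy : zy ∈ Set.Icc (0 : ℝ) 1) (hn : 0 ≤ n)
    (hlip : |zx - zy| ≤ Λ * n) :
    |X - Y| ^ (m + k + 2) * (zx ^ 2 + zy ^ 2) / (16 * 2 ^ m * 2 ^ k) / n ^ τ ≤
      (ε * ((z₁ - z₂) * (oddPow k X * zx ^ 2 - oddPow k Y * zy ^ 2) / n ^ τ₁) +
        (oddPow m a - oddPow m b) * (oddPow k X * zx ^ 2 - oddPow k Y * zy ^ 2) / n ^ τ) +
      (4 * (m + 1) * Λ ^ 2 * ((|a| ^ m + |b| ^ m) * (|X| ^ (k + 2) + |Y| ^ (k + 2)) * (n ^ 2 / n ^ τ)) +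
        2 * Λ * ((|X| ^ (k + 1) + |Y| ^ (k + 1)) * (n / n ^ τ₁))) := by
  set P := oddPow k X * zx ^ 2 - oddPow k Y * zy ^ 2 with hP
  have e1 := p_part_ge hm hk ht hzx.1 hzy.1
  have e2 := sgn_part_ge hk h₁ h₂ ht hzx hzy
  have hsq : (zx - zy) ^ 2 ≤ Λ ^ 2 * n ^ 2 := by
    rw [← sq_abs (zx - zy), ← mul_pow]
    gcongr
  have e1' : |X - Y| ^ (m + k + 2) * (zx ^ 2 + zy ^ 2) / (16 * 2 ^ m * 2 ^ k) ≤
      (oddPow m a - oddPow m b) * P +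
      4 * (m + 1) * (|a| ^ m + |b| ^ m) * (|X| ^ (k + 2) + |Y| ^ (k + 2)) * (Λ ^ 2 * n ^ 2) := by
    have : 4 * (m + 1) * (|a| ^ m + |b| ^ m) * (|X| ^ (k + 2) + |Y| ^ (k + 2)) * (zx - zy) ^ 2 ≤
      4 * (m + 1) * (|a| ^ m + |b| ^ m) * (|X| ^ (k + 2) + |Y| ^ (k + 2)) * (Λ ^ 2 * n ^ 2) := by
      gcongr
    linarith
  have e2' : 0 ≤ ε * ((z₁ - z₂) * P) + 2 * (|X| ^ (k + 1) + |Y| ^ (k + 1)) * (Λ * n) := by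
    have h3 : 2 * (|X| ^ (k + 1) + |Y| ^ (k + 1)) * |zx - zy| ≤
      2 * (|X| ^ (k + 1) + |Y| ^ (k + 1)) * (Λ * n) := by gcongr
    have h4 : 0 ≤ 2 * (|X| ^ (k + 1) + |Y| ^ (k + 1)) * |zx - zy| := by positivity
    set c := 2 * (|X| ^ (k + 1) + |Y| ^ (k + 1)) * |zx - zy|
    have h5 : ε * -c ≤ ε * ((z₁ - z₂) * P) := mul_le_mul_of_nonneg_left e2 hε.1
    have h6 : ε * c ≤ c := mul_le_of_le_one_left h4 hε.2
    linarith
  have f1 := div_le_div_of_nonneg_right e1' (by positivity : 0 ≤ n ^ τ)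
  have f2 := div_nonneg e2' (by positivity : 0 ≤ n ^ τ₁)
  rw [add_div] at f1 f2
  refine f1.trans ?_
  rw [mul_div_assoc] at f2
  have g1 : 4 * (m + 1) * (|a| ^ m + |b| ^ m) * (|X| ^ (k + 2) + |Y| ^ (k + 2)) * (Λ ^ 2 * n ^ 2) / n ^ τ
      = 4 * (m + 1) * Λ ^ 2 * ((|a| ^ m + |b| ^ m) * (|X| ^ (k + 2) + |Y| ^ (k + 2)) *
        (n ^ 2 / n ^ τ)) := by ring
  have g2 : 2 * (|X| ^ (k + 1) + |Y| ^ (k + 1)) * (Λ * n) / n ^ τ₁ =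
      2 * Λ * ((|X| ^ (k + 1) + |Y| ^ (k + 1)) * (n / n ^ τ₁)) := by ring
  rw [g1]
  rw [g2] at f2
  linarith

/-- Away from the diagonal no coercivity is sought: both terms are bounded in absolute value. -/
lemma far_pointwise {m ε z₁ z₂ a b φx φy n τ τ₁ : ℝ} (hm : 0 ≤ m)
    (hε : ε ∈ Set.Icc (0 : ℝ) 1) (h₁ : z₁ ∈ sgnSet a) (h₂ : z₂ ∈ sgnSet b) (hn : 0 ≤ n) :
    0 ≤ (ε * ((z₁ - z₂) * (φx - φy) / n ^ τ₁) +
        (oddPow m a - oddPow m b) * (φx - φy) / n ^ τ) +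
      ((|φx| + |φy|) * ((|a| ^ (m + 1) + |b| ^ (m + 1)) * (1 / n ^ τ)) +
        2 * ((|φx| + |φy|) * (1 / n ^ τ₁))) := by
  have hφ := abs_sub φx φy
  have hz : |z₁ - z₂| ≤ 2 := by
    have := abs_sub z₁ z₂
    linarith [abs_le_one_of_mem_sgnSet h₁, abs_le_one_of_mem_sgnSet h₂]
  have hD : |oddPow m a - oddPow m b| ≤ |a| ^ (m + 1) + |b| ^ (m + 1) := by
    have := abs_sub (oddPow m a) (oddPow m b)
    rwa [abs_oddPow hm, abs_oddPow hm] at this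
  have e1 : |(z₁ - z₂) * (φx - φy)| ≤ 2 * (|φx| + |φy|) := by
    rw [abs_mul]; gcongr
  have e2 : |(oddPow m a - oddPow m b) * (φx - φy)| ≤
      (|a| ^ (m + 1) + |b| ^ (m + 1)) * (|φx| + |φy|) := by
    rw [abs_mul]; gcongr
  have f1 : 0 ≤ ε * ((z₁ - z₂) * (φx - φy)) + 2 * (|φx| + |φy|) := by
    have h5 : ε * -(2 * (|φx| + |φy|)) ≤ ε * ((z₁ - z₂) * (φx - φy)) :=
      mul_le_mul_of_nonneg_left (abs_le.mp e1).1 hε.1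
    have h6 : ε * (2 * (|φx| + |φy|)) ≤ 2 * (|φx| + |φy|) :=
      mul_le_of_le_one_left (by positivity) hε.2
    linarith
  have f2 : 0 ≤ (oddPow m a - oddPow m b) * (φx - φy) +
      (|a| ^ (m + 1) + |b| ^ (m + 1)) * (|φx| + |φy|) := by
    linarith [(abs_le.mp e2).1]
  have g1 := mul_nonneg f1 (by positivity : 0 ≤ 1 / n ^ τ₁)
  have g2 := mul_nonneg f2 (by positivity : 0 ≤ 1 / n ^ τ)
  have : (ε * ((z₁ - z₂) * (φx - φy) / n ^ τ₁) +
        (oddPow m a - oddPow m b) * (φx - φy) / n ^ τ) +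
      ((|φx| + |φy|) * ((|a| ^ (m + 1) + |b| ^ (m + 1)) * (1 / n ^ τ)) +
        2 * ((|φx| + |φy|) * (1 / n ^ τ₁))) =
      (ε * ((z₁ - z₂) * (φx - φy)) + 2 * (|φx| + |φy|)) * (1 / n ^ τ₁) +
      ((oddPow m a - oddPow m b) * (φx - φy) +
        (|a| ^ (m + 1) + |b| ^ (m + 1)) * (|φx| + |φy|)) * (1 / n ^ τ) := by ring
  rw [this]
  positivity

/-- Only an inequality, since at `n = 0`, `c = 0` the right side is one and the left side zero. -/
lemma rpow_div_rpow_le {n e τ c : ℝ} (hn : 0 ≤ n) (he : e ≠ 0) (hc : c = e - τ) :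
    n ^ e / n ^ τ ≤ n ^ c := by
  rcases eq_or_lt_of_le hn with h0 | h0
  · rw [← h0, Real.zero_rpow he, zero_div]; positivity
  · rw [← Real.rpow_sub h0, hc]

set_option maxHeartbeats 1600000 in
-- The differentiated equation is tested with `diffTest`. The near error of the `p`-term has size
-- `‖h‖^(α(k+2))`. The near error of the sign term and all far terms are linear in `|δ|^(k+1)`, `δ`
-- being the difference of step `h`, and give `‖h‖^(α(k+1))`, the larger of the two. `hcond` is the
-- integrability condition of the near error.
lemma exists_energy_estimate {N : ℕ} (hN : 1 ≤ N) {p s₁ sp α k r d h₀ K : ℝ} (hp : 2 ≤ p)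
    (hs₁ : s₁ ∈ Set.Ioo (0 : ℝ) 1) (hsp : 0 < sp) (hsp1 : sp < 1) (hα : 0 < α)
    (hcond : 0 < 2 - sp * p + α * (p - 2)) (hk : 0 ≤ k) (hd : 0 < d) (hd1 : d ≤ 1) (hdh : d ≤ h₀)
    (hK : 0 ≤ K) (hr : r + 5 * d ≤ 2) :
    ∃ C : ℝ, 0 ≤ C ∧ ∀ u : RN N → ℝ, NormalizedSolution p s₁ sp u →
      DiffBound α (p - 2 + k + 2) (r + 4 * d) h₀ K u → ∀ h : RN N, h ≠ 0 → ‖h‖ < d →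
      ∫⁻ z in nearPairs N r d, ENNReal.ofReal
        (|(u (z.1 + h) - u z.1) - (u (z.2 + h) - u z.2)| ^ (p - 2 + k + 2) /
          ‖z.1 - z.2‖ ^ ((N : ℝ) + sp * p)) ≤ ENNReal.ofReal (C * ‖h‖ ^ (α * (k + 1))) := by
  obtain ⟨hs0, hs1⟩ := hs₁
  -- Radii: the cutoff lives in `r + d`, near pairs meeting its support lie in `r + 2d`, `W` below
  -- is cut at `r + 3d`, and the shift by `h` uses another `d`. The last `d` keeps the distance to
  -- radius 2 needed for the far density.
  obtain ⟨ζ, hζ, hζ1⟩ := exists_isCutoff N (r := r) hd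
  obtain ⟨Cf, hCft, hCf⟩ := exists_lintegral_farDensity_le (N := N) (s₁ := s₁) hp hsp hd hd1
  set Λ : ℝ := 1 / d with hΛ
  have hΛ0 : 0 ≤ Λ := by positivity
  set V := (volume (Metric.ball (0 : RN N) (r + 3 * d))).toReal with hV
  have hV0 : 0 ≤ V := ENNReal.toReal_nonneg
  have hspp : 0 < sp * p := by positivity
  set κ₁ := ∫⁻ x, nearKernel N (2 - sp * p + α * (p - 2)) d x with hκ₁
  set κ₂ := ∫⁻ x, nearKernel N (1 - s₁) d x with hκ₂
  set κ₃ := ∫⁻ x, farKernel N s₁ d x with hκ₃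
  have hκ₁t : κ₁ ≠ ∞ := (lintegral_nearKernel_lt_top hN hcond d).ne
  have hκ₂t : κ₂ ≠ ∞ := (lintegral_nearKernel_lt_top hN (by linarith) d).ne
  have hκ₃t : κ₃ ≠ ∞ := (lintegral_farKernel_lt_top hs0 hd).ne
  have hm : 0 ≤ p - 2 := by linarith
  set c : ℝ := 16 * 2 ^ (p - 2) * 2 ^ k with hc
  have hc0 : 0 < c := by positivity
  set D : ℝ≥0∞ := ENNReal.ofReal (4 * (p - 2 + 1) * Λ ^ 2) * (ENNReal.ofReal (8 * K) * κ₁) +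
    ENNReal.ofReal (2 * (K + V)) * (ENNReal.ofReal (2 * Λ) * (κ₂ + κ₂) +
      ((Cf + Cf) + (Cf + Cf) + ENNReal.ofReal 2 * (κ₃ + κ₃))) with hD
  have hDt : D ≠ ∞ := by
    rw [hD]
    refine ENNReal.add_ne_top.mpr ⟨ENNReal.mul_ne_top ENNReal.ofReal_ne_top
      (ENNReal.mul_ne_top ENNReal.ofReal_ne_top hκ₁t), ENNReal.mul_ne_top ENNReal.ofReal_ne_top ?_⟩
    simp only [ne_eq, ENNReal.add_eq_top, ENNReal.mul_eq_top, ENNReal.ofReal_ne_top, hκ₂t, hκ₃t, hCft,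
      or_self, and_false, false_and, not_false_eq_true]
  refine ⟨c * D.toReal, by positivity, ?_⟩
  intro u hu hB h hne hhd
  have hum := hu.measurable
  have hpos : 0 < ‖h‖ := norm_pos_iff.mpr hne
  have mφ : Measurable (diffTest k u ζ h) := measurable_diffTest hum hζ
  have mf := measurable_farDensity p sp d hum
  have mk2 := measurable_nearKernel N (1 - s₁) d
  have mk3 := measurable_farKernel N s₁ d
  have hφ0 : ∀ x, x ∉ Metric.ball (0 : RN N) (r + d) → diffTest k u ζ h x = 0 :=
    fun x hx => diffTest_eq_zero hζ hx
  -- Here alone the finite `s₁`-energy of `u` enters, to make the test function admissible; no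
  -- constant depends on its size.
  obtain ⟨ε, hε, Z, Z', hZ', hZ, hTi, hT0⟩ := exists_differentiated_equation (h := h) hp hsp hd hd1
    hu mφ (abs_diffTest_le_const hk hζ hu.abs_le_one (by linarith)) hφ0 (by linarith)
    (lintegral_energyDensity_diffTest_lt_top hN one_pos (by linarith) (by linarith) hd hk hΛ0 hum
      hu.abs_le_one hζ (by linarith) hu.energy_one_lt_top)
    (lintegral_energyDensity_diffTest_lt_top hN (by linarith) hspp (by nlinarith) hd hk hΛ0 hum
      hu.abs_le_one hζ (by linarith) (lt_of_le_of_lt hu.energy_le (by simp)))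
  set W : RN N → ℝ≥0∞ := (Metric.ball (0 : RN N) (r + 3 * d)).indicator
    (fun x => ENNReal.ofReal (|u (x + h) - u x| ^ (k + 1))) with hW
  have hWm : Measurable W := Measurable.indicator (by fun_prop) measurableSet_ball
  have hWi : ∫⁻ x, W x ≤ ENNReal.ofReal (2 * (K + V) * ‖h‖ ^ (α * (k + 1))) := by
    rw [hW, lintegral_indicator measurableSet_ball]
    exact hB.lintegral_rpow_le hum hK (by linarith) (by linarith) hne (by linarith) (by linarith)
  have hφW : ∀ x, ENNReal.ofReal |diffTest k u ζ h x| ≤ W x := by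
    intro x
    refine (ENNReal.ofReal_le_ofReal (abs_diffTest_le hk hζ x)).trans ?_
    by_cases hx : x ∈ Metric.ball (0 : RN N) (r + d)
    · rw [Set.indicator_of_mem hx, hW, Set.indicator_of_mem
        (Metric.ball_subset_ball (by linarith) hx)]
    · rw [Set.indicator_of_notMem hx]; simp
  set F : RN N × RN N → ℝ≥0∞ := fun z =>
    ENNReal.ofReal ((|u (z.1 + h) - u (z.2 + h)| ^ (p - 2) + |u z.1 - u z.2| ^ (p - 2)) *
        (|u (z.1 + h) - u z.1| ^ (k + 2) + |u (z.2 + h) - u z.2| ^ (k + 2)) *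
          ‖z.1 - z.2‖ ^ (2 - N - sp * p)) with hF
  have hFm : Measurable F := by simp only [hF]; fun_prop
  set E : RN N × RN N → ℝ≥0∞ := fun z =>
    ENNReal.ofReal (4 * (p - 2 + 1) * Λ ^ 2) * (nearPairs N (r + d + d) d).indicator F z +
    (ENNReal.ofReal (2 * Λ) * (W z.1 * nearKernel N (1 - s₁) d (z.1 - z.2) +
        W z.2 * nearKernel N (1 - s₁) d (z.1 - z.2)) +
     ((W z.1 * farDensity p sp d u (z.1 + h, z.2 + h) + W z.2 * farDensity p sp d u (z.1 + h, z.2 + h)) +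
      (W z.1 * farDensity p sp d u (z.1 + 0, z.2 + 0) + W z.2 * farDensity p sp d u (z.1 + 0, z.2 + 0)) +
      ENNReal.ofReal 2 * (W z.1 * farKernel N s₁ d (z.1 - z.2) + W z.2 * farKernel N s₁ d (z.1 - z.2))))
    with hE
  have hEi : ∫⁻ z, E z ≤ D * ENNReal.ofReal (‖h‖ ^ (α * (k + 1))) := by
    have hSm := measurableSet_nearPairs N (r + d + d) d
    have hIm : Measurable ((nearPairs N (r + d + d) d).indicator F) := hFm.indicator hSm
    have hW0 : ∀ c : RN N, ‖c‖ ≤ d →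
        ∀ x, x + c ∉ Metric.ball (0 : RN N) (2 - d) → W x = 0 := by
      intro c hcd x hx
      refine Set.indicator_of_notMem (fun hx' => hx ?_) _
      rw [mem_ball_zero_iff] at *
      linarith [norm_add_le x c]
    have i1 : ∫⁻ z, (nearPairs N (r + d + d) d).indicator F z ≤
        ENNReal.ofReal (8 * K * ‖h‖ ^ (α * (k + 2))) * κ₁ := by
      rw [lintegral_indicator hSm]
      exact lintegral_near_error_le hN hm hk hum hK hB hne (by linarith) hdh (by linarith)
    -- As `‖h‖ < d ≤ 1`, the exponent may be lowered to that of the other errors.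
    have i1' : ENNReal.ofReal (8 * K * ‖h‖ ^ (α * (k + 2))) ≤
        ENNReal.ofReal (8 * K) * ENNReal.ofReal (‖h‖ ^ (α * (k + 1))) := by
      rw [← ENNReal.ofReal_mul (by positivity)]
      refine ENNReal.ofReal_le_ofReal (mul_le_mul_of_nonneg_left ?_ (by positivity))
      exact Real.rpow_le_rpow_of_exponent_ge hpos (by linarith) (by nlinarith)
    have j1 := lintegral_mul_farDensity_le hum (hCf u hu) hWm (hW0 h hhd.le)
    have j2 := lintegral_mul_farDensity_le' hum (hCf u hu) hWm (hW0 h hhd.le)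
    have j3 := lintegral_mul_farDensity_le hum (hCf u hu) hWm (hW0 0 (by simpa using hd.le))
    have j4 := lintegral_mul_farDensity_le' hum (hCf u hu) hWm (hW0 0 (by simpa using hd.le))
    rw [hE, lintegral_add_left (by fun_prop), lintegral_add_left (by fun_prop),
      lintegral_add_left (by fun_prop), lintegral_add_left (by fun_prop),
      lintegral_add_left (by fun_prop), lintegral_add_left (by fun_prop),
      lintegral_const_mul _ (by fun_prop), lintegral_const_mul _ (by fun_prop),
      lintegral_const_mul _ (by fun_prop), lintegral_add_left (by fun_prop),
      lintegral_add_left (by fun_prop),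
      lintegral_mul_sub_kernel hWm mk2, lintegral_mul_sub_kernel' hWm mk2 (nearKernel_neg _ _),
      lintegral_mul_sub_kernel hWm mk3, lintegral_mul_sub_kernel' hWm mk3 (farKernel_neg _ _)]
    rw [ENNReal.ofReal_mul (by positivity)] at hWi
    set H := ENNReal.ofReal (‖h‖ ^ (α * (k + 1))) with hH
    calc _ ≤ ENNReal.ofReal (4 * (p - 2 + 1) * Λ ^ 2) * ((ENNReal.ofReal (8 * K) * H) * κ₁) +
          (ENNReal.ofReal (2 * Λ) * ((∫⁻ x, W x) * κ₂ + (∫⁻ x, W x) * κ₂) +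
          (((∫⁻ x, W x) * Cf + (∫⁻ x, W x) * Cf) + ((∫⁻ x, W x) * Cf + (∫⁻ x, W x) * Cf) +
            ENNReal.ofReal 2 * ((∫⁻ x, W x) * κ₃ + (∫⁻ x, W x) * κ₃))) :=
          add_le_add (mul_le_mul_right (i1.trans (mul_le_mul_left i1' _)) _)
            (add_le_add le_rfl (add_le_add (add_le_add (add_le_add j1 j2) (add_le_add j3 j4)) le_rfl))
      _ = ENNReal.ofReal (4 * (p - 2 + 1) * Λ ^ 2) * ((ENNReal.ofReal (8 * K) * H) * κ₁) +
          (∫⁻ x, W x) * (ENNReal.ofReal (2 * Λ) * (κ₂ + κ₂) +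
          ((Cf + Cf) + (Cf + Cf) + ENNReal.ofReal 2 * (κ₃ + κ₃))) := by ring
      _ ≤ ENNReal.ofReal (4 * (p - 2 + 1) * Λ ^ 2) * ((ENNReal.ofReal (8 * K) * H) * κ₁) +
          (ENNReal.ofReal (2 * (K + V)) * H) * (ENNReal.ofReal (2 * Λ) * (κ₂ + κ₂) +
          ((Cf + Cf) + (Cf + Cf) + ENNReal.ofReal 2 * (κ₃ + κ₃))) := by gcongr
      _ = _ := by rw [hD]; ring
  set Q : RN N × RN N → ℝ≥0∞ := (nearPairs N r d).indicator fun z => ENNReal.ofReal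
    (|(u (z.1 + h) - u z.1) - (u (z.2 + h) - u z.2)| ^ (p - 2 + k + 2) / c /
      ‖z.1 - z.2‖ ^ ((N : ℝ) + sp * p)) with hQ
  have hQm : Measurable Q := Measurable.indicator (by fun_prop) (measurableSet_nearPairs N r d)
  have hkey : ∫⁻ z, Q z ≤ ∫⁻ z, E z := by
    refine lintegral_le_of_integral_eq_zero hTi hT0 hQm ?_
    filter_upwards [hZ', hZ] with z hz' hz
    -- Pairs missing the support of the test function contribute nothing. The others are split at
    -- distance `d` between `near_pointwise` and `far_pointwise`.
    by_cases h1 : z.1 ∉ Metric.ball (0 : RN N) (r + d) ∧ z.2 ∉ Metric.ball (0 : RN N) (r + d)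
    · have hQ0 : Q z = 0 := by
        refine Set.indicator_of_notMem (fun hz0 => h1.1 ?_) _
        exact Metric.ball_subset_ball (by linarith) hz0.1
      rw [hQ0, hφ0 _ h1.1, hφ0 _ h1.2]
      simp
    · have hor : z.1 ∈ Metric.ball (0 : RN N) (r + d) ∨ z.2 ∈ Metric.ball (0 : RN N) (r + d) := by
        tauto
      rcases lt_or_ge ‖z.1 - z.2‖ d with hnd | hnd
      · have hs := norm_sub_norm_le z.1 z.2
        have hs' := norm_sub_norm_le z.2 z.1
        rw [norm_sub_rev] at hs'
        have b1 : ‖z.1‖ < r + d + d := by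
          rcases hor with h2 | h2 <;> rw [mem_ball_zero_iff] at h2 <;> linarith
        have b2 : ‖z.2‖ < r + d + d := by
          rcases hor with h2 | h2 <;> rw [mem_ball_zero_iff] at h2 <;> linarith
        have hnp : z ∈ nearPairs N (r + d + d) d := ⟨mem_ball_zero_iff.mpr b1, hnd⟩
        have key := near_pointwise (m := p - 2) (k := k) (ε := ε) (X := u (z.1 + h) - u z.1)
          (Y := u (z.2 + h) - u z.2) (n := ‖z.1 - z.2‖) (τ := N + sp * p) (τ₁ := N + s₁) hm hk hε
          hz' hz (by ring) (hζ.mem_Icc z.1) (hζ.mem_Icc z.2) (norm_nonneg _) (hζ.lipschitz z.1 z.2)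
        have hQle : Q z ≤ ENNReal.ofReal (|(u (z.1 + h) - u z.1) - (u (z.2 + h) - u z.2)| ^
            (p - 2 + k + 2) * (ζ z.1 ^ 2 + ζ z.2 ^ 2) / c / ‖z.1 - z.2‖ ^ ((N : ℝ) + sp * p)) := by
          by_cases hz0 : z ∈ nearPairs N r d
          · rw [hQ, Set.indicator_of_mem hz0]
            refine ENNReal.ofReal_le_ofReal ?_
            rw [hζ1 _ hz0.1]
            gcongr
            exact le_mul_of_one_le_right (by positivity) (by nlinarith [sq_nonneg (ζ z.2)])
          · rw [hQ, Set.indicator_of_notMem hz0]; exact zero_le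
        refine (add_le_add_left hQle _).trans (ofReal_add_ofReal_neg_le (by positivity) key
          (by positivity) ?_)
        have w1 : W z.1 = ENNReal.ofReal (|u (z.1 + h) - u z.1| ^ (k + 1)) :=
          Set.indicator_of_mem (mem_ball_zero_iff.mpr (by linarith)) _
        have w2 : W z.2 = ENNReal.ofReal (|u (z.2 + h) - u z.2| ^ (k + 1)) :=
          Set.indicator_of_mem (mem_ball_zero_iff.mpr (by linarith)) _
        rw [hE]
        simp only
        rw [← add_assoc]
        refine le_trans ?_ le_self_add
        rw [ENNReal.ofReal_add (by positivity) (by positivity),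
          ENNReal.ofReal_mul (by positivity : 0 ≤ 4 * (p - 2 + 1) * Λ ^ 2),
          ENNReal.ofReal_mul (by positivity : 0 ≤ 2 * Λ)]
        rw [Set.indicator_of_mem hnp, ← add_mul, w1, w2, nearKernel_eq _ hnd,
          ← ENNReal.ofReal_add (by positivity) (by positivity),
          ← ENNReal.ofReal_mul (by positivity : 0 ≤ |u (z.1 + h) - u z.1| ^ (k + 1) +
            |u (z.2 + h) - u z.2| ^ (k + 1))]
        refine add_le_add (mul_le_mul_right (ENNReal.ofReal_le_ofReal ?_) _)
          (mul_le_mul_right (ENNReal.ofReal_le_ofReal ?_) _)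
        · refine mul_le_mul_of_nonneg_left ?_ (by positivity)
          rw [← Real.rpow_natCast]
          exact rpow_div_rpow_le (norm_nonneg _) (by norm_num) (by push_cast; ring)
        · refine mul_le_mul_of_nonneg_left ?_ (by positivity)
          nth_rw 1 [← Real.rpow_one ‖z.1 - z.2‖]
          exact rpow_div_rpow_le (norm_nonneg _) (by norm_num) (by ring)
      · have hQ0 : Q z = ENNReal.ofReal 0 := by
          rw [ENNReal.ofReal_zero]
          exact Set.indicator_of_notMem (fun hz0 => absurd hz0.2 (not_lt.mpr hnd)) _
        have key := far_pointwise (m := p - 2) (ε := ε) (φx := diffTest k u ζ h z.1)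
          (φy := diffTest k u ζ h z.2) (n := ‖z.1 - z.2‖) (τ := N + sp * p) (τ₁ := N + s₁) hm hε
          hz' hz (norm_nonneg _)
        rw [hQ0]
        refine ofReal_add_ofReal_neg_le le_rfl key (by positivity) ?_
        rw [hE]
        simp only
        refine le_trans ?_ le_add_self
        refine le_trans ?_ le_add_self
        have hφs : ENNReal.ofReal (|diffTest k u ζ h z.1| + |diffTest k u ζ h z.2|) ≤ W z.1 + W z.2 := by
          rw [ENNReal.ofReal_add (by positivity) (by positivity)]
          exact add_le_add (hφW _) (hφW _)
        have hφa : 0 ≤ |diffTest k u ζ h z.1| + |diffTest k u ζ h z.2| := by positivity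
        rw [ENNReal.ofReal_add (by positivity) (by positivity), ENNReal.ofReal_mul hφa,
          ENNReal.ofReal_mul (by positivity : (0:ℝ) ≤ 2), ENNReal.ofReal_mul hφa]
        rw [← add_mul, ← add_mul, ← add_mul, ← mul_add, farKernel_eq _ hnd]
        refine add_le_add (mul_le_mul hφs ?_ zero_le zero_le)
          (mul_le_mul_right (mul_le_mul_left hφs _) _)
        unfold farDensity
        simp only [add_zero, add_sub_add_right_eq_sub]
        rw [farKernel_eq _ hnd, ← add_mul, ← ENNReal.ofReal_add (by positivity) (by positivity),
          ← ENNReal.ofReal_mul (by positivity)]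
        have : p - 2 + 1 = p - 1 := by ring
        rw [this]
  have hfin : ∫⁻ z in nearPairs N r d, ENNReal.ofReal
        (|(u (z.1 + h) - u z.1) - (u (z.2 + h) - u z.2)| ^ (p - 2 + k + 2) /
          ‖z.1 - z.2‖ ^ ((N : ℝ) + sp * p)) = ENNReal.ofReal c * ∫⁻ z, Q z := by
    rw [← lintegral_indicator (measurableSet_nearPairs N r d), ← lintegral_const_mul _ hQm]
    refine lintegral_congr fun z => ?_
    by_cases hz0 : z ∈ nearPairs N r d
    · rw [hQ, Set.indicator_of_mem hz0, Set.indicator_of_mem hz0, ← ENNReal.ofReal_mul hc0.le]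
      congr 1
      field_simp
    · rw [hQ, Set.indicator_of_notMem hz0, Set.indicator_of_notMem hz0, mul_zero]
  rw [hfin]
  refine (mul_le_mul_right (hkey.trans hEi) _).trans (le_of_eq ?_)
  rw [mul_assoc, ENNReal.ofReal_mul hc0.le, ENNReal.ofReal_mul ENNReal.toReal_nonneg,
    ENNReal.ofReal_toReal hDt]

/-! ### Bootstrapping the order of differentiability. -/

/-- Normalized solutions have first differences of order `α` in `L^q`, with locally uniform constants. -/
def NikolskiiBound (N : ℕ) (p s₁ sp α q : ℝ) : Prop :=
  ∀ r : ℝ, 0 < r → r < 2 → ∃ K h₀ : ℝ, 0 ≤ K ∧ 0 < h₀ ∧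
    ∀ u : RN N → ℝ, NormalizedSolution p s₁ sp u → DiffBound α q r h₀ K u

/-- The energy estimate bounds the energy of a first difference; `lintegral_diff_le_gagliardo`,
applied to that difference with the same step `h`, gains a further `‖h‖^(sp p)` for second
differences. Returning to first differences is where `α' < 1` is needed. -/
lemma NikolskiiBound.improve {N : ℕ} (hN : 1 ≤ N) {p s₁ sp α α' k q : ℝ} (hp : 2 ≤ p)
    (hs₁ : s₁ ∈ Set.Ioo (0 : ℝ) 1) (hsp : 0 < sp) (hsp1 : sp < 1) (hα : 0 < α)
    (hcond : 0 < 2 - sp * p + α * (p - 2)) (hk : 0 ≤ k) (hq : q = p - 2 + k + 2)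
    (hα' : α' * q = α * (k + 1) + sp * p) (hα'0 : 0 < α') (hα'1 : α' < 1)
    (H : NikolskiiBound N p s₁ sp α q) : NikolskiiBound N p s₁ sp α' q := by
  intro r hr0 hr2
  have hq1 : 1 ≤ q := by linarith
  have hspp : 0 < sp * p := by positivity
  -- The argument reaches out to radius `r + 6 d₁`, still below 2.
  set d₁ := (2 - r) / 8 with hd₁
  have hd₁0 : 0 < d₁ := by linarith
  obtain ⟨K, h₀, hK, hh₀, HB⟩ := H (r + 5 * d₁) (by linarith) (by linarith)
  set d := min d₁ (min h₀ 1) with hd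
  have hd0 : 0 < d := by positivity
  have hdd : d ≤ d₁ := min_le_left _ _
  have hdh : d ≤ h₀ := (min_le_right _ _).trans (min_le_left _ _)
  have hd1 : d ≤ 1 := (min_le_right _ _).trans (min_le_right _ _)
  obtain ⟨C, hC, HC⟩ := exists_energy_estimate hN (r := r + d₁) (h₀ := h₀) hp hs₁ hsp hsp1 hα hcond hk
    hd0 hd1 hdh hK (by linarith)
  obtain ⟨C', hC', HC'⟩ := lintegral_diff_le_gagliardo (N := N) q (sp * p) (by linarith) hspp.le
  obtain ⟨K', hK', HK'⟩ := lintegral_diff_le_of_second_diff (N := N) (q := q) (α := α') (r := r)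
    (h₀ := d / 2) (K := C' * C) hq1 hα'0 hα'1 (by positivity) (by positivity) (by linarith)
  refine ⟨K', d / 2, hK', by positivity, ?_⟩
  intro u hu
  have hum := hu.measurable
  refine HK' u hum hu.abs_le_one ?_
  intro h hh
  rcases eq_or_ne h 0 with rfl | hne
  · simp [Real.zero_rpow (by linarith : q ≠ 0)]
  have hpos : 0 < ‖h‖ := norm_pos_iff.mpr hne
  have hB : DiffBound α (p - 2 + k + 2) (r + d₁ + 4 * d) h₀ K u := by
    intro η hη
    rw [← hq]
    exact le_trans (lintegral_mono_set (Metric.ball_subset_ball (by linarith))) (HB u hu η hη)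
  have e1 := HC u hu hB h hne (by linarith)
  have e2 := HC' (fun x => u (x + h) - u x) (by fun_prop) r (r + d₁) d h (by linarith) (by linarith) hne
  rw [← hq] at e1
  refine e2.trans ((mul_le_mul_right e1 _).trans (le_of_eq ?_))
  rw [← ENNReal.ofReal_mul (by positivity), hα', Real.rpow_add hpos]
  congr 1
  ring

/-- Differences are bounded by 2 on the relevant balls, so raising the exponent costs only a
constant; the product of order and exponent is preserved. -/
lemma NikolskiiBound.interpolate {N : ℕ} {p s₁ sp α q α' q' : ℝ} (hq : 0 ≤ q) (hqq : q ≤ q')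
    (hα : α' * q' = α * q) (H : NikolskiiBound N p s₁ sp α q) :
    NikolskiiBound N p s₁ sp α' q' := by
  intro r hr0 hr2
  obtain ⟨K, h₀, hK, hh₀, HB⟩ := H r hr0 hr2
  refine ⟨2 ^ (q' - q) * K, min h₀ (2 - r), by positivity, lt_min hh₀ (by linarith), ?_⟩
  intro u hu h hh
  have hum := hu.measurable
  have h1 : ‖h‖ < h₀ := lt_of_lt_of_le hh (min_le_left _ _)
  have h2 : ‖h‖ < 2 - r := lt_of_lt_of_le hh (min_le_right _ _)
  calc _ ≤ ∫⁻ x in Metric.ball 0 r, ENNReal.ofReal (2 ^ (q' - q)) *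
        ENNReal.ofReal (|u (x + h) - u x| ^ q) := by
        refine setLIntegral_mono' measurableSet_ball fun x hx => ?_
        rw [← ENNReal.ofReal_mul (by positivity)]
        refine ENNReal.ofReal_le_ofReal ?_
        have hb := abs_diff_le_two (h := h) hu.abs_le_one (r := r) (by linarith) hx
        rcases eq_or_lt_of_le hqq with rfl | hlt
        · simp
        · have : |u (x + h) - u x| ^ q' =
              |u (x + h) - u x| ^ (q' - q) * |u (x + h) - u x| ^ q := by
            rw [← Real.rpow_add' (abs_nonneg _) (by linarith)]; congr 1; ring
          rw [this]
          gcongr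
    _ = ENNReal.ofReal (2 ^ (q' - q)) * ∫⁻ x in Metric.ball 0 r,
        ENNReal.ofReal (|u (x + h) - u x| ^ q) := lintegral_const_mul _ (by fun_prop)
    _ ≤ ENNReal.ofReal (2 ^ (q' - q)) * ENNReal.ofReal (K * ‖h‖ ^ (α * q)) := by
        gcongr
        exact HB u hu h h1
    _ = _ := by
        rw [← ENNReal.ofReal_mul (by positivity), hα, mul_assoc]

lemma nikolskiiBound_energy {N : ℕ} {p s₁ sp : ℝ} (hp : 2 ≤ p) (hsp : 0 < sp) :
    NikolskiiBound N p s₁ sp sp p := by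
  intro r hr0 hr2
  have hp0 : 0 < p := by linarith
  obtain ⟨C, hC, HC⟩ := lintegral_diff_le_gagliardo (N := N) p (sp * p) hp0 (by positivity)
  set d := (2 - r) / 4 with hd
  have hd0 : 0 < d := by linarith
  refine ⟨C, d / 2, hC, by positivity, ?_⟩
  intro u hu h hh
  rcases eq_or_ne h 0 with rfl | hne
  · simp [Real.zero_rpow hp0.ne']
  refine (HC u hu.measurable r (r + d) d h (by linarith) (by linarith) hne).trans ?_
  refine le_trans (mul_le_mul_right (b := _) (c := 1) ?_ _) (by rw [mul_one])
  refine le_trans (lintegral_mono_set ?_) hu.energy_le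
  rintro z ⟨h1, h2⟩
  rw [mem_ball_zero_iff] at h1
  rw [norm_sub_rev] at h2
  have := norm_sub_norm_le z.2 z.1
  exact ⟨mem_ball_zero_iff.mpr (by linarith), mem_ball_zero_iff.mpr (by linarith)⟩

/-- Starting from order `sp` in `L^{p+n}`, one improvement with `k = n` gives order `sp
(p+n+1)/(p+n)` with the same exponent. Interpolation with boundedness converts the gain into one
more unit of exponent at order `sp`. The bound `sp ≤ (p-1)/p` keeps the intermediate order below
one. -/
lemma nikolskiiBound_sobolev {N : ℕ} (hN : 1 ≤ N) {p s₁ sp : ℝ} (hp : 2 ≤ p)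
    (hs₁ : s₁ ∈ Set.Ioo (0 : ℝ) 1) (hsp : 0 < sp) (hsp1 : sp ≤ (p - 1) / p) (n : ℕ) :
    NikolskiiBound N p s₁ sp sp (p + n) := by
  have hp0 : 0 < p := by linarith
  rw [le_div_iff₀ hp0] at hsp1
  have hs1 : sp < 1 := by nlinarith
  induction n with
  | zero => simpa using nikolskiiBound_energy hp hsp
  | succ n ih =>
    have hn : (0 : ℝ) ≤ n := Nat.cast_nonneg n
    have hq : (0 : ℝ) < p + n := by positivity
    have h1 : NikolskiiBound N p s₁ sp (sp * (p + n + 1) / (p + n)) (p + n) := by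
      refine ih.improve hN (k := n) hp hs₁ hsp hs1 hsp (by nlinarith) hn (by ring) ?_ (by positivity) ?_
      · field_simp; ring
      · rw [div_lt_one hq]
        nlinarith
    refine h1.interpolate hq.le (by push_cast; linarith) ?_
    push_cast
    field_simp
    ring

/-- With `q = p + m` fixed, the improvement step is an affine contraction of the order, with fixed
point `σ` and factor `θ`; starting below `σ ≤ 1`, the orders increase to `σ`. They never fall below
`sp`, so the integrability condition follows from `2 - 2 sp > 0`. -/
lemma exists_nikolskiiBound {N : ℕ} (hN : 1 ≤ N) {p s₁ sp γ : ℝ} (hp : 2 ≤ p)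
    (hs₁ : s₁ ∈ Set.Ioo (0 : ℝ) 1) (hsp : 0 < sp) (hsp1 : sp ≤ (p - 1) / p)
    (hγ : γ < sp * p / (p - 1)) :
    ∃ α q : ℝ, 1 ≤ q ∧ 0 < α ∧ γ < α - N / q ∧ NikolskiiBound N p s₁ sp α q := by
  have hp0 : 0 < p := by linarith
  have hp1 : 0 < p - 1 := by linarith
  set σ := sp * p / (p - 1) with hσ
  have hσp : σ * (p - 1) = sp * p := by rw [hσ]; field_simp
  have hsσ : sp < σ := by rw [hσ, lt_div_iff₀ hp1]; nlinarith
  have hσ1 : σ ≤ 1 := by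
    rw [hσ, div_le_one hp1]
    rwa [le_div_iff₀ hp0] at hsp1
  -- Half of the gap `σ - γ` pays for the Morrey loss `N / q`, the other half for stopping the
  -- iteration after finitely many steps.
  obtain ⟨m, hm⟩ := exists_nat_gt (2 * N / (σ - γ))
  have hσγ : 0 < σ - γ := by linarith
  set q : ℝ := p + m with hq
  have hm0 : (0 : ℝ) ≤ m := Nat.cast_nonneg m
  have hq0 : 0 < q := by positivity
  have hNq : N / q < (σ - γ) / 2 := by
    rw [div_lt_iff₀ hσγ] at hm
    rw [div_lt_iff₀ hq0]
    nlinarith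
  set θ : ℝ := 1 - (p - 1) / q with hθ
  have hθ0 : 0 ≤ θ := by
    rw [hθ, sub_nonneg, div_le_one hq0]; linarith
  have hθ1 : θ < 1 := by
    have : 0 < (p - 1) / q := by positivity
    linarith
  have hθq : θ * q = m + 1 := by rw [hθ, sub_mul, div_mul_cancel₀ _ hq0.ne']; rw [hq]; ring
  have hall : ∀ n : ℕ, NikolskiiBound N p s₁ sp (σ - (σ - sp) * θ ^ n) q := by
    intro n
    induction n with
    | zero => simpa using nikolskiiBound_sobolev hN hp hs₁ hsp hsp1 m
    | succ n ih =>
      have hpow0 : 0 ≤ θ ^ n := by positivity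
      have hpow1 : θ ^ n ≤ 1 := pow_le_one₀ hθ0 hθ1.le
      have hpow1' : θ ^ (n + 1) ≤ 1 := pow_le_one₀ hθ0 hθ1.le
      have hpow0' : 0 < (σ - sp) * θ ^ (n + 1) := by
        have : 0 < θ := by
          by_contra h
          have : θ = 0 := le_antisymm (not_lt.mp h) hθ0
          rw [this] at hθq; linarith
        have : 0 < σ - sp := by linarith
        positivity
      have hge : sp ≤ σ - (σ - sp) * θ ^ n := by nlinarith
      have hge' : sp ≤ σ - (σ - sp) * θ ^ (n + 1) := by nlinarith
      have hs1 : sp < 1 := by linarith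
      refine ih.improve hN (k := m) hp hs₁ hsp hs1 (by linarith) (by nlinarith) hm0
        (by rw [hq]; ring) ?_ (by linarith) (by linarith)
      rw [← hσp, ← hθq, pow_succ]
      have : q * 1 = θ * q + (p - 1) := by rw [hθq, hq]; ring
      linear_combination σ * this
  obtain ⟨n, hn⟩ := exists_pow_lt_of_lt_one (by linarith : 0 < (σ - γ) / 2) hθ1
  refine ⟨σ - (σ - sp) * θ ^ n, q, by linarith, ?_, ?_, hall n⟩
  · have hpow1 : θ ^ n ≤ 1 := pow_le_one₀ hθ0 hθ1.le
    nlinarith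
  · have hpow0 : 0 ≤ θ ^ n := by positivity
    have : (σ - sp) * θ ^ n ≤ θ ^ n := mul_le_of_le_one_left hpow0 (by linarith)
    linarith

/-! ### Morrey's embedding through averages. -/

section holder

open Filter Topology

lemma le_add_rpow_mul {t μ q : ℝ} (ht : 0 ≤ t) (hμ : 0 < μ) (hq : 1 ≤ q) :
    t ≤ μ + μ ^ (1 - q) * t ^ q := by
  have h := rpow_mul_rpow_le_add (a := t / μ) (b := 1) (by positivity) zero_le_one zero_le_one hq
  rw [Real.rpow_one, Real.one_rpow, Real.one_rpow, mul_one, Real.div_rpow ht hμ.le,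
    div_le_iff₀ hμ] at h
  have e : μ ^ (1 - q) = μ / μ ^ q := by rw [Real.rpow_sub hμ, Real.rpow_one]
  rw [e]
  calc t ≤ _ := h
    _ = _ := by ring

/-- Use the increment as second variable and apply the difference bound for each fixed increment. -/
lemma lintegral_diff_pairs_le {N : ℕ} {α q r h₀ K ρ : ℝ} {f : RN N → ℝ} (hf : Measurable f)
    (hα : 0 ≤ α) (hq : 0 ≤ q) (hK : 0 ≤ K) (hρh : 4 * ρ ≤ h₀)
    (H : DiffBound α q r h₀ K f) {A B : Set (RN N)} (hA : MeasurableSet A) (hB : MeasurableSet B)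
    (hAr : A ⊆ Metric.ball 0 r) (hAB : ∀ s ∈ A, ∀ t ∈ B, ‖t - s‖ < 4 * ρ) :
    ∫⁻ s in A, ∫⁻ t in B, ENNReal.ofReal (|f s - f t| ^ q) ≤
      ENNReal.ofReal (K * (4 * ρ) ^ (α * q)) * volume (Metric.ball (0 : RN N) (4 * ρ)) := by
  set G : RN N → RN N → ℝ≥0∞ := fun s η => ENNReal.ofReal (|f (s + η) - f s| ^ q) with hG
  have hGm : Measurable (Function.uncurry G) := by
    simp only [hG, Function.uncurry_def]; fun_prop
  have h1 : ∀ s ∈ A, ∫⁻ t in B, ENNReal.ofReal (|f s - f t| ^ q) ≤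
      ∫⁻ η in Metric.ball 0 (4 * ρ), G s η := by
    intro s hs
    rw [← lintegral_indicator hB, ← lintegral_indicator measurableSet_ball,
      ← lintegral_add_left_eq_self _ s]
    refine lintegral_mono fun η => ?_
    by_cases hη : s + η ∈ B
    · have : η ∈ Metric.ball (0 : RN N) (4 * ρ) := by
        have := hAB s hs _ hη
        rw [mem_ball_zero_iff]; simpa using this
      rw [Set.indicator_of_mem hη, Set.indicator_of_mem this, abs_sub_comm]
    · rw [Set.indicator_of_notMem hη]; exact zero_le
  calc _ ≤ ∫⁻ s in A, ∫⁻ η in Metric.ball 0 (4 * ρ), G s η := setLIntegral_mono' hA h1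
    _ ≤ ∫⁻ s in Metric.ball 0 r, ∫⁻ η in Metric.ball 0 (4 * ρ), G s η := lintegral_mono_set hAr
    _ = ∫⁻ η in Metric.ball 0 (4 * ρ), ∫⁻ s in Metric.ball 0 r, G s η :=
        lintegral_lintegral_swap hGm.aemeasurable
    _ ≤ ∫⁻ η in Metric.ball (0 : RN N) (4 * ρ), ENNReal.ofReal (K * (4 * ρ) ^ (α * q)) := by
        refine setLIntegral_mono' measurableSet_ball fun η hη => ?_
        rw [mem_ball_zero_iff] at hη
        refine (H η (by linarith)).trans (ENNReal.ofReal_le_ofReal ?_)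
        gcongr
    _ = _ := by rw [setLIntegral_const]

lemma measureReal_closedBall_eq {N : ℕ} (hN : 1 ≤ N) (x : RN N) {ρ : ℝ} (hρ : 0 ≤ ρ) :
    volume.real (Metric.closedBall x ρ) = ρ ^ N * volume.real (Metric.ball (0 : RN N) 1) := by
  have : Nonempty (Fin N) := ⟨⟨0, hN⟩⟩
  rw [Measure.addHaar_real_closedBall volume x hρ]
  simp

/-- The difference of averages is the average of `f s - f t` over both balls, whose points are
within `3ρ` of each other. Varying both centres and radii covers the two uses at once: halving a
radius at a fixed centre, and changing the centre. -/
lemma abs_average_sub_average_le {N : ℕ} (hN : 1 ≤ N) {α q h₀ K : ℝ} (hα : 0 < α) (hq : 1 ≤ q)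
    (hK : 0 ≤ K) :
    ∃ C : ℝ, 0 ≤ C ∧ ∀ f : RN N → ℝ, Measurable f → (∀ x ∈ Metric.ball (0 : RN N) 2, |f x| ≤ 1) →
      DiffBound α q 1 h₀ K f → ∀ (x y : RN N) (ρ a b : ℝ), 0 < ρ → ρ ≤ 1 / 4 → 4 * ρ ≤ h₀ →
      a ∈ Set.Icc (ρ / 2) ρ → b ∈ Set.Icc (ρ / 2) ρ → ‖x‖ < 1 / 2 → ‖y‖ < 1 / 2 → ‖x - y‖ ≤ ρ →
      |(⨍ s in Metric.closedBall x a, f s) - ⨍ t in Metric.closedBall y b, f t| ≤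
        C * ρ ^ (α - N / q) := by
  set v := volume.real (Metric.ball (0 : RN N) 1) with hv
  have hv0 : 0 < v := by
    rw [hv, measureReal_def]
    exact ENNReal.toReal_pos (Metric.measure_ball_pos _ _ one_pos).ne' measure_ball_lt_top.ne
  refine ⟨1 + K * 4 ^ (α * q) * (4 ^ N * v) * (2 ^ N / v) ^ 2, by positivity, ?_⟩
  intro f hf hbd H x y ρ a b hρ hρ1 hρh ha hb hx hy hxy
  have hq0 : 0 < q := by linarith
  have ha0 : 0 < a := by linarith [ha.1]
  have hb0 : 0 < b := by linarith [hb.1]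
  set A := Metric.closedBall x a with hA
  set B := Metric.closedBall y b with hB
  have hsub : ∀ (w : RN N) (c : ℝ), ‖w‖ < 1 / 2 → c ≤ ρ → Metric.closedBall w c ⊆ Metric.ball 0 1 := by
    intro w c hw hc
    refine Metric.closedBall_subset_ball' ?_
    rw [dist_zero_right]; linarith
  have hAs := hsub x a hx ha.2
  have hBs := hsub y b hy hb.2
  have hAm : MeasurableSet A := Metric.isClosed_closedBall.measurableSet
  have hBm : MeasurableSet B := Metric.isClosed_closedBall.measurableSet
  have hfint : ∀ S : Set (RN N), MeasurableSet S → S ⊆ Metric.ball 0 1 → IntegrableOn f S := by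
    intro S hS hSs
    refine IntegrableOn.of_bound (lt_of_le_of_lt (measure_mono hSs) measure_ball_lt_top)
      hf.aestronglyMeasurable 1 ?_
    refine ae_restrict_of_forall_mem hS fun s hs => ?_
    exact hbd s (Metric.ball_subset_ball (by norm_num) (hSs hs))
  have iA := hfint A hAm hAs
  have iB := hfint B hBm hBs
  set VA := volume.real A with hVA
  set VB := volume.real B with hVB
  have hVAe : VA = a ^ N * v := measureReal_closedBall_eq hN x ha0.le
  have hVBe : VB = b ^ N * v := measureReal_closedBall_eq hN y hb0.le
  have hVA0 : 0 < VA := by rw [hVAe]; positivity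
  have hVB0 : 0 < VB := by rw [hVBe]; positivity
  have hVAt : volume A ≠ ∞ := (measure_closedBall_lt_top).ne
  have hVBt : volume B ≠ ∞ := (measure_closedBall_lt_top).ne
  have hdiff : ∫ s in A, ∫ t in B, (f s - f t) = VA * VB * ((⨍ s in A, f s) - ⨍ t in B, f t) := by
    have e1 : ∀ s, ∫ t in B, (f s - f t) = VB * f s - ∫ t in B, f t := by
      intro s
      have ic : Integrable (fun _ : RN N => f s) (volume.restrict B) := integrableOn_const hVBt
      rw [integral_sub ic iB, setIntegral_const, smul_eq_mul]
    simp_rw [e1]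
    have ic : Integrable (fun _ : RN N => ∫ t in B, f t) (volume.restrict A) :=
      integrableOn_const hVAt
    rw [integral_sub (iA.const_mul _) ic, integral_const_mul,
      setIntegral_const, smul_eq_mul, setAverage_eq, setAverage_eq, smul_eq_mul, smul_eq_mul,
      ← hVA, ← hVB]
    field_simp
  have hnorm : ENNReal.ofReal (VA * VB * |(⨍ s in A, f s) - ⨍ t in B, f t|) ≤
      ∫⁻ s in A, ∫⁻ t in B, ENNReal.ofReal |f s - f t| := by
    have e1 : VA * VB * |(⨍ s in A, f s) - ⨍ t in B, f t| =
        ‖∫ s in A, ∫ t in B, (f s - f t)‖ := by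
      rw [hdiff, Real.norm_eq_abs, abs_mul, abs_of_pos (mul_pos hVA0 hVB0)]
    rw [e1, ofReal_norm]
    refine (enorm_integral_le_lintegral_enorm _).trans (lintegral_mono fun s => ?_)
    refine (enorm_integral_le_lintegral_enorm _).trans (lintegral_mono fun t => ?_)
    simp only
    rw [Real.enorm_eq_ofReal_abs]
  -- The target bound serves as threshold in `le_add_rpow_mul`: then `μ^(1-q) ρ^(αq) = μ ρ^N`, and
  -- with the volume of the ball of increments this is `μ` times a multiple of the product of the
  -- two volumes.
  set μ := ρ ^ (α - N / q) with hμ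
  have hμ0 : 0 < μ := by positivity
  have hpairs := lintegral_diff_pairs_le hf hα.le hq0.le hK hρh H hAm hBm hAs (by
    intro s hs t ht
    have e1 : ‖s - x‖ ≤ a := by rwa [hA, mem_closedBall_iff_norm] at hs
    have e2 : ‖t - y‖ ≤ b := by rwa [hB, mem_closedBall_iff_norm] at ht
    have e3 : t - s = (t - y) - (s - x) - (x - y) := by abel
    rw [e3]
    have := norm_sub_le (t - y - (s - x)) (x - y)
    have := norm_sub_le (t - y) (s - x)
    linarith [ha.2, hb.2])
  have hvol4 : volume (Metric.ball (0 : RN N) (4 * ρ)) = ENNReal.ofReal ((4 * ρ) ^ N * v) := by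
    rw [Measure.addHaar_ball_of_pos volume _ (by positivity), ENNReal.ofReal_mul (by positivity),
      hv, ofReal_measureReal measure_ball_lt_top.ne]
    simp
  have hpt : ∫⁻ s in A, ∫⁻ t in B, ENNReal.ofReal |f s - f t| ≤
      ENNReal.ofReal (μ * (VA * VB)) + ENNReal.ofReal (μ ^ (1 - q)) *
        ∫⁻ s in A, ∫⁻ t in B, ENNReal.ofReal (|f s - f t| ^ q) := by
    have hmm : Measurable fun s => ∫⁻ t in B, ENNReal.ofReal (|f s - f t| ^ q) := by
      have : Measurable (Function.uncurry fun s t : RN N => ENNReal.ofReal (|f s - f t| ^ q)) := by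
        simp only [Function.uncurry_def]; fun_prop
      exact this.lintegral_prod_right'
    have e1 : ∀ s, ∫⁻ t in B, ENNReal.ofReal |f s - f t| ≤
        ENNReal.ofReal (μ * VB) + ENNReal.ofReal (μ ^ (1 - q)) *
          ∫⁻ t in B, ENNReal.ofReal (|f s - f t| ^ q) := by
      intro s
      calc _ ≤ ∫⁻ t in B, (ENNReal.ofReal μ + ENNReal.ofReal (μ ^ (1 - q)) *
            ENNReal.ofReal (|f s - f t| ^ q)) := by
            refine lintegral_mono fun t => ?_
            rw [← ENNReal.ofReal_mul (by positivity), ← ENNReal.ofReal_add hμ0.le (by positivity)]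
            exact ENNReal.ofReal_le_ofReal (le_add_rpow_mul (abs_nonneg _) hμ0 hq)
        _ = _ := by
            rw [lintegral_add_left (by fun_prop), lintegral_const_mul _ (by fun_prop),
              setLIntegral_const, ENNReal.ofReal_mul hμ0.le, hVB, ofReal_measureReal hVBt]
    calc _ ≤ ∫⁻ s in A, (ENNReal.ofReal (μ * VB) + ENNReal.ofReal (μ ^ (1 - q)) *
          ∫⁻ t in B, ENNReal.ofReal (|f s - f t| ^ q)) := lintegral_mono e1
      _ = _ := by
          rw [lintegral_add_left (by fun_prop), lintegral_const_mul _ hmm, setLIntegral_const,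
            ← ofReal_measureReal hVAt, ← ENNReal.ofReal_mul (by positivity)]
          congr 2
          ring
  have hfin := hnorm.trans (hpt.trans (add_le_add_right (mul_le_mul_right hpairs _) _))
  rw [hvol4, ← ENNReal.ofReal_mul (by positivity), ← ENNReal.ofReal_mul (by positivity),
    ← ENNReal.ofReal_add (by positivity) (by positivity),
    ENNReal.ofReal_le_ofReal_iff (by positivity)] at hfin
  have hVV : 0 < VA * VB := mul_pos hVA0 hVB0
  have hρN : ρ ^ N = ρ ^ (N : ℝ) := (Real.rpow_natCast ρ N).symm
  have hVVge : (ρ ^ N * v / 2 ^ N) ^ 2 ≤ VA * VB := by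
    rw [hVAe, hVBe, sq]
    have h1 : ρ ^ N * v / 2 ^ N = (ρ / 2) ^ N * v := by rw [div_pow]; ring
    rw [h1]
    have := ha.1
    have := hb.1
    gcongr
  have hμq : μ ^ (1 - q) * (ρ ^ (α * q)) = μ * ρ ^ N := by
    rw [hμ, hρN, ← Real.rpow_mul hρ.le, ← Real.rpow_add hρ, ← Real.rpow_add hρ]
    congr 1
    field_simp
    ring
  have hstep : μ ^ (1 - q) * (K * (4 * ρ) ^ (α * q) * ((4 * ρ) ^ N * v)) =
      μ * (K * 4 ^ (α * q) * (4 ^ N * v) * (2 ^ N / v) ^ 2) * (ρ ^ N * v / 2 ^ N) ^ 2 := by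
    rw [Real.mul_rpow (by norm_num) hρ.le, mul_pow]
    calc _ = (μ ^ (1 - q) * ρ ^ (α * q)) * (K * 4 ^ (α * q) * (4 ^ N * ρ ^ N * v)) := by ring
      _ = _ := by rw [hμq]; field_simp
  rw [hstep] at hfin
  set c := K * 4 ^ (α * q) * (4 ^ N * v) * (2 ^ N / v) ^ 2 with hc
  have hc0 : 0 ≤ c := by positivity
  have h5 : μ * c * (ρ ^ N * v / 2 ^ N) ^ 2 ≤ μ * c * (VA * VB) := by gcongr
  refine le_of_mul_le_mul_left (?_ : VA * VB * _ ≤ VA * VB * _) hVV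
  linarith

/-- A geometric series over dyadic radii, with ratio `(1/2)^γ`. -/
lemma abs_sub_limit_le {γ C ρ ℓ : ℝ} {m : ℝ → ℝ} (hγ : 0 < γ) (hρ : 0 < ρ)
    (hm : ∀ n : ℕ, |m (ρ * (1 / 2) ^ n) - m (ρ * (1 / 2) ^ (n + 1))| ≤ C * (ρ * (1 / 2) ^ n) ^ γ)
    (hlim : Tendsto m (𝓝[>] 0) (𝓝 ℓ)) :
    |m ρ - ℓ| ≤ C * ρ ^ γ / (1 - (1 / 2) ^ γ) := by
  have ht : Tendsto (fun n : ℕ => ρ * (1 / 2 : ℝ) ^ n) atTop (𝓝[>] 0) := by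
    refine tendsto_nhdsWithin_iff.mpr ⟨?_, Filter.Eventually.of_forall fun n => ?_⟩
    · have := (tendsto_pow_atTop_nhds_zero_of_lt_one (r := (1 / 2 : ℝ)) (by norm_num)
        (by norm_num)).const_mul ρ
      simpa using this
    · exact Set.mem_Ioi.mpr (by positivity)
  have h := dist_le_of_le_geometric_of_tendsto₀ ((1 / 2 : ℝ) ^ γ) (C * ρ ^ γ)
    (f := fun n : ℕ => m (ρ * (1 / 2) ^ n)) (a := ℓ)
    (Real.rpow_lt_one (by norm_num) (by norm_num) hγ) (fun n => ?_) (hlim.comp ht)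
  · simpa [Real.dist_eq] using h
  · rw [Real.dist_eq]
    refine (hm n).trans (le_of_eq ?_)
    rw [Real.mul_rpow hρ.le (by positivity), ← Real.rpow_natCast, ← Real.rpow_natCast,
      ← Real.rpow_mul (by norm_num), ← Real.rpow_mul (by norm_num), mul_comm (n : ℝ)]
    ring

/-- Morrey's embedding at points where the averages converge. -/
lemma exists_morrey {N : ℕ} (hN : 1 ≤ N) {α q h₀ K : ℝ} (hα : 0 < α) (hq : 1 ≤ q)
    (hK : 0 ≤ K) (hγ : 0 < α - N / q) :
    ∃ C : ℝ, 0 ≤ C ∧ ∀ f : RN N → ℝ, Measurable f → (∀ x ∈ Metric.ball (0 : RN N) 2, |f x| ≤ 1) →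
      DiffBound α q 1 h₀ K f → ∀ (x y : RN N) (ℓ ℓ' : ℝ), x ≠ y → ‖x‖ < 1 / 2 → ‖y‖ < 1 / 2 →
      ‖x - y‖ ≤ 1 / 4 → 4 * ‖x - y‖ ≤ h₀ →
      Tendsto (fun ρ => ⨍ s in Metric.closedBall x ρ, f s) (𝓝[>] 0) (𝓝 ℓ) →
      Tendsto (fun ρ => ⨍ s in Metric.closedBall y ρ, f s) (𝓝[>] 0) (𝓝 ℓ') →
      |ℓ - ℓ'| ≤ C * ‖x - y‖ ^ (α - N / q) := by
  obtain ⟨C, hC, HC⟩ := abs_average_sub_average_le hN (h₀ := h₀) hα hq hK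
  set γ := α - N / q with hγd
  have hθ : (1 / 2 : ℝ) ^ γ < 1 := Real.rpow_lt_one (by norm_num) (by norm_num) hγ
  have hθ' : 0 < 1 - (1 / 2 : ℝ) ^ γ := by linarith
  refine ⟨C + 2 * (C / (1 - (1 / 2) ^ γ)), by positivity, ?_⟩
  intro f hf hbd H x y ℓ ℓ' hne hx hy hxy hxyh hlx hly
  set ρ := ‖x - y‖ with hρ
  have hρ0 : 0 < ρ := norm_pos_iff.mpr (sub_ne_zero.mpr hne)
  have hone : ∀ (w : RN N) (ℓ : ℝ), ‖w‖ < 1 / 2 →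
      Tendsto (fun ρ => ⨍ s in Metric.closedBall w ρ, f s) (𝓝[>] 0) (𝓝 ℓ) →
      |(⨍ s in Metric.closedBall w ρ, f s) - ℓ| ≤ C * ρ ^ γ / (1 - (1 / 2) ^ γ) := by
    intro w ℓ hw hl
    refine abs_sub_limit_le (m := fun ρ => ⨍ s in Metric.closedBall w ρ, f s) hγ hρ0 (fun n => ?_) hl
    have hp1 : (1 / 2 : ℝ) ^ n ≤ 1 := pow_le_one₀ (by norm_num) (by norm_num)
    have hp0 : 0 < (1 / 2 : ℝ) ^ n := by positivity
    have hle : ρ * (1 / 2) ^ n ≤ ρ := mul_le_of_le_one_right hρ0.le hp1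
    have hpos : 0 < ρ * (1 / 2) ^ n := by positivity
    refine HC f hf hbd H w w (ρ * (1 / 2) ^ n) _ _ hpos (by linarith) (by linarith)
      ⟨by linarith, le_rfl⟩ ⟨?_, ?_⟩ hw hw (by simpa using hpos.le)
    · rw [pow_succ]; linarith
    · rw [pow_succ]; linarith
  have e1 := hone x ℓ hx hlx
  have e2 := hone y ℓ' hy hly
  have e3 := HC f hf hbd H x y ρ ρ ρ hρ0 hxy hxyh ⟨by linarith, le_rfl⟩ ⟨by linarith, le_rfl⟩
    hx hy le_rfl
  have e4 : C * ρ ^ γ / (1 - (1 / 2) ^ γ) = C / (1 - (1 / 2) ^ γ) * ρ ^ γ := by ring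
  rw [e4] at e1 e2
  rw [abs_le] at *
  constructor <;> nlinarith [e1.1, e1.2, e2.1, e2.2, e3.1, e3.2]

/-! ### Affine rescaling of weak solutions. -/

instance instIsAddHaarMeasureVolumeProd (N : ℕ) :
    (volume : Measure (RN N × RN N)).IsAddHaarMeasure := by
  rw [Measure.volume_eq_prod]; infer_instance

section affine

variable {E : Type*} [NormedAddCommGroup E] [NormedSpace ℝ E]

lemma affine_mem_closedBall_iff (c x y : E) {l : ℝ} (hl : 0 < l) (ρ : ℝ) :
    c + l • x ∈ Metric.closedBall (c + l • y) (l * ρ) ↔ x ∈ Metric.closedBall y ρ := by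
  rw [mem_closedBall_iff_norm, mem_closedBall_iff_norm, add_sub_add_left_eq_sub, ← smul_sub,
    norm_smul, Real.norm_of_nonneg hl.le, mul_le_mul_iff_right₀ hl]

lemma affine_mem_ball_iff (c x : E) {l : ℝ} (hl : 0 < l) (ρ : ℝ) :
    c + l • x ∈ Metric.ball c (l * ρ) ↔ x ∈ Metric.ball (0 : E) ρ := by
  rw [mem_ball_iff_norm, mem_ball_zero_iff, add_sub_cancel_left,
    norm_smul, Real.norm_of_nonneg hl.le, mul_lt_mul_iff_right₀ hl]

variable [MeasurableSpace E] [BorelSpace E]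

lemma measurableEmbedding_affine (c : E) {l : ℝ} (hl : 0 < l) :
    MeasurableEmbedding fun x : E => c + l • x :=
  ((Homeomorph.smulOfNeZero l hl.ne').trans (Homeomorph.addLeft c)).measurableEmbedding

variable [FiniteDimensional ℝ E] (μ : Measure E) [μ.IsAddHaarMeasure]

lemma map_affine (c : E) {l : ℝ} (hl : 0 < l) :
    Measure.map (fun x : E => c + l • x) μ =
      ENNReal.ofReal (l ^ Module.finrank ℝ E)⁻¹ • μ := by
  have h1 : (fun x : E => c + l • x) = (fun x => c + x) ∘ fun x => l • x := rfl
  rw [h1, ← Measure.map_map (by fun_prop) (by fun_prop), Measure.map_addHaar_smul μ hl.ne',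
    Measure.map_smul, map_add_left_eq_self, abs_of_pos (by positivity)]

lemma lintegral_comp_affine (F : E → ℝ≥0∞) (c : E) {l : ℝ} (hl : 0 < l) :
    ∫⁻ x, F (c + l • x) ∂μ = ENNReal.ofReal (l ^ Module.finrank ℝ E)⁻¹ * ∫⁻ x, F x ∂μ := by
  rw [← (measurableEmbedding_affine c hl).lintegral_map, map_affine μ c hl, lintegral_smul_measure,
    smul_eq_mul]

lemma integral_comp_affine (f : E → ℝ) (c : E) {l : ℝ} (hl : 0 < l) :
    ∫ x, f (c + l • x) ∂μ = (l ^ Module.finrank ℝ E)⁻¹ * ∫ x, f x ∂μ := by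
  rw [← (measurableEmbedding_affine c hl).integral_map, map_affine μ c hl, integral_smul_measure,
    smul_eq_mul, ENNReal.toReal_ofReal (by positivity)]

lemma quasiMeasurePreserving_affine (c : E) {l : ℝ} (hl : 0 < l) :
    Measure.QuasiMeasurePreserving (fun x : E => c + l • x) μ μ := by
  refine ⟨(measurableEmbedding_affine c hl).measurable, ?_⟩
  rw [map_affine μ c hl]
  exact Measure.smul_absolutelyContinuous

lemma setLIntegral_comp_affine (F : E → ℝ≥0∞) (c : E) {l : ℝ} (hl : 0 < l) {S S' : Set E}
    (hS : MeasurableSet S) (hS' : MeasurableSet S') (hSS : ∀ x, x ∈ S ↔ c + l • x ∈ S') :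
    ∫⁻ x in S, F (c + l • x) ∂μ = ENNReal.ofReal (l ^ Module.finrank ℝ E)⁻¹ * ∫⁻ x in S', F x ∂μ := by
  rw [← lintegral_indicator hS, ← lintegral_indicator hS', ← lintegral_comp_affine μ _ c hl]
  refine lintegral_congr fun x => ?_
  by_cases hx : x ∈ S
  · rw [Set.indicator_of_mem hx, Set.indicator_of_mem ((hSS x).mp hx)]
  · rw [Set.indicator_of_notMem hx, Set.indicator_of_notMem (fun h => hx ((hSS x).mpr h))]

lemma setAverage_comp_affine (f : E → ℝ) (c y : E) {l : ℝ} (hl : 0 < l) (ρ : ℝ) :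
    ⨍ x in Metric.closedBall y ρ, f (c + l • x) ∂μ =
      ⨍ x in Metric.closedBall (c + l • y) (l * ρ), f x ∂μ := by
  have hl' : 0 < (l ^ Module.finrank ℝ E)⁻¹ := by positivity
  have h1 : ∫ x in Metric.closedBall y ρ, f (c + l • x) ∂μ =
      (l ^ Module.finrank ℝ E)⁻¹ * ∫ x in Metric.closedBall (c + l • y) (l * ρ), f x ∂μ := by
    rw [← integral_indicator Metric.isClosed_closedBall.measurableSet,
      ← integral_indicator Metric.isClosed_closedBall.measurableSet, ← integral_comp_affine μ _ c hl]
    refine integral_congr_ae (Filter.Eventually.of_forall fun x => ?_)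
    by_cases hx : x ∈ Metric.closedBall y ρ
    · simp only
      rw [Set.indicator_of_mem hx,
        Set.indicator_of_mem ((affine_mem_closedBall_iff c x y hl ρ).mpr hx)]
    · simp only
      rw [Set.indicator_of_notMem hx,
        Set.indicator_of_notMem (fun h => hx ((affine_mem_closedBall_iff c x y hl ρ).mp h))]
  have h2 : μ.real (Metric.closedBall y ρ) =
      (l ^ Module.finrank ℝ E)⁻¹ * μ.real (Metric.closedBall (c + l • y) (l * ρ)) := by
    have := setLIntegral_comp_affine μ (fun _ => 1) c hl
      (Metric.isClosed_closedBall (x := y) (ε := ρ)).measurableSet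
      (Metric.isClosed_closedBall (x := c + l • y) (ε := l * ρ)).measurableSet
      (fun x => (affine_mem_closedBall_iff c x y hl ρ).symm)
    rw [setLIntegral_one, setLIntegral_one] at this
    rw [measureReal_def, this, ENNReal.toReal_mul, ENNReal.toReal_ofReal hl'.le, measureReal_def]
  rw [setAverage_eq, setAverage_eq, h1, h2, smul_eq_mul, smul_eq_mul, mul_inv]
  field_simp

end affine

lemma ae_prod_fst {N : ℕ} {P : RN N → Prop} (h : ∀ᵐ x, P x) : ∀ᵐ z : RN N × RN N, P z.1 := by
  rw [Measure.volume_eq_prod]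
  exact Measure.quasiMeasurePreserving_fst.ae h

lemma ae_prod_snd {N : ℕ} {P : RN N → Prop} (h : ∀ᵐ x, P x) : ∀ᵐ z : RN N × RN N, P z.2 := by
  rw [Measure.volume_eq_prod]
  exact Measure.quasiMeasurePreserving_snd.ae h

/-- A function with the bounds of a normalized solution almost everywhere agrees almost everywhere
with a normalized solution. -/
lemma exists_normalizedSolution {N : ℕ} {p s₁ sp : ℝ} {v : RN N → ℝ}
    (hv : AEStronglyMeasurable v volume) (hbd : ∀ᵐ x, x ∈ Metric.ball (0 : RN N) 2 → |v x| ≤ 1)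
    (htail : ∫⁻ x in (Metric.ball (0 : RN N) 2)ᶜ,
      ENNReal.ofReal (|v x| ^ (p - 1) / ‖x‖ ^ ((N : ℝ) + sp * p)) ≤ 1)
    (henergy : ∫⁻ z in Metric.ball (0 : RN N) 2 ×ˢ Metric.ball (0 : RN N) 2,
      ENNReal.ofReal (|v z.1 - v z.2| ^ p / ‖z.1 - z.2‖ ^ ((N : ℝ) + sp * p)) ≤ 1)
    (henergy1 : ∫⁻ z in Metric.ball (0 : RN N) 2 ×ˢ Metric.ball (0 : RN N) 2,
      ENNReal.ofReal (|v z.1 - v z.2| ^ (1 : ℝ) / ‖z.1 - z.2‖ ^ ((N : ℝ) + s₁ * 1)) < ∞)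
    {ε : ℝ} (hε : ε ∈ Set.Icc (0 : ℝ) 1) {Z : RN N × RN N → ℝ} (hZ : AEStronglyMeasurable Z volume)
    (hZs : ∀ᵐ z : RN N × RN N, Z z ∈ sgnSet (v z.1 - v z.2))
    (heq : ∀ φ : RN N → ℝ, IsTestFunction p s₁ sp (Metric.ball 0 2) φ →
      0 = ε * (∫ z : RN N × RN N, Z z * (φ z.1 - φ z.2) / ‖z.1 - z.2‖ ^ ((N : ℝ) + s₁)) +
        ∫ z : RN N × RN N, |v z.1 - v z.2| ^ (p - 2) * (v z.1 - v z.2) * (φ z.1 - φ z.2) /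
          ‖z.1 - z.2‖ ^ ((N : ℝ) + sp * p)) :
    ∃ w : RN N → ℝ, w =ᵐ[volume] v ∧ NormalizedSolution p s₁ sp w := by
  classical
  set v₀ := hv.mk v with hv₀
  have hm : Measurable v₀ := hv.stronglyMeasurable_mk.measurable
  -- Truncation makes the bound hold at every point of the ball, not just almost everywhere, and
  -- changes a measurable representative only on a null set.
  set w : RN N → ℝ := fun x => if x ∈ Metric.ball (0 : RN N) 2 then max (-1) (min 1 (v₀ x)) else v₀ x
    with hw
  have hwm : Measurable w := Measurable.ite measurableSet_ball (by fun_prop) hm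
  have hwv : ∀ᵐ x, w x = v x := by
    filter_upwards [hv.ae_eq_mk, hbd] with x h1 h2
    simp only [hw]
    split_ifs with hx
    · have h3 := abs_le.mp (h2 hx)
      rw [hv₀, ← h1, min_eq_right h3.2, max_eq_right h3.1]
    · exact h1.symm
  have hwv2 : ∀ᵐ z : RN N × RN N, w z.1 = v z.1 ∧ w z.2 = v z.2 :=
    (ae_prod_fst hwv).and (ae_prod_snd hwv)
  refine ⟨w, hwv, hwm, ?_, ?_, ?_, ?_, ε, hε, Z, hZ, ?_, ?_⟩
  · intro x hx
    simp only [hw, if_pos hx]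
    exact abs_le.mpr ⟨le_max_left _ _, max_le (by norm_num) (min_le_left _ _)⟩
  · refine le_trans (le_of_eq (lintegral_congr_ae ?_)) htail
    filter_upwards [ae_restrict_of_ae hwv] with x hx
    rw [hx]
  · refine le_trans (le_of_eq (lintegral_congr_ae ?_)) henergy
    filter_upwards [ae_restrict_of_ae hwv2] with x hx
    rw [hx.1, hx.2]
  · refine lt_of_le_of_lt (le_of_eq (lintegral_congr_ae ?_)) henergy1
    filter_upwards [ae_restrict_of_ae hwv2] with x hx
    rw [hx.1, hx.2]
  · filter_upwards [hwv2, hZs] with z h1 h2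
    rw [h1.1, h1.2]; exact h2
  · intro φ hφ
    have := heq φ hφ
    have hc : ∫ z : RN N × RN N, |w z.1 - w z.2| ^ (p - 2) * (w z.1 - w z.2) * (φ z.1 - φ z.2) /
          ‖z.1 - z.2‖ ^ ((N : ℝ) + sp * p) = ∫ z : RN N × RN N, |v z.1 - v z.2| ^ (p - 2) *
          (v z.1 - v z.2) * (φ z.1 - φ z.2) / ‖z.1 - z.2‖ ^ ((N : ℝ) + sp * p) := by
      refine integral_congr_ae ?_
      filter_upwards [hwv2] with z h1
      rw [h1.1, h1.2]
    rw [hc]; exact this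

lemma energyDensity_comp_affine {N : ℕ} (q a : ℝ) (u : RN N → ℝ) (c : RN N) {l M : ℝ} (hl : 0 < l)
    (hM : 0 < M) (z : RN N × RN N) :
    energyDensity q a (fun x => u (c + l • x) / M) z =
      ENNReal.ofReal (l ^ ((N : ℝ) + a) / M ^ q) * energyDensity q a u ((c, c) + l • z) := by
  unfold energyDensity
  simp only [Prod.fst_add, Prod.snd_add, Prod.smul_fst, Prod.smul_snd]
  rw [← ENNReal.ofReal_mul (by positivity), add_sub_add_left_eq_sub, ← smul_sub, norm_smul,
    Real.norm_of_nonneg hl.le, Real.mul_rpow hl.le (norm_nonneg _), ← sub_div, abs_div,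
    abs_of_pos hM, Real.div_rpow (abs_nonneg _) hM.le]
  congr 1
  have : l ^ ((N : ℝ) + a) ≠ 0 := by positivity
  field_simp

lemma MemSobolev.comp_affine {N : ℕ} {s q : ℝ} (hq : 0 < q) {φ : RN N → ℝ} (c : RN N) {l : ℝ}
    (hl : 0 < l) (h : MemSobolev s q Set.univ φ) :
    MemSobolev s q Set.univ fun x => φ (c + l • x) := by
  obtain ⟨h1, h2⟩ := h
  unfold gagliardo at h2
  rw [Measure.restrict_univ] at h1
  rw [Set.univ_prod_univ, Measure.restrict_univ] at h2
  refine ⟨?_, ?_⟩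
  · rw [Measure.restrict_univ]
    refine MemLp.comp_of_map (g := φ) (f := fun x => c + l • x) ?_
      (measurableEmbedding_affine c hl).measurable.aemeasurable
    rw [map_affine volume c hl]
    exact h1.smul_measure ENNReal.ofReal_ne_top
  · unfold gagliardo
    rw [Set.univ_prod_univ, Measure.restrict_univ]
    refine ENNReal.rpow_lt_top_of_nonneg (by positivity) (ne_of_lt ?_)
    have h3 := (ENNReal.rpow_lt_top_iff_of_pos (by positivity : 0 < 1 / q)).mp h2
    have h4 : ∀ z : RN N × RN N, ENNReal.ofReal (|φ (c + l • z.1) - φ (c + l • z.2)| ^ q /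
        ‖z.1 - z.2‖ ^ ((N : ℝ) + s * q)) = ENNReal.ofReal (l ^ ((N : ℝ) + s * q) / 1 ^ q) *
        energyDensity q (s * q) φ ((c, c) + l • z) := by
      intro z
      rw [← energyDensity_comp_affine q (s * q) φ c hl one_pos z]
      simp [energyDensity]
    simp_rw [h4]
    rw [lintegral_const_mul' _ _ ENNReal.ofReal_ne_top, lintegral_comp_affine _ _ _ hl]
    exact ENNReal.mul_lt_top ENNReal.ofReal_lt_top (ENNReal.mul_lt_top ENNReal.ofReal_lt_top h3)

lemma IsTestFunction.comp_affine {N : ℕ} {p s₁ sp : ℝ} (hp : 0 < p) {φ : RN N → ℝ} (c : RN N)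
    {l : ℝ} (hl : 0 < l) {Ω Ω' : Set (RN N)} (hΩ : ∀ x ∈ Ω, c + l • x ∈ Ω')
    (h : IsTestFunction p s₁ sp Ω φ) :
    IsTestFunction p s₁ sp Ω' fun y => φ (-(l⁻¹ • c) + l⁻¹ • y) := by
  obtain ⟨h1, h2, h3, h4⟩ := h
  have hl' : 0 < l⁻¹ := by positivity
  set g : RN N ≃ₜ RN N := (Homeomorph.smulOfNeZero l⁻¹ hl'.ne').trans
    (Homeomorph.addLeft (-(l⁻¹ • c))) with hg
  have hgφ : (fun y => φ (-(l⁻¹ • c) + l⁻¹ • y)) = φ ∘ g := rfl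
  refine ⟨h1.comp_affine one_pos _ hl', h2.comp_affine hp _ hl', ?_, ?_⟩
  · rw [hgφ]; exact h3.comp_homeomorph g
  · rw [hgφ, tsupport_comp_eq_preimage φ g]
    intro y hy
    have := hΩ _ (h4 hy)
    have e : c + l • g y = y := by
      change c + l • (-(l⁻¹ • c) + l⁻¹ • y) = y
      rw [smul_add, smul_neg, smul_smul, smul_smul, mul_inv_cancel₀ hl.ne', one_smul, one_smul]
      abel
    rwa [e] at this

lemma oddPow_div {b M : ℝ} (hM : 0 < M) (t : ℝ) : oddPow b (t / M) = oddPow b t / M ^ (b + 1) := by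
  unfold oddPow
  rw [abs_div, abs_of_pos hM, Real.div_rpow (abs_nonneg _) hM.le, Real.rpow_add_one hM.ne']
  field_simp

/-- The sign graph is invariant under division by `M`, whereas the `p`-term has degree `p - 1`, and
the kernels scale with different powers of `l`. After dividing by the factor of the `p`-term, the
sign term carries `ε = l^(sp p - s₁) / M^(p-1)`, and `hε` says `ε ≤ 1`. -/
lemma IsWeakSolution.exists_normalizedSolution {N : ℕ} {p s₁ sp : ℝ} (hp : 2 ≤ p) {Ω : Set (RN N)}
    {u : RN N → ℝ} (hu : IsWeakSolution p s₁ sp Ω u) {c : RN N} {l M : ℝ} (hl : 0 < l) (hM : 0 < M)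
    (hball : CompactlyIn (Metric.ball c (l * 2)) Ω)
    (hbd : ∀ᵐ y, y ∈ Metric.ball c (l * 2) → |u y| ≤ M)
    (htail : ENNReal.ofReal (l ^ (sp * p)) * ∫⁻ y in (Metric.ball c (l * 2))ᶜ,
      ENNReal.ofReal (|u y| ^ (p - 1) / ‖y - c‖ ^ ((N : ℝ) + sp * p)) ≤ ENNReal.ofReal (M ^ (p - 1)))
    (henergy : ∫⁻ z in Metric.ball c (l * 2) ×ˢ Metric.ball c (l * 2), energyDensity p (sp * p) u z ≤
      ENNReal.ofReal (M ^ p * l ^ ((N : ℝ) - sp * p)))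
    (hε : l ^ (sp * p - s₁) ≤ M ^ (p - 1)) :
    ∃ w : RN N → ℝ, w =ᵐ[volume] (fun x => u (c + l • x) / M) ∧ NormalizedSolution p s₁ sp w := by
  obtain ⟨hW1, -, ⟨hum, -⟩, Z, hZ, hZs, heq⟩ := hu
  have hq1 := quasiMeasurePreserving_affine (volume : Measure (RN N)) c hl
  have hq2 := quasiMeasurePreserving_affine (volume : Measure (RN N × RN N)) (c, c) hl
  have hM1 : 0 < M ^ (p - 1) := by positivity
  have hmemB : ∀ x : RN N, x ∈ Metric.ball (0 : RN N) 2 ↔ c + l • x ∈ Metric.ball c (l * 2) :=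
    fun x => (affine_mem_ball_iff c x hl 2).symm
  have hmemBB : ∀ z : RN N × RN N, z ∈ Metric.ball (0 : RN N) 2 ×ˢ Metric.ball (0 : RN N) 2 ↔
      (c, c) + l • z ∈ Metric.ball c (l * 2) ×ˢ Metric.ball c (l * 2) := by
    intro z
    rw [Set.mem_prod, Set.mem_prod, hmemB, hmemB]
    rfl
  have hBB := (measurableSet_ball (x := (0 : RN N)) (ε := 2)).prod
    (measurableSet_ball (x := (0 : RN N)) (ε := 2))
  have hBB' := (measurableSet_ball (x := c) (ε := l * 2)).prod
    (measurableSet_ball (x := c) (ε := l * 2))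
  have hscale : ∀ q a : ℝ, ∫⁻ z in Metric.ball (0 : RN N) 2 ×ˢ Metric.ball (0 : RN N) 2,
      energyDensity q a (fun x => u (c + l • x) / M) z = ENNReal.ofReal (l ^ (a - N) / M ^ q) *
        ∫⁻ z in Metric.ball c (l * 2) ×ˢ Metric.ball c (l * 2), energyDensity q a u z := by
    intro q a
    simp_rw [energyDensity_comp_affine q a u c hl hM]
    rw [lintegral_const_mul' _ _ ENNReal.ofReal_ne_top,
      setLIntegral_comp_affine volume _ (c, c) hl hBB hBB' hmemBB, ← mul_assoc,
      ← ENNReal.ofReal_mul (by positivity)]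
    congr 2
    have hfr : Module.finrank ℝ (RN N × RN N) = N + N := by simp
    rw [hfr, ← Real.rpow_natCast, Nat.cast_add, ← Real.rpow_neg hl.le, div_mul_eq_mul_div,
      ← Real.rpow_add hl]
    congr 2; ring
  refine _root_.exists_normalizedSolution (ε := l ^ (sp * p - s₁) / M ^ (p - 1))
    (Z := fun z => Z ((c, c) + l • z)) ?_ ?_ ?_ ?_ ?_ ⟨by positivity, (div_le_one hM1).mpr hε⟩ ?_ ?_ ?_
  · simp_rw [div_eq_mul_inv]
    exact (hum.comp_quasiMeasurePreserving hq1).mul_const _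
  · filter_upwards [hq1.ae hbd] with x hx hx2
    rw [abs_div, abs_of_pos hM, div_le_one hM]
    exact hx ((hmemB x).mp hx2)
  · have h1 : ∀ x : RN N, ENNReal.ofReal (|u (c + l • x) / M| ^ (p - 1) / ‖x‖ ^ ((N : ℝ) + sp * p)) =
        ENNReal.ofReal (l ^ ((N : ℝ) + sp * p) / M ^ (p - 1)) * (fun y => ENNReal.ofReal
          (|u y| ^ (p - 1) / ‖y - c‖ ^ ((N : ℝ) + sp * p))) (c + l • x) := by
      intro x
      simp only [add_sub_cancel_left]
      rw [← ENNReal.ofReal_mul (by positivity), norm_smul, Real.norm_of_nonneg hl.le,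
        Real.mul_rpow hl.le (norm_nonneg _), abs_div, abs_of_pos hM,
        Real.div_rpow (abs_nonneg _) hM.le]
      congr 1
      have : l ^ ((N : ℝ) + sp * p) ≠ 0 := by positivity
      field_simp
    rw [lintegral_congr h1, lintegral_const_mul' _ _ ENNReal.ofReal_ne_top,
      setLIntegral_comp_affine volume (fun y => ENNReal.ofReal
          (|u y| ^ (p - 1) / ‖y - c‖ ^ ((N : ℝ) + sp * p))) c hl measurableSet_ball.compl
        (measurableSet_ball (x := c) (ε := l * 2)).compl (fun x => not_congr (hmemB x)),
      ← mul_assoc, ← ENNReal.ofReal_mul (by positivity)]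
    have hfr : Module.finrank ℝ (RN N) = N := by simp
    have h2 : l ^ ((N : ℝ) + sp * p) / M ^ (p - 1) * (l ^ Module.finrank ℝ (RN N))⁻¹ =
        (M ^ (p - 1))⁻¹ * l ^ (sp * p) := by
      rw [hfr, Real.rpow_add hl, Real.rpow_natCast]
      field_simp
    rw [h2, ENNReal.ofReal_mul (by positivity), mul_assoc]
    refine (mul_le_mul_right htail _).trans (le_of_eq ?_)
    rw [← ENNReal.ofReal_mul (by positivity), inv_mul_cancel₀ hM1.ne', ENNReal.ofReal_one]
  · refine le_trans (le_of_eq (hscale p (sp * p))) ?_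
    refine (mul_le_mul_right henergy _).trans (le_of_eq ?_)
    rw [← ENNReal.ofReal_mul (by positivity), ← ENNReal.ofReal_one]
    congr 1
    have h1 : l ^ (sp * p - N) * l ^ ((N : ℝ) - sp * p) = 1 := by
      rw [← Real.rpow_add hl]; simp
    have h2 : M ^ p ≠ 0 := by positivity
    field_simp
    exact h1
  · refine lt_of_le_of_lt (le_of_eq (hscale 1 (s₁ * 1))) ?_
    refine ENNReal.mul_lt_top ENNReal.ofReal_lt_top ?_
    have := (hW1 _ Metric.isOpen_ball hball).2
    unfold gagliardo at this
    simpa [energyDensity] using this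
  · exact hZ.1.comp_quasiMeasurePreserving hq2
  · filter_upwards [hq2.ae hZs] with z hz
    have h1 : ∀ t : ℝ, sgnSet (t / M) = sgnSet t := by
      intro t
      unfold sgnSet
      by_cases ht : t = 0
      · simp [ht]
      · have htM : t / M ≠ 0 := by positivity
        rw [if_neg ht, if_neg htM, abs_div, abs_of_pos hM]
        congr 1
        have : |t| ≠ 0 := abs_ne_zero.mpr ht
        field_simp
    rw [← sub_div, h1]
    exact hz
  · intro φ hφ
    have hφ' := hφ.comp_affine (by linarith : 0 < p) c hl (Ω' := Ω)
      (fun x hx => hball.2 (subset_closure ((hmemB x).mp hx)))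
    have h0 := heq _ hφ'
    have hφT : ∀ x : RN N, φ (-(l⁻¹ • c) + l⁻¹ • (c + l • x)) = φ x := by
      intro x
      congr 1
      rw [smul_add, smul_smul, inv_mul_cancel₀ hl.ne', one_smul]
      abel
    have hn : ∀ (z : RN N × RN N) (τ : ℝ), ‖c + l • z.1 - (c + l • z.2)‖ ^ τ =
        l ^ τ * ‖z.1 - z.2‖ ^ τ := by
      intro z τ
      rw [add_sub_add_left_eq_sub, ← smul_sub, norm_smul, Real.norm_of_nonneg hl.le,
        Real.mul_rpow hl.le (norm_nonneg _)]
    set I₁ := ∫ z : RN N × RN N, Z ((c, c) + l • z) * (φ z.1 - φ z.2) /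
      ‖z.1 - z.2‖ ^ ((N : ℝ) + s₁) with hI₁
    set I₂ := ∫ z : RN N × RN N, |u (c + l • z.1) / M - u (c + l • z.2) / M| ^ (p - 2) *
      (u (c + l • z.1) / M - u (c + l • z.2) / M) * (φ z.1 - φ z.2) /
          ‖z.1 - z.2‖ ^ ((N : ℝ) + sp * p) with hI₂
    set ψ : RN N → ℝ := fun y => φ (-(l⁻¹ • c) + l⁻¹ • y) with hψ
    have e1 := integral_comp_affine (volume : Measure (RN N × RN N))
      (fun z => Z z * (ψ z.1 - ψ z.2) / ‖z.1 - z.2‖ ^ ((N : ℝ) + s₁)) (c, c) hl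
    have e2 := integral_comp_affine (volume : Measure (RN N × RN N))
      (fun z => |u z.1 - u z.2| ^ (p - 2) * (u z.1 - u z.2) * (ψ z.1 - ψ z.2) /
          ‖z.1 - z.2‖ ^ ((N : ℝ) + sp * p)) (c, c) hl
    simp only [Prod.fst_add, Prod.snd_add, Prod.smul_fst, Prod.smul_snd, hψ, hφT, hn] at e1 e2
    have f1 : ∫ z : RN N × RN N, Z ((c, c) + l • z) * (φ z.1 - φ z.2) /
        (l ^ ((N : ℝ) + s₁) * ‖z.1 - z.2‖ ^ ((N : ℝ) + s₁)) = (l ^ ((N : ℝ) + s₁))⁻¹ * I₁ := by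
      rw [hI₁, ← integral_const_mul]
      refine integral_congr_ae (Filter.Eventually.of_forall fun z => ?_)
      simp only
      rw [div_mul_eq_div_div_swap]
      ring
    have f2 : ∫ z : RN N × RN N, |u (c + l • z.1) - u (c + l • z.2)| ^ (p - 2) *
        (u (c + l • z.1) - u (c + l • z.2)) * (φ z.1 - φ z.2) /
        (l ^ ((N : ℝ) + sp * p) * ‖z.1 - z.2‖ ^ ((N : ℝ) + sp * p)) =
        (l ^ ((N : ℝ) + sp * p))⁻¹ * M ^ (p - 1) * I₂ := by
      rw [hI₂, ← integral_const_mul]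
      refine integral_congr_ae (Filter.Eventually.of_forall fun z => ?_)
      simp only
      have h1 := oddPow_div (b := p - 2) hM (u (c + l • z.1) - u (c + l • z.2))
      unfold oddPow at h1
      rw [← sub_div, h1, div_mul_eq_div_div_swap, show p - 2 + 1 = p - 1 by ring]
      field_simp
    rw [f1] at e1
    rw [f2] at e2
    have hL : 0 < (l ^ Module.finrank ℝ (RN N × RN N))⁻¹ := by positivity
    have h3 : (l ^ ((N : ℝ) + s₁))⁻¹ * I₁ + (l ^ ((N : ℝ) + sp * p))⁻¹ * M ^ (p - 1) * I₂ = 0 := by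
      rw [e1, e2, ← mul_add, ← h0, mul_zero]
    have h4 : l ^ ((N : ℝ) + sp * p) * (l ^ ((N : ℝ) + s₁))⁻¹ = l ^ (sp * p - s₁) := by
      rw [← Real.rpow_neg hl.le, ← Real.rpow_add hl]; congr 1; ring
    have hl2 : l ^ ((N : ℝ) + sp * p) ≠ 0 := by positivity
    have h5 : l ^ (sp * p - s₁) * I₁ + M ^ (p - 1) * I₂ = 0 := by
      have : l ^ ((N : ℝ) + sp * p) * ((l ^ ((N : ℝ) + s₁))⁻¹ * I₁ +
          (l ^ ((N : ℝ) + sp * p))⁻¹ * M ^ (p - 1) * I₂) = 0 := by rw [h3, mul_zero]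
      rw [← h4]
      calc _ = l ^ ((N : ℝ) + sp * p) * ((l ^ ((N : ℝ) + s₁))⁻¹ * I₁ +
          (l ^ ((N : ℝ) + sp * p))⁻¹ * M ^ (p - 1) * I₂) := by field_simp
        _ = 0 := this
    have h6 : l ^ (sp * p - s₁) / M ^ (p - 1) * I₁ + I₂ =
        (l ^ (sp * p - s₁) * I₁ + M ^ (p - 1) * I₂) / M ^ (p - 1) := by
      field_simp
    rw [h6, h5, zero_div]

/-! ### Local integrability and Lebesgue points. -/

lemma CompactlyIn.mono {N : ℕ} {A B Ω : Set (RN N)} (h : CompactlyIn B Ω) (hAB : A ⊆ B) :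
    CompactlyIn A Ω :=
  ⟨h.1.of_isClosed_subset isClosed_closure (closure_mono hAB), (closure_mono hAB).trans h.2⟩

lemma MemTailSpace.locallyIntegrable {N : ℕ} {q a : ℝ} (hq : 1 ≤ q) {u : RN N → ℝ}
    (hu : MemTailSpace q a u) (ha : 0 ≤ a) : LocallyIntegrable u volume := by
  have hball : ∀ ρ : ℝ, 0 < ρ → IntegrableOn u (Metric.ball (0 : RN N) ρ) volume := by
    intro ρ hρ
    have hτ : 0 ≤ (N : ℝ) + a := by positivity
    refine ⟨hu.1.restrict, ?_⟩
    have hb : ∀ x ∈ Metric.ball (0 : RN N) ρ, ‖u x‖ₑ ≤ 1 + ENNReal.ofReal ((1 + ρ) ^ ((N : ℝ) + a)) *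
        ENNReal.ofReal (|u x| ^ q / (1 + ‖x‖) ^ ((N : ℝ) + a)) := by
      intro x hx
      rw [mem_ball_zero_iff] at hx
      rw [← ENNReal.ofReal_mul (by positivity), ← ENNReal.ofReal_one,
        ← ENNReal.ofReal_add zero_le_one (by positivity), ← ofReal_norm, Real.norm_eq_abs]
      refine ENNReal.ofReal_le_ofReal ?_
      have h1 : |u x| ≤ 1 + |u x| ^ q := by
        rcases le_total |u x| 1 with h | h
        · have : 0 ≤ |u x| ^ q := by positivity
          linarith
        · have := Real.rpow_le_rpow_of_exponent_le h hq
          rw [Real.rpow_one] at this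
          linarith
      have h2 : (1 + ‖x‖) ^ ((N : ℝ) + a) ≤ (1 + ρ) ^ ((N : ℝ) + a) := by gcongr
      have h3 : |u x| ^ q ≤ (1 + ρ) ^ ((N : ℝ) + a) * (|u x| ^ q / (1 + ‖x‖) ^ ((N : ℝ) + a)) := by
        have h0 : 0 < (1 + ‖x‖) ^ ((N : ℝ) + a) := by positivity
        rw [mul_div_assoc', le_div_iff₀ h0, mul_comm]
        gcongr
      linarith
    refine lt_of_le_of_lt (setLIntegral_mono' measurableSet_ball hb) ?_
    rw [lintegral_add_left measurable_const, lintegral_const_mul' _ _ ENNReal.ofReal_ne_top]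
    refine ENNReal.add_lt_top.mpr ⟨?_, ENNReal.mul_lt_top ENNReal.ofReal_lt_top ?_⟩
    · rw [setLIntegral_one]; exact measure_ball_lt_top
    · exact (setLIntegral_le_lintegral _ _).trans_lt hu.2
  intro x
  refine ⟨Metric.ball 0 (‖x‖ + 1), Metric.isOpen_ball.mem_nhds (by simp), hball _ (by positivity)⟩

/-- The points at which the averages of `u` over shrinking balls converge to the value of `u`. -/
def lebesguePoints {N : ℕ} (u : RN N → ℝ) : Set (RN N) :=
  {x | Tendsto (fun ρ => ⨍ y in Metric.closedBall x ρ, u y) (𝓝[>] 0) (𝓝 (u x))}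

lemma ae_mem_lebesguePoints {N : ℕ} {u : RN N → ℝ} (hu : LocallyIntegrable u volume) :
    ∀ᵐ x, x ∈ lebesguePoints u := by
  filter_upwards [IsUnifLocDoublingMeasure.ae_tendsto_average volume hu 1] with x hx
  refine hx (l := 𝓝[>] 0) (fun _ => x) (fun ρ => ρ) tendsto_id ?_
  filter_upwards [self_mem_nhdsWithin] with ρ hρ
  exact Metric.mem_closedBall_self (by simpa using le_of_lt hρ)

/-- Averages over small balls lie in the closed convex set `[-M, M]`, hence so does their limit. -/
lemma abs_le_of_mem_lebesguePoints {N : ℕ} {u : RN N → ℝ} (hu : LocallyIntegrable u volume)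
    {U : Set (RN N)} (hU : IsOpen U) {M : ℝ} (hbd : ∀ᵐ y, y ∈ U → |u y| ≤ M) {x : RN N}
    (hx : x ∈ lebesguePoints u) (hxU : x ∈ U) : |u x| ≤ M := by
  obtain ⟨ε, hε, hεU⟩ := Metric.isOpen_iff.mp hU x hxU
  have hmem : u x ∈ Set.Icc (-M) M := by
    refine isClosed_Icc.mem_of_tendsto hx ?_
    filter_upwards [Ioo_mem_nhdsGT hε] with ρ hρ
    have hsub : Metric.closedBall x ρ ⊆ U := (Metric.closedBall_subset_ball hρ.2).trans hεU
    refine (convex_Icc (-M) M).set_average_mem isClosed_Icc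
      (Metric.measure_closedBall_pos volume x hρ.1).ne' measure_closedBall_lt_top.ne ?_
      (hu.integrableOn_isCompact (isCompact_closedBall x ρ))
    filter_upwards [ae_restrict_mem Metric.isClosed_closedBall.measurableSet,
      ae_restrict_of_ae hbd] with y h1 h2
    exact abs_le.mp (h2 (hsub h1))
  exact abs_le.mpr hmem

lemma ae_abs_le_of_eLpNorm_top_le {N : ℕ} {u : RN N → ℝ} {U : Set (RN N)} (hU : MeasurableSet U)
    {M : ℝ} (hM : 0 ≤ M) (h : eLpNorm u ∞ (volume.restrict U) ≤ ENNReal.ofReal M) :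
    ∀ᵐ y, y ∈ U → |u y| ≤ M := by
  rw [← ae_restrict_iff' hU]
  rw [eLpNorm_exponent_top] at h
  filter_upwards [ae_le_eLpNormEssSup (f := u) (μ := volume.restrict U)] with y hy
  have := hy.trans h
  rwa [← ofReal_norm, ENNReal.ofReal_le_ofReal_iff hM] at this

/-! ### Quantitative normalization at interior points. -/

section rescaling

variable {N : ℕ} {p s₁ sp : ℝ} {u : RN N → ℝ} {x₀ x : RN N} {R d A M : ℝ}

/-- The tail at an interior point is controlled by the supremum and the tail of the larger ball. -/
lemma lintegral_tail_le (hsp : 0 < sp) (hp : 2 ≤ p) (hd : 0 < d) (hR : 0 < R)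
    (hA : 1 ≤ A) (hRA : R ≤ A * d) (hx : ‖x - x₀‖ ≤ R - d) (hM : 0 ≤ M)
    (hbd : ∀ᵐ y, y ∈ Metric.ball x₀ R → |u y| ≤ M)
    (htail : tail sp p u x₀ R ≤ ENNReal.ofReal M) :
    ENNReal.ofReal ((d / 2) ^ (sp * p)) * ∫⁻ y in (Metric.ball x d)ᶜ,
      ENNReal.ofReal (|u y| ^ (p - 1) / ‖y - x‖ ^ ((N : ℝ) + sp * p)) ≤
    ENNReal.ofReal (((volume (Metric.ball (0 : RN N) 1)).toReal + 1) * A ^ ((N : ℝ) + sp * p) *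
      M ^ (p - 1)) := by
  set V := (volume (Metric.ball (0 : RN N) 1)).toReal with hV
  set τ : ℝ := (N : ℝ) + sp * p with hτ
  have hspp : 0 < sp * p := by positivity
  have hτ0 : 0 < τ := by positivity
  have hp1 : 0 < p - 1 := by linarith
  have hdR : d ≤ R := by have := (norm_nonneg (x - x₀)).trans hx; linarith
  set F : RN N → ℝ≥0∞ := fun y => ENNReal.ofReal (|u y| ^ (p - 1) / ‖y - x‖ ^ τ) with hF
  -- Inside the large ball use the supremum and the volume; outside it `‖y - x₀‖ ≤ A ‖y - x‖`, so
  -- the original tail applies.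
  have hsplit : ∫⁻ y in (Metric.ball x d)ᶜ, F y ≤
      (∫⁻ y in Metric.ball x₀ R ∩ (Metric.ball x d)ᶜ, F y) + ∫⁻ y in (Metric.ball x₀ R)ᶜ, F y := by
    refine (lintegral_mono_set ?_).trans (lintegral_union_le _ _ _)
    intro y hy
    by_cases h : y ∈ Metric.ball x₀ R
    · exact Or.inl ⟨h, hy⟩
    · exact Or.inr h
  have hin : ∫⁻ y in Metric.ball x₀ R ∩ (Metric.ball x d)ᶜ, F y ≤
      ENNReal.ofReal (M ^ (p - 1) / d ^ τ * (R ^ N * V)) := by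
    have hb : ∀ᵐ y, y ∈ Metric.ball x₀ R ∩ (Metric.ball x d)ᶜ →
        F y ≤ ENNReal.ofReal (M ^ (p - 1) / d ^ τ) := by
      filter_upwards [hbd] with y hy hmem
      have h1 : d ≤ ‖y - x‖ := by simpa [dist_eq_norm] using hmem.2
      refine ENNReal.ofReal_le_ofReal ?_
      have := hy hmem.1
      gcongr
    refine (setLIntegral_mono_ae' (measurableSet_ball.inter measurableSet_ball.compl) hb).trans ?_
    rw [setLIntegral_const, ENNReal.ofReal_mul (by positivity)]
    gcongr
    refine (measure_mono Set.inter_subset_left).trans ?_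
    rw [Measure.addHaar_ball_of_pos volume x₀ hR, ENNReal.ofReal_mul (by positivity), hV,
      ENNReal.ofReal_toReal measure_ball_lt_top.ne]
    simp
  have hout : ∫⁻ y in (Metric.ball x₀ R)ᶜ, F y ≤ ENNReal.ofReal (A ^ τ) *
      ∫⁻ y in (Metric.ball x₀ R)ᶜ, ENNReal.ofReal (|u y| ^ (p - 1) / ‖y - x₀‖ ^ τ) := by
    rw [← lintegral_const_mul' _ _ ENNReal.ofReal_ne_top]
    refine setLIntegral_mono' measurableSet_ball.compl fun y hy => ?_
    rw [← ENNReal.ofReal_mul (by positivity)]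
    refine ENNReal.ofReal_le_ofReal ?_
    have hy' : R ≤ ‖y - x₀‖ := by simpa [dist_eq_norm] using hy
    have htri : ‖y - x₀‖ ≤ ‖y - x‖ + ‖x - x₀‖ := by
      simpa using norm_add_le (y - x) (x - x₀)
    have h1 : d ≤ ‖y - x‖ := by linarith
    have h2 : ‖y - x₀‖ ≤ A * ‖y - x‖ := by nlinarith
    have h3 : 0 < ‖y - x₀‖ := by linarith
    have h4 : 0 < ‖y - x‖ := by linarith
    have h5 : ‖y - x₀‖ ^ τ ≤ A ^ τ * ‖y - x‖ ^ τ := by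
      rw [← Real.mul_rpow (by linarith) h4.le]; gcongr
    rw [mul_div_assoc', div_le_div_iff₀ (by positivity) (by positivity)]
    calc |u y| ^ (p - 1) * ‖y - x₀‖ ^ τ ≤ |u y| ^ (p - 1) * (A ^ τ * ‖y - x‖ ^ τ) := by gcongr
      _ = A ^ τ * |u y| ^ (p - 1) * ‖y - x‖ ^ τ := by ring
  have htail' : ENNReal.ofReal (R ^ (sp * p)) * ∫⁻ y in (Metric.ball x₀ R)ᶜ,
      ENNReal.ofReal (|u y| ^ (p - 1) / ‖y - x₀‖ ^ τ) ≤ ENNReal.ofReal (M ^ (p - 1)) := by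
    have := ENNReal.rpow_le_rpow htail hp1.le
    unfold tail at this
    rwa [← ENNReal.rpow_mul, one_div_mul_cancel hp1.ne', ENNReal.rpow_one,
      ENNReal.ofReal_rpow_of_nonneg hM hp1.le] at this
  have hlR : (d / 2) ^ (sp * p) ≤ R ^ (sp * p) := by gcongr; linarith
  have e1 : ENNReal.ofReal ((d / 2) ^ (sp * p)) * ENNReal.ofReal (M ^ (p - 1) / d ^ τ * (R ^ N * V)) ≤
      ENNReal.ofReal (V * A ^ τ * M ^ (p - 1)) := by
    rw [← ENNReal.ofReal_mul (by positivity)]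
    refine ENNReal.ofReal_le_ofReal ?_
    have h1 : (d / 2) ^ (sp * p) ≤ d ^ (sp * p) := by gcongr; linarith
    have h2 : (R / d) ^ N ≤ A ^ τ := by
      have : R / d ≤ A := by rwa [div_le_iff₀ hd]
      calc (R / d) ^ N ≤ A ^ N := by gcongr
        _ = A ^ (N : ℝ) := (Real.rpow_natCast A N).symm
        _ ≤ A ^ τ := Real.rpow_le_rpow_of_exponent_le hA (by linarith)
    have h3 : d ^ τ = d ^ N * d ^ (sp * p) := by
      rw [hτ, Real.rpow_add hd, Real.rpow_natCast]
    calc (d / 2) ^ (sp * p) * (M ^ (p - 1) / d ^ τ * (R ^ N * V))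
        ≤ d ^ (sp * p) * (M ^ (p - 1) / d ^ τ * (R ^ N * V)) := by gcongr
      _ = V * (R / d) ^ N * M ^ (p - 1) := by
        rw [h3, div_pow]
        have : 0 < d ^ (sp * p) := by positivity
        field_simp
      _ ≤ V * A ^ τ * M ^ (p - 1) := by gcongr
  calc ENNReal.ofReal ((d / 2) ^ (sp * p)) * ∫⁻ y in (Metric.ball x d)ᶜ, F y
      ≤ ENNReal.ofReal ((d / 2) ^ (sp * p)) * (ENNReal.ofReal (M ^ (p - 1) / d ^ τ * (R ^ N * V)) +
          ENNReal.ofReal (A ^ τ) * ∫⁻ y in (Metric.ball x₀ R)ᶜ,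
            ENNReal.ofReal (|u y| ^ (p - 1) / ‖y - x₀‖ ^ τ)) := by
        gcongr; exact hsplit.trans (add_le_add hin hout)
    _ ≤ ENNReal.ofReal (V * A ^ τ * M ^ (p - 1)) + ENNReal.ofReal (A ^ τ) *
          (ENNReal.ofReal (R ^ (sp * p)) * ∫⁻ y in (Metric.ball x₀ R)ᶜ,
            ENNReal.ofReal (|u y| ^ (p - 1) / ‖y - x₀‖ ^ τ)) := by
        rw [mul_add]
        refine add_le_add e1 ?_
        rw [mul_left_comm]
        gcongr
    _ ≤ ENNReal.ofReal (V * A ^ τ * M ^ (p - 1)) +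
          ENNReal.ofReal (A ^ τ) * ENNReal.ofReal (M ^ (p - 1)) := by gcongr
    _ = ENNReal.ofReal ((V + 1) * A ^ τ * M ^ (p - 1)) := by
        rw [← ENNReal.ofReal_mul (by positivity), ← ENNReal.ofReal_add (by positivity) (by positivity)]
        ring_nf

/-- Around an interior point, a weak solution rescales to a normalized one. -/
lemma IsWeakSolution.exists_rescaled (hN : 1 ≤ N) (hs₁ : s₁ ∈ Set.Ioo (0 : ℝ) 1) (hsp : 0 < sp)
    (hp : 2 ≤ p) {Ω : Set (RN N)} (hu : IsWeakSolution p s₁ sp Ω u) (hd : 0 < d) (hd1 : d ≤ 1)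
    (hA : 1 ≤ A * d) (hRA : R ≤ A * d) (hx : ‖x - x₀‖ ≤ R - d)
    (hball : CompactlyIn (Metric.ball x₀ R) Ω) (hM : 1 ≤ M)
    (hT : supTail sp p u x₀ R + gagliardo sp p (Metric.ball x₀ R) u ≤ ENNReal.ofReal M) :
    ∃ w : RN N → ℝ, w =ᵐ[volume] (fun z => u (x + (d / 2) • z) /
        (((volume (Metric.ball (0 : RN N) 1)).toReal + 2 ^ N) * A ^ ((N : ℝ) + sp * p) * M)) ∧
      NormalizedSolution p s₁ sp w := by
  set V := (volume (Metric.ball (0 : RN N) 1)).toReal with hV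
  have hV0 : 0 ≤ V := ENNReal.toReal_nonneg
  set τ : ℝ := (N : ℝ) + sp * p with hτ
  have hspp : 0 < sp * p := by positivity
  have hN1 : (1 : ℝ) ≤ N := by exact_mod_cast hN
  have hτ1 : 1 ≤ τ := by linarith
  have hdR : d ≤ R := by have := (norm_nonneg (x - x₀)).trans hx; linarith
  have hR : 0 < R := by linarith
  have hA1 : 1 ≤ A := by
    by_contra! h
    nlinarith
  have hM0 : 0 ≤ M := by linarith
  have h2N : (2 : ℝ) ≤ 2 ^ N := by simpa using pow_le_pow_right₀ (by norm_num : (1 : ℝ) ≤ 2) hN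
  have hAτ : A ≤ A ^ τ := by simpa using Real.rpow_le_rpow_of_exponent_le hA1 hτ1
  have hAτ1 : 1 ≤ A ^ τ := hA1.trans hAτ
  -- Large enough for every normalization: it dominates `(V + 1) A^τ` for the tail, `(2A)^N` for the
  -- energy, and `2A ≥ 1 / (d / 2)` for `ε`.
  set c : ℝ := (V + 2 ^ N) * A ^ τ with hc
  have hcA : 2 * A ≤ c := mul_le_mul (by linarith) hAτ (by linarith) (by linarith)
  have hc1 : 1 ≤ c := by linarith
  have hcM : c ≤ c * M := le_mul_of_one_le_right (by linarith) hM
  have hsub : Metric.ball x (d / 2 * 2) ⊆ Metric.ball x₀ R := by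
    rw [div_mul_cancel₀ _ (two_ne_zero)]
    intro y hy
    rw [mem_ball_iff_norm] at hy ⊢
    have : ‖y - x₀‖ ≤ ‖y - x‖ + ‖x - x₀‖ := by simpa using norm_add_le (y - x) (x - x₀)
    linarith
  have hsup : eLpNorm u ∞ (volume.restrict (Metric.ball x₀ R)) ≤ ENNReal.ofReal M :=
    le_self_add.trans (le_self_add.trans hT)
  have htail : tail sp p u x₀ R ≤ ENNReal.ofReal M :=
    le_add_self.trans (le_self_add.trans hT)
  have hgag : gagliardo sp p (Metric.ball x₀ R) u ≤ ENNReal.ofReal M := le_add_self.trans hT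
  have hbd := ae_abs_le_of_eLpNorm_top_le measurableSet_ball hM0 hsup
  have hl : 1 / (d / 2) ≤ 2 * A := by rw [div_le_iff₀ (by positivity)]; linarith
  refine hu.exists_normalizedSolution hp (by positivity) (by nlinarith) (hball.mono hsub) ?_ ?_ ?_ ?_
  · filter_upwards [hbd] with y hy hmem
    exact (hy (hsub hmem)).trans (le_mul_of_one_le_left hM0 hc1)
  · rw [div_mul_cancel₀ _ (two_ne_zero)]
    refine (lintegral_tail_le hsp hp hd hR hA1 hRA hx hM0 hbd htail).trans
      (ENNReal.ofReal_le_ofReal ?_)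
    rw [Real.mul_rpow (by linarith) hM0]
    have h1 : (V + 1) * A ^ τ ≤ c := by rw [hc]; gcongr; linarith
    have h2 : c ≤ c ^ (p - 1) := by
      simpa using Real.rpow_le_rpow_of_exponent_le hc1 (show (1 : ℝ) ≤ p - 1 by linarith)
    gcongr
    exact h1.trans h2
  · have h1 : ∫⁻ z in Metric.ball x₀ R ×ˢ Metric.ball x₀ R, energyDensity p (sp * p) u z ≤
        ENNReal.ofReal (M ^ p) := by
      have := ENNReal.rpow_le_rpow hgag (show 0 ≤ p by linarith)
      unfold gagliardo at this
      rwa [← ENNReal.rpow_mul, one_div_mul_cancel (by linarith), ENNReal.rpow_one,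
        ENNReal.ofReal_rpow_of_nonneg hM0 (by linarith)] at this
    refine (lintegral_mono_set (Set.prod_mono hsub hsub)).trans (h1.trans
      (ENNReal.ofReal_le_ofReal ?_))
    rw [Real.mul_rpow (by linarith) hM0]
    have h2 : ((2 * A) ^ N)⁻¹ ≤ (d / 2) ^ ((N : ℝ) - sp * p) := by
      calc ((2 * A) ^ N)⁻¹ ≤ ((1 / (d / 2)) ^ N)⁻¹ := by
            gcongr
        _ = (d / 2) ^ (N : ℝ) := by rw [Real.rpow_natCast, one_div, inv_pow, inv_inv]
        _ ≤ (d / 2) ^ ((N : ℝ) - sp * p) :=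
            Real.rpow_le_rpow_of_exponent_ge (by positivity) (by linarith) (by linarith)
    have h3 : (2 * A) ^ N ≤ c ^ p := by
      have : (2 * A) ^ N ≤ c := by
        rw [mul_pow, hc]
        have : A ^ N ≤ A ^ τ := by
          rw [← Real.rpow_natCast]; exact Real.rpow_le_rpow_of_exponent_le hA1 (by linarith)
        gcongr
        linarith
      refine this.trans ?_
      simpa using Real.rpow_le_rpow_of_exponent_le hc1 (show (1 : ℝ) ≤ p by linarith)
    have h4 : 1 ≤ c ^ p * (d / 2) ^ ((N : ℝ) - sp * p) := by
      calc (1 : ℝ) = (2 * A) ^ N * ((2 * A) ^ N)⁻¹ := by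
            rw [mul_inv_cancel₀]; positivity
        _ ≤ _ := by gcongr
    calc M ^ p = M ^ p * 1 := (mul_one _).symm
      _ ≤ M ^ p * (c ^ p * (d / 2) ^ ((N : ℝ) - sp * p)) := by gcongr
      _ = _ := by ring
  -- As `s₁ < 1` and `sp * p > 0`, the exponent exceeds `-1`; thus `ε ≤ 1` follows from `2A ≤ c` for
  -- every `s₁`.
  · have h1 : (d / 2) ^ (sp * p - s₁) ≤ (d / 2) ^ (-1 : ℝ) :=
      Real.rpow_le_rpow_of_exponent_ge (by positivity) (by linarith) (by linarith [hs₁.2])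
    have h2 : (d / 2) ^ (-1 : ℝ) = 1 / (d / 2) := by rw [Real.rpow_neg_one, one_div]
    have h3 : c * M ≤ (c * M) ^ (p - 1) := by
      simpa using Real.rpow_le_rpow_of_exponent_le (hc1.trans hcM) (show (1 : ℝ) ≤ p - 1 by linarith)
    linarith

end rescaling

/-! ### Hölder estimates for the original solution. -/

/-- The Hölder estimate at Lebesgue points. -/
lemma exists_holder_lebesguePoints {N : ℕ} (hN : 1 ≤ N) {p s₁ sp γ : ℝ} (hp : 2 ≤ p)
    (hs₁ : s₁ ∈ Set.Ioo (0 : ℝ) 1) (hsp : 0 < sp) (hsp1 : sp ≤ (p - 1) / p) (hγ0 : 0 < γ)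
    (hγ : γ < sp * p / (p - 1)) :
    ∃ C κ : ℝ, 0 < C ∧ ∀ (Ω : Set (RN N)) (u : RN N → ℝ), IsWeakSolution p s₁ sp Ω u →
      ∀ (x₀ : RN N) (R d A M : ℝ), 0 < d → d ≤ 1 → 1 ≤ A * d → R ≤ A * d →
        CompactlyIn (Metric.ball x₀ R) Ω → 1 ≤ M →
        supTail sp p u x₀ R + gagliardo sp p (Metric.ball x₀ R) u ≤ ENNReal.ofReal M →
        ∀ x y : RN N, x ∈ lebesguePoints u → y ∈ lebesguePoints u → ‖x - x₀‖ ≤ R - d →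
          ‖y - x₀‖ ≤ R - d → |u x - u y| ≤ C * A ^ κ * M * ‖x - y‖ ^ γ := by
  obtain ⟨α, q, hq, hα, hαγ, H⟩ := exists_nikolskiiBound hN hp hs₁ hsp hsp1 hγ
  obtain ⟨K, h₀, hK, hh₀, H⟩ := H 1 one_pos (by norm_num)
  obtain ⟨C, hC, hmor⟩ := exists_morrey (h₀ := h₀) hN hα hq hK (hγ0.trans hαγ)
  set V := (volume (Metric.ball (0 : RN N) 1)).toReal with hV
  have hV0 : 0 ≤ V := ENNReal.toReal_nonneg
  set τ : ℝ := (N : ℝ) + sp * p with hτ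
  have hτ0 : 0 ≤ τ := by positivity
  set c₀ : ℝ := min (1 / 4) (h₀ / 4) with hc₀
  have hc₀0 : 0 < c₀ := by positivity
  -- The summands treat near and far pairs. In the exponent, `τ` comes from the normalizing constant
  -- and `γ` from undoing the dilation, as `1 / l ≤ 2 A`.
  refine ⟨C * (V + 2 ^ N) * 2 ^ γ + 2 * (2 / c₀) ^ γ, τ + γ, by positivity, ?_⟩
  intro Ω u hu x₀ R d A M hd hd1 hA hRA hball hM hT x y hx hy hxR hyR
  have hA1 : 1 ≤ A := by
    by_contra! h
    nlinarith
  have hM0 : 0 ≤ M := by linarith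
  have hfint : LocallyIntegrable u volume :=
    hu.2.2.1.locallyIntegrable (by linarith) (by positivity)
  rcases eq_or_ne x y with rfl | hxy
  · simp only [sub_self, abs_zero]; positivity
  have hn : 0 < ‖x - y‖ := norm_pos_iff.mpr (sub_ne_zero.mpr hxy)
  have hAγ : A ^ γ ≤ A ^ (τ + γ) := Real.rpow_le_rpow_of_exponent_le hA1 (by linarith)
  rcases lt_or_ge (c₀ * (d / 2)) ‖x - y‖ with hfar | hnear
  · have hbd := ae_abs_le_of_eLpNorm_top_le measurableSet_ball hM0
      (le_self_add.trans (le_self_add.trans hT))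
    have hx1 := abs_le_of_mem_lebesguePoints hfint Metric.isOpen_ball hbd hx
      (by rw [mem_ball_iff_norm]; linarith)
    have hy1 := abs_le_of_mem_lebesguePoints hfint Metric.isOpen_ball hbd hy
      (by rw [mem_ball_iff_norm]; linarith)
    have h1 : 1 ≤ 2 / c₀ * A * ‖x - y‖ := by
      have : c₀ ≤ 2 * A * ‖x - y‖ := by nlinarith
      rw [div_mul_eq_mul_div, div_mul_eq_mul_div, le_div_iff₀ hc₀0]
      linarith
    have h2 : 1 ≤ (2 / c₀) ^ γ * A ^ γ * ‖x - y‖ ^ γ := by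
      rw [← Real.mul_rpow (by positivity) (by positivity),
        ← Real.mul_rpow (by positivity) (by positivity)]
      exact Real.one_le_rpow h1 hγ0.le
    calc |u x - u y| ≤ |u x| + |u y| := abs_sub _ _
      _ ≤ 2 * M * 1 := by linarith
      _ ≤ 2 * M * ((2 / c₀) ^ γ * A ^ γ * ‖x - y‖ ^ γ) := by gcongr
      _ ≤ 2 * M * ((2 / c₀) ^ γ * A ^ (τ + γ) * ‖x - y‖ ^ γ) := by gcongr
      _ = (0 + 2 * (2 / c₀) ^ γ) * A ^ (τ + γ) * M * ‖x - y‖ ^ γ := by ring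
      _ ≤ _ := by gcongr; positivity
  · obtain ⟨w, hw, hws⟩ := hu.exists_rescaled hN hs₁ hsp hp hd hd1 hA hRA hxR hball hM hT
    set M' : ℝ := (V + 2 ^ N) * A ^ τ * M with hM'
    have hM'0 : 0 < M' := by positivity
    set l : ℝ := d / 2 with hl
    have hl0 : 0 < l := by positivity
    have hlA : 1 / l ≤ 2 * A := by rw [div_le_iff₀ (by positivity), hl]; linarith
    set y' : RN N := l⁻¹ • (y - x) with hy'
    -- Averages ignore null sets, so the limits for the representative `w` are the rescaled values
    -- of `u` itself.
    have hlim : ∀ z : RN N, x + l • z ∈ lebesguePoints u →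
        Tendsto (fun ρ => ⨍ s in Metric.closedBall z ρ, w s) (𝓝[>] 0)
          (𝓝 (u (x + l • z) / M')) := by
      intro z hz
      have h1 : Tendsto (fun ρ : ℝ => l * ρ) (𝓝[>] 0) (𝓝[>] 0) := by
        refine tendsto_nhdsWithin_iff.mpr ⟨?_, ?_⟩
        · have : Tendsto (fun ρ : ℝ => l * ρ) (𝓝 0) (𝓝 (l * 0)) := by
            exact (continuous_const.mul continuous_id).tendsto 0
          rw [mul_zero] at this
          exact this.mono_left nhdsWithin_le_nhds
        · filter_upwards [self_mem_nhdsWithin] with ρ hρ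
          exact mul_pos hl0 hρ
      refine ((hz.comp h1).div_const M').congr fun ρ => ?_
      have h2 : ⨍ s in Metric.closedBall z ρ, w s = ⨍ s in Metric.closedBall z ρ, u (x + l • s) / M' :=
        average_congr (ae_restrict_of_ae hw)
      rw [h2, setAverage_comp_affine volume (fun t => u t / M') x z hl0 ρ]
      simp only [Function.comp]
      rw [setAverage_eq, setAverage_eq, integral_div, smul_eq_mul, smul_eq_mul, mul_div_assoc]
    have hxy' : x + l • y' = y := by
      rw [hy', smul_inv_smul₀ hl0.ne']; abel
    have hny : ‖y'‖ = ‖x - y‖ / l := by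
      rw [hy', norm_smul, norm_inv, Real.norm_of_nonneg hl0.le, norm_sub_rev, inv_mul_eq_div]
    have hyc : ‖y'‖ ≤ c₀ := by rw [hny, div_le_iff₀ hl0]; exact hnear
    have hy4 : ‖y'‖ ≤ 1 / 4 := hyc.trans (min_le_left _ _)
    have hyh : ‖y'‖ ≤ h₀ / 4 := hyc.trans (min_le_right _ _)
    have hyp : 0 < ‖y'‖ := by rw [hny]; positivity
    have hres := hmor w hws.measurable hws.abs_le_one (H w hws) 0 y' (u x / M') (u y / M')
      (norm_pos_iff.mp hyp).symm (by simp) (by linarith) (by simpa using hy4)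
      (by rw [zero_sub, norm_neg]; linarith)
      (by simpa using hlim 0 (by simpa using hx)) (by simpa [hxy'] using hlim y' (by rwa [hxy']))
    rw [zero_sub, norm_neg, ← sub_div, abs_div, abs_of_pos hM'0, div_le_iff₀ hM'0] at hres
    have h1 : ‖y'‖ ^ (α - N / q) ≤ (2 * A) ^ γ * ‖x - y‖ ^ γ := by
      calc ‖y'‖ ^ (α - N / q) ≤ ‖y'‖ ^ γ :=
            Real.rpow_le_rpow_of_exponent_ge hyp (by linarith) hαγ.le
        _ = (1 / l * ‖x - y‖) ^ γ := by rw [hny]; ring_nf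
        _ ≤ (2 * A * ‖x - y‖) ^ γ := by gcongr
        _ = _ := Real.mul_rpow (by positivity) (by positivity)
    calc |u x - u y| ≤ C * ‖y'‖ ^ (α - N / q) * M' := hres
      _ ≤ C * ((2 * A) ^ γ * ‖x - y‖ ^ γ) * M' := by gcongr
      _ = (C * (V + 2 ^ N) * 2 ^ γ + 0) * A ^ (τ + γ) * M * ‖x - y‖ ^ γ := by
        rw [hM', Real.mul_rpow (by norm_num) (by linarith), Real.rpow_add (by linarith) τ γ]; ring
      _ ≤ _ := by gcongr; positivity

lemma tail_lt_top {N : ℕ} {s p : ℝ} (hs : 0 ≤ s) (hp : 1 < p) {u : RN N → ℝ}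
    (hu : MemTailSpace (p - 1) (s * p) u) (x₀ : RN N) {R : ℝ} (hR : 0 < R) :
    tail s p u x₀ R < ∞ := by
  have hτ : 0 ≤ (N : ℝ) + s * p := by positivity
  refine ENNReal.rpow_lt_top_of_nonneg (by rw [one_div_nonneg]; linarith)
    (ENNReal.mul_lt_top ENNReal.ofReal_lt_top ?_).ne
  set c : ℝ := (1 + ‖x₀‖) / R + 1 with hc
  have hc0 : 0 < c := by positivity
  have hb : ∀ y ∈ (Metric.ball x₀ R)ᶜ,
      ENNReal.ofReal (|u y| ^ (p - 1) / ‖y - x₀‖ ^ ((N : ℝ) + s * p)) ≤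
        ENNReal.ofReal (c ^ ((N : ℝ) + s * p)) *
          ENNReal.ofReal (|u y| ^ (p - 1) / (1 + ‖y‖) ^ ((N : ℝ) + s * p)) := by
    intro y hy
    have hy' : R ≤ ‖y - x₀‖ := by simpa [dist_eq_norm] using hy
    have h0 : 0 < ‖y - x₀‖ := by linarith
    have h1 : ‖y‖ ≤ ‖y - x₀‖ + ‖x₀‖ := by simpa using norm_add_le (y - x₀) x₀
    have h2 : 1 + ‖x₀‖ ≤ (1 + ‖x₀‖) / R * ‖y - x₀‖ := by
      rw [div_mul_eq_mul_div, le_div_iff₀ hR]; gcongr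
    have h3 : 1 + ‖y‖ ≤ c * ‖y - x₀‖ := by rw [hc, add_mul, one_mul]; linarith
    have h4 : (1 + ‖y‖) ^ ((N : ℝ) + s * p) ≤
        c ^ ((N : ℝ) + s * p) * ‖y - x₀‖ ^ ((N : ℝ) + s * p) := by
      rw [← Real.mul_rpow hc0.le h0.le]; gcongr
    rw [← ENNReal.ofReal_mul (by positivity)]
    refine ENNReal.ofReal_le_ofReal ?_
    rw [mul_div_assoc', div_le_div_iff₀ (by positivity) (by positivity)]
    calc |u y| ^ (p - 1) * (1 + ‖y‖) ^ ((N : ℝ) + s * p)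
        ≤ |u y| ^ (p - 1) * (c ^ ((N : ℝ) + s * p) * ‖y - x₀‖ ^ ((N : ℝ) + s * p)) := by gcongr
      _ = _ := by ring
  refine (setLIntegral_mono' measurableSet_ball.compl hb).trans_lt ?_
  rw [lintegral_const_mul' _ _ ENNReal.ofReal_ne_top]
  exact ENNReal.mul_lt_top ENNReal.ofReal_lt_top ((setLIntegral_le_lintegral _ _).trans_lt hu.2)

lemma supTail_add_gagliardo_lt_top {N : ℕ} {p s₁ sp : ℝ} (hp : 1 < p) (hsp : 0 ≤ sp)
    {Ω : Set (RN N)} {u : RN N → ℝ} (hu : IsWeakSolution p s₁ sp Ω u) (hloc : LocallyBoundedOn Ω u)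
    {x₀ : RN N} {R : ℝ} (hR : 0 < R) (hball : CompactlyIn (Metric.ball x₀ R) Ω) :
    supTail sp p u x₀ R + gagliardo sp p (Metric.ball x₀ R) u < ∞ :=
  ENNReal.add_lt_top.mpr ⟨ENNReal.add_lt_top.mpr ⟨(hloc _ Metric.isOpen_ball hball).2,
    tail_lt_top hsp hp hu.2.2.1 x₀ hR⟩, (hu.2.1 _ Metric.isOpen_ball hball).2⟩

/-! ### Extension from a dense set. -/

section extension

variable {E : Type*} [SeminormedAddCommGroup E] {f : E → ℝ} {S U : Set E} {K γ : ℝ}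

/-- A function that is Hölder continuous on a dense part of an open set extends continuously. -/
lemma tendsto_extendFrom_of_holder (hS : Dense S) (hU : IsOpen U) (hK : 0 ≤ K) (hγ : 0 < γ)
    (H : ∀ x ∈ S ∩ U, ∀ y ∈ S ∩ U, |f x - f y| ≤ K * ‖x - y‖ ^ γ) {x : E} (hx : x ∈ U) :
    Tendsto f (𝓝[S] x) (𝓝 (extendFrom S f x)) := by
  have hne : (𝓝[S] x).NeBot := mem_closure_iff_nhdsWithin_neBot.mp (hS x)
  refine tendsto_extendFrom (cauchy_map_iff_exists_tendsto.mp (Metric.cauchy_iff.mpr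
    ⟨inferInstance, fun ε hε => ?_⟩))
  have hlim : Tendsto (fun δ : ℝ => K * (2 * δ) ^ γ) (𝓝[>] 0) (𝓝 0) := by
    have h1 : Continuous fun δ : ℝ => K * (2 * δ) ^ γ :=
      continuous_const.mul ((continuous_const.mul continuous_id).rpow_const fun _ => Or.inr hγ.le)
    have h2 := h1.tendsto 0
    rw [mul_zero, Real.zero_rpow hγ.ne', mul_zero] at h2
    exact h2.mono_left nhdsWithin_le_nhds
  obtain ⟨δ₀, hδ₀, hδU⟩ := Metric.isOpen_iff.mp hU x hx
  obtain ⟨δ, hδε, hδ⟩ := ((hlim.eventually (gt_mem_nhds hε)).and (Ioo_mem_nhdsGT hδ₀)).exists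
  have hmem : S ∩ Metric.ball x δ ∈ 𝓝[S] x :=
    inter_mem self_mem_nhdsWithin (nhdsWithin_le_nhds (Metric.ball_mem_nhds x hδ.1))
  have hsub : S ∩ Metric.ball x δ ⊆ S ∩ U :=
    Set.inter_subset_inter_right _ ((Metric.ball_subset_ball hδ.2.le).trans hδU)
  refine ⟨f '' (S ∩ Metric.ball x δ), image_mem_map hmem, ?_⟩
  rintro _ ⟨a, ha, rfl⟩ _ ⟨b, hb, rfl⟩
  refine lt_of_le_of_lt ?_ hδε
  rw [Real.dist_eq]
  refine (H a (hsub ha) b (hsub hb)).trans ?_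
  have h1 := mem_ball_iff_norm.mp ha.2
  have h2 := mem_ball_iff_norm.mp hb.2
  have h3 : ‖a - b‖ ≤ 2 * δ := by
    have := norm_sub_le (a - x) (b - x)
    rw [sub_sub_sub_cancel_right] at this
    linarith
  gcongr

/-- The filter `𝓝[S] x` does not exclude `x`, so for `x ∈ S` the limit along it must be `f x`. -/
lemma extendFrom_eq_of_holder (hS : Dense S) (hU : IsOpen U) (hK : 0 ≤ K) (hγ : 0 < γ)
    (H : ∀ x ∈ S ∩ U, ∀ y ∈ S ∩ U, |f x - f y| ≤ K * ‖x - y‖ ^ γ) {x : E} (hx : x ∈ S ∩ U) :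
    extendFrom S f x = f x :=
  tendsto_nhds_unique ((tendsto_extendFrom_of_holder hS hU hK hγ H hx.2).mono_left
    (pure_le_nhdsWithin hx.1)) (tendsto_pure_nhds f x)

lemma abs_extendFrom_sub_le (hS : Dense S) (hU : IsOpen U) (hK : 0 ≤ K) (hγ : 0 < γ)
    (H : ∀ x ∈ S ∩ U, ∀ y ∈ S ∩ U, |f x - f y| ≤ K * ‖x - y‖ ^ γ) {x y : E} (hx : x ∈ U)
    (hy : y ∈ U) : |extendFrom S f x - extendFrom S f y| ≤ K * ‖x - y‖ ^ γ := by
  have hnx : (𝓝[S] x).NeBot := mem_closure_iff_nhdsWithin_neBot.mp (hS x)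
  have hny : (𝓝[S] y).NeBot := mem_closure_iff_nhdsWithin_neBot.mp (hS y)
  have h1 := (tendsto_extendFrom_of_holder hS hU hK hγ H hx).comp
    (tendsto_fst (f := 𝓝[S] x) (g := 𝓝[S] y))
  have h2 := (tendsto_extendFrom_of_holder hS hU hK hγ H hy).comp
    (tendsto_snd (f := 𝓝[S] x) (g := 𝓝[S] y))
  have h3 : Tendsto (fun z : E × E => K * ‖z.1 - z.2‖ ^ γ) (𝓝[S] x ×ˢ 𝓝[S] y)
      (𝓝 (K * ‖x - y‖ ^ γ)) := by
    have hc : Continuous fun z : E × E => K * ‖z.1 - z.2‖ ^ γ :=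
      continuous_const.mul ((continuous_fst.sub continuous_snd).norm.rpow_const
        fun _ => Or.inr hγ.le)
    have := hc.tendsto (x, y)
    rw [nhds_prod_eq] at this
    exact this.mono_left (prod_mono nhdsWithin_le_nhds nhdsWithin_le_nhds)
  refine le_of_tendsto_of_tendsto (h1.sub h2).abs h3 ?_
  have hmem : ∀ z ∈ U, S ∩ U ∈ 𝓝[S] z := fun z hz =>
    inter_mem self_mem_nhdsWithin (nhdsWithin_le_nhds (hU.mem_nhds hz))
  filter_upwards [prod_mem_prod (hmem x hx) (hmem y hy)] with z hz
  exact H z.1 hz.1 z.2 hz.2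

end extension

lemma holderSeminorm_le {N : ℕ} {γ K : ℝ} {A : Set (RN N)} {v : RN N → ℝ}
    (H : ∀ x ∈ A, ∀ y ∈ A, |v x - v y| ≤ K * ‖x - y‖ ^ γ) :
    holderSeminorm γ A v ≤ ENNReal.ofReal K := by
  refine iSup₂_le fun x hx => iSup₂_le fun y hy => iSup_le fun hxy =>
    ENNReal.ofReal_le_ofReal ?_
  have hn : 0 < ‖x - y‖ := norm_pos_iff.mpr (sub_ne_zero.mpr hxy)
  rw [div_le_iff₀ (by positivity)]
  exact H x hx y hy

/-- The Hölder estimate on a ball, for the continuous representative. -/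
lemma exists_holder_extendFrom {N : ℕ} (hN : 1 ≤ N) {p s₁ sp γ : ℝ} (hp : 2 ≤ p)
    (hs₁ : s₁ ∈ Set.Ioo (0 : ℝ) 1) (hsp : 0 < sp) (hsp1 : sp ≤ (p - 1) / p) (hγ0 : 0 < γ)
    (hγ : γ < sp * p / (p - 1)) :
    ∃ C κ : ℝ, 0 < C ∧ ∀ (Ω : Set (RN N)) (u : RN N → ℝ), IsWeakSolution p s₁ sp Ω u →
      LocallyBoundedOn Ω u → ∀ (x₀ : RN N) (R d A : ℝ), 0 < d → d < R → d ≤ 1 → 1 ≤ A * d →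
        R ≤ A * d → CompactlyIn (Metric.ball x₀ R) Ω →
        (∀ x ∈ Metric.ball x₀ (R - d), x ∈ lebesguePoints u →
          extendFrom (lebesguePoints u) u x = u x) ∧
        ∀ x ∈ Metric.ball x₀ (R - d), ∀ y ∈ Metric.ball x₀ (R - d),
          |extendFrom (lebesguePoints u) u x - extendFrom (lebesguePoints u) u y| ≤
            C * A ^ κ * (supTail sp p u x₀ R + gagliardo sp p (Metric.ball x₀ R) u + 1).toReal *
              ‖x - y‖ ^ γ := by
  obtain ⟨C, κ, hC, H⟩ := exists_holder_lebesguePoints hN hp hs₁ hsp hsp1 hγ0 hγ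
  refine ⟨C, κ, hC, ?_⟩
  intro Ω u hu hloc x₀ R d A hd hdR hd1 hA hRA hball
  have hfin := supTail_add_gagliardo_lt_top (by linarith) hsp.le hu hloc (hd.trans hdR) hball
  have hne : supTail sp p u x₀ R + gagliardo sp p (Metric.ball x₀ R) u + 1 ≠ ∞ :=
    ENNReal.add_ne_top.mpr ⟨hfin.ne, ENNReal.one_ne_top⟩
  -- The added one gives `M ≥ 1`, as the rescaling requires.
  set M := (supTail sp p u x₀ R + gagliardo sp p (Metric.ball x₀ R) u + 1).toReal with hM
  have hM1 : 1 ≤ M := by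
    rw [hM, ← ENNReal.toReal_one]
    exact ENNReal.toReal_mono hne le_add_self
  have hT : supTail sp p u x₀ R + gagliardo sp p (Metric.ball x₀ R) u ≤ ENNReal.ofReal M := by
    rw [hM, ENNReal.ofReal_toReal hne]
    exact le_self_add
  have hA0 : 0 ≤ A := by
    by_contra! h
    nlinarith
  have hK : 0 ≤ C * A ^ κ * M := by positivity
  have hdense : Dense (lebesguePoints u) := Measure.dense_of_ae
    (ae_mem_lebesguePoints (hu.2.2.1.locallyIntegrable (by linarith) (by positivity)))
  have hH : ∀ x ∈ lebesguePoints u ∩ Metric.ball x₀ (R - d), ∀ y ∈ lebesguePoints u ∩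
      Metric.ball x₀ (R - d), |u x - u y| ≤ C * A ^ κ * M * ‖x - y‖ ^ γ := fun x hx y hy =>
    H Ω u hu x₀ R d A M hd hd1 hA hRA hball hM1 hT x y hx.1 hy.1 (mem_ball_iff_norm.mp hx.2).le
      (mem_ball_iff_norm.mp hy.2).le
  exact ⟨fun x hx hxL => extendFrom_eq_of_holder hdense Metric.isOpen_ball hK hγ0 hH ⟨hxL, hx⟩,
    fun x hx y hy => abs_extendFrom_sub_le hdense Metric.isOpen_ball hK hγ0 hH hx hy⟩

/-! ### Balls inside the domain, and conclusion. -/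

lemma CompactlyIn.exists_ball_add {N : ℕ} {Ω : Set (RN N)} (hΩ : IsOpen Ω) {x₀ : RN N} {R : ℝ}
    (hR : 0 < R) (h : CompactlyIn (Metric.ball x₀ R) Ω) :
    ∃ δ : ℝ, 0 < δ ∧ δ ≤ 1 ∧ CompactlyIn (Metric.ball x₀ (R + δ)) Ω := by
  rw [CompactlyIn, closure_ball x₀ hR.ne'] at h
  obtain ⟨δ, hδ, hsub⟩ := h.1.exists_cthickening_subset_open hΩ h.2
  refine ⟨min δ 1, by positivity, min_le_right _ _, ?_⟩
  have hne : R + min δ 1 ≠ 0 := by positivity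
  rw [CompactlyIn, closure_ball x₀ hne]
  refine ⟨isCompact_closedBall _ _, ?_⟩
  refine (Metric.closedBall_subset_closedBall ?_).trans
    ((cthickening_closedBall hδ.le hR.le x₀).symm.subset.trans hsub)
  have := min_le_left δ 1
  linarith

lemma IsOpen.exists_compactlyIn_ball {N : ℕ} {Ω : Set (RN N)} (hΩ : IsOpen Ω) {x : RN N}
    (hx : x ∈ Ω) : ∃ R : ℝ, 0 < R ∧ R ≤ 1 ∧ CompactlyIn (Metric.ball x R) Ω := by
  obtain ⟨ε, hε, hsub⟩ := Metric.isOpen_iff.mp hΩ x hx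
  have hpos : 0 < min (ε / 2) 1 := by positivity
  refine ⟨min (ε / 2) 1, hpos, min_le_right _ _, ?_⟩
  rw [CompactlyIn, closure_ball x hpos.ne']
  refine ⟨isCompact_closedBall _ _, (Metric.closedBall_subset_ball ?_).trans hsub⟩
  have := min_le_left (ε / 2) 1
  linarith

end holder

/-- The constants `C γ` and `κ γ` are chosen after `N, p, s₁, sp` only, hence depend on nothing but
these and `γ`. The function `v` is the continuous representative of `u` in `Ω`. -/
theorem corollary1p4 (N : ℕ) (hN : 2 ≤ N) (p s₁ sp : ℝ) (hp : 2 ≤ p)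
    (hs₁ : s₁ ∈ Set.Ioo (0 : ℝ) 1) (hsp : sp ∈ Set.Ioc (0 : ℝ) ((p - 1) / p)) :
    ∃ C κ : ℝ → ℝ,
      ∀ Ω : Set (RN N), IsOpen Ω → IsConnected Ω → Bornology.IsBounded Ω →
      ∀ u : RN N → ℝ, IsWeakSolution p s₁ sp Ω u → LocallyBoundedOn Ω u →
        ∃ v : RN N → ℝ, v =ᵐ[volume.restrict Ω] u ∧
          ∀ γ ∈ Set.Ioo (0 : ℝ) (sp * p / (p - 1)),
            MemHolderLoc γ Ω v ∧
            ∀ (x₀ : RN N) (R r : ℝ), R ∈ Set.Ioo (0 : ℝ) 1 → r ∈ Set.Ioo (0 : ℝ) R →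
              CompactlyIn (Metric.ball x₀ R) Ω →
              holderSeminorm γ (Metric.ball x₀ r) v ≤
                ENNReal.ofReal (C γ / (R - r) ^ κ γ) *
                  (supTail sp p u x₀ R + gagliardo sp p (Metric.ball x₀ R) u + 1) := by
  have hex := fun (γ : ℝ) (h0 : 0 < γ) (h1 : γ < sp * p / (p - 1)) =>
    exists_holder_extendFrom (N := N) (by omega) hp hs₁ hsp.1 hsp.2 h0 h1
  choose! C κ hC H using hex
  -- This representative is built from `u` alone, so one function serves all `γ`. To see that it
  -- agrees with `u` almost everywhere in `Ω`, any admissible exponent would do; half the limiting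
  -- one is used.
  refine ⟨C, κ, fun Ω hΩ _ _ u hu hloc => ⟨extendFrom (lebesguePoints u) u, ?_, ?_⟩⟩
  · have hpos : 0 < sp * p / (p - 1) :=
      div_pos (mul_pos hsp.1 (by linarith)) (by linarith)
    have hleb := ae_mem_lebesguePoints (u := u)
      (hu.2.2.1.locallyIntegrable (by linarith) (mul_nonneg hsp.1.le (by linarith)))
    filter_upwards [ae_restrict_mem hΩ.measurableSet, ae_restrict_of_ae hleb] with x hx hxL
    obtain ⟨R, hR, hR1, hball⟩ := hΩ.exists_compactlyIn_ball hx
    have hA : 1 ≤ 2 / R * (R / 2) := by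
      rw [div_mul_div_cancel₀ hR.ne']; norm_num
    exact (H _ (half_pos hpos) (half_lt_self hpos) Ω u hu hloc x R (R / 2) (2 / R) (half_pos hR)
      (half_lt_self hR) (by linarith) hA (hR1.trans hA) hball).1 x
      (Metric.mem_ball_self (by linarith)) hxL
  · rintro γ ⟨hγ0, hγ1⟩
    refine ⟨fun x₀ R hR hball => ?_, ?_⟩
    -- The estimate loses a margin `δ`, so it is applied on a slightly larger ball to reach all of
    -- the given one. This `R` may exceed one, hence the maximum in `A`.
    · obtain ⟨δ, hδ, hδ1, hball'⟩ := hball.exists_ball_add hΩ hR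
      have hA : max 1 (R + δ) / δ * δ = max 1 (R + δ) := div_mul_cancel₀ _ hδ.ne'
      have := (H γ hγ0 hγ1 Ω u hu hloc x₀ (R + δ) δ (max 1 (R + δ) / δ) hδ (by linarith) hδ1
        (by rw [hA]; exact le_max_left _ _) (by rw [hA]; exact le_max_right _ _) hball').2
      rw [add_sub_cancel_right] at this
      exact (holderSeminorm_le this).trans_lt ENNReal.ofReal_lt_top
    · rintro x₀ R r ⟨hR0, hR1⟩ ⟨hr0, hrR⟩ hball
      have hd : 0 < R - r := sub_pos.mpr hrR
      -- With margin `R - r` and `R < 1`, the choice `A = 1 / (R - r)` is admissible and `A ^ κ`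
      -- becomes the stated power.
      have hA : 1 / (R - r) * (R - r) = 1 := div_mul_cancel₀ _ hd.ne'
      have := (H γ hγ0 hγ1 Ω u hu hloc x₀ R (R - r) (1 / (R - r)) hd (by linarith) (by linarith)
        hA.ge (hR1.le.trans hA.ge) hball).2
      rw [sub_sub_cancel] at this
      have hfin := supTail_add_gagliardo_lt_top (by linarith) hsp.1.le hu hloc hR0 hball
      have hne : supTail sp p u x₀ R + gagliardo sp p (Metric.ball x₀ R) u + 1 ≠ ∞ :=
        ENNReal.add_ne_top.mpr ⟨hfin.ne, ENNReal.one_ne_top⟩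
      refine (holderSeminorm_le this).trans (le_of_eq ?_)
      have hCγ := hC γ hγ0 hγ1
      rw [ENNReal.ofReal_mul (by positivity), ENNReal.ofReal_toReal hne,
        Real.div_rpow zero_le_one hd.le, Real.one_rpow, mul_one_div]
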